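/- Let $p\ge 0$, $n\ge 0$ be integers and consider one of three cases, with $m=0,1,-1$ respectively: ($\mathrm{GL}$) $G_n=\mathrm{GL}_n(\mathbb C)$; ($\mathrm O$) $G_n=\mathrm O_n(\mathbb C)=\{h: h^{t}\beta h=\beta\}$ for a symmetric unitary matrix $\beta$; ($\mathrm{Sp}$) $G_n=\mathrm{Sp}_n(\mathbb C)=\{h: h^{t}\beta h=\beta\}$ for a skew-symmetric unitary matrix $\beta$ ($n$ even). Let $K_n\subset G_n$ be the subgroup of unitary elements ($\mathrm U_n$, $\mathrm O_n(\mathbb R)$, $\mathrm{USp}_n$). Put $U_p=\mathbb C^p$ in the $\mathrm{GL}$ case and $U_p=\mathbb C^p\oplus(\mathbb C^p)^*$ in the other two cases, where $U_p$ carries the anti-linear map $C(u\oplus\varphi)=\bar\varphi\oplus(\pm\bar u)$ ($+$ for $\mathrm O$, $-$ for $\mathrm{Sp}$) and $\mathbb C^n$ the anti-linear map $Tv=\overline{\beta v}$. Let $G_p=\mathrm{GL}(\mathbb C^p)$ in the $\mathrm{GL}$ case and $G_p=\{g\in \mathrm{GL}(U_p): gC=Cg\}$ ($\simeq\mathrm{GL}_{2p}(\mathbb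 R)$, resp. $\mathrm{GL}_p(\mathbb H)$) in the other two, and let $K_p\subset G_p$ be the subgroup of unitary elements ($\mathrm U_p$, $\mathrm O_{2p}(\mathbb R)$, $\mathrm{USp}_{2p}$). Let $X_{p,n}$ be the real vector space of structure-preserving linear maps $\mathbb C^n\to U_p$ (all linear maps for $\mathrm{GL}$; those $M$ with $CM=MT$ for $\mathrm O$, $\mathrm{Sp}$), and let $\psi:\mathrm{Hom}(\mathbb C^n,\mathbb C^p)\to X_{p,n}$ be the isomorphism $\psi(L)=L$ for $\mathrm{GL}$, $\psi(L)=L\oplus\overline L\,\beta$ for $\mathrm O$, $\mathrm{Sp}$. Assume $\mathrm{rank}(K_p)\le\mathrm{rank}(K_n)$, that is, $p\le n$ for $\mathrm{GL}$ and $2p\le n$ for $\mathrm O$, $\mathrm{Sp}$. Regard $U_p$ as a subspace of $\mathbb C^n$ by a structure-preserving isometry, so that $\mathbb C^n=U_p\oplus U_{n,p}$ is an orthogonal decomposition; let $\Pi\in X_{p,n}$, $\Pi\Pi^\dagger=1$, be the projector on $U_p$, and let $K_{n,p}=\{k\in K_n:\Pi k=\Pi\}$ be the subgroup of $K_n$ acting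 on $U_{n,p}$ only ($\simeq\mathrm U_{n-p}$, $\mathrm O_{n-2p}(\mathbb R)$, $\mathrm{USp}_{n-2p}$). Normalizations: $\mathrm{dvol}$ is the Euclidean (Lebesgue) measure on $\mathrm{Hom}(\mathbb C^n,\mathbb C^p)$ for the norm square $\mathrm{Tr}\,LL^\dagger$. The volumes $\mathrm{vol}(K_n)$, $\mathrm{vol}(K_{n,p})$ are with respect to the invariant measures that at the identity agree with the Euclidean volume density on the Lie algebra for the norm square $-(1+|m|)^{-1}\mathrm{Tr}_{\mathbb C^n}A^2$. The measure $dg_{K_p}$ is the $G_p$-invariant measure on $G_p/K_p$ which at the base point agrees with the Euclidean volume density, for the norm square $(1+|m|)^{-1}\mathrm{Tr}_{U_p}B^2$, on the tangent space of Hermitian elements $B\in\mathrm{Lie}(G_p)$. Let $f$ be a holomorphic function on $V=\mathrm{Hom}(\mathbb C^n,\mathbb C^p)\oplus\mathrm{Hom}(\mathbb C^p,\mathbb C^n)$ with $f(L\oplus\tilde L)=f(Lh\oplus h^{-1}\tilde L)$ for all $h\in G_n$, and suppose that $f_r(L):=f(L\oplus L^\dagger)$ is a Schwartz function on $\mathrm{Hom}(\mathbb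 C^n,\mathbb C^p)$. Let $J(g)=2^{p^2-pn}|\mathrm{Det}\,g|^{2n}$ for $\mathrm{GL}$ and $J(g)=2^{2p^2-pn}|\mathrm{Det}\,g|^{n}$ for $\mathrm O$, $\mathrm{Sp}$ (determinants on $U_p$). Then $g\mapsto f_r(\psi^{-1}(g\Pi))\,J(g)$ is a well-defined function on $G_p/K_p$, the integrals on both sides below converge absolutely, and $$\int_{\mathrm{Hom}(\mathbb C^n,\mathbb C^p)} f_r(L)\,\mathrm{dvol}(L)=\frac{\mathrm{vol}(K_n)}{\mathrm{vol}(K_{n,p})}\int_{G_p/K_p} f_r\circ\psi^{-1}(g\Pi)\,J(g)\,dg_{K_p}.$$ -/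

import Mathlib

open MeasureTheory Matrix Filter Topology
open scoped ENNReal

/-! ## Matrix spaces and matrix groups as measurable spaces -/

noncomputable instance Matrix.measurableSpaceComplex {α γ : Type} : MeasurableSpace (Matrix α γ ℂ) :=
  inferInstanceAs (MeasurableSpace (α → γ → ℂ))

/-- Lebesgue measure on complex matrices, with respect to the real and imaginary parts of the
entries.  It is the Euclidean volume of the norm square `Tr (L * Lᴴ)`. -/
noncomputable instance Matrix.measureSpaceComplex {α γ : Type} [Fintype α] [Fintype γ] :
    MeasureSpace (Matrix α γ ℂ) :=
  inferInstanceAs (MeasureSpace (α → γ → ℂ))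

instance Matrix.borelSpaceComplex {α γ : Type} [Fintype α] [Fintype γ] :
    BorelSpace (Matrix α γ ℂ) :=
  inferInstanceAs (BorelSpace (α → γ → ℂ))

instance Matrix.locallyCompactSpaceComplex {α γ : Type} [Fintype α] [Fintype γ] :
    LocallyCompactSpace (Matrix α γ ℂ) :=
  inferInstanceAs (LocallyCompactSpace (α → γ → ℂ))

section FrobeniusNorm

attribute [local instance] Matrix.frobeniusNormedAddCommGroup Matrix.frobeniusNormedSpace
  Matrix.frobeniusNormedRing Matrix.frobeniusNormedAlgebra

/-- `u` is a Schwartz function on the real vector space of complex `α × γ` matrices with the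
norm `L ↦ (Tr (L * Lᴴ)) ^ (1/2)`. -/
def IsSchwartz {α γ : Type} [Fintype α] [Fintype γ] (u : Matrix α γ ℂ → ℂ) : Prop :=
  ∃ φ : SchwartzMap (Matrix α γ ℂ) ℂ, ∀ L, φ L = u L

theorem Matrix.isEmbedding_val_GL {ι : Type} [Fintype ι] [DecidableEq ι] :
    IsEmbedding (Units.val : GL ι ℂ → Matrix ι ι ℂ) :=
  haveI : CompleteSpace (Matrix ι ι ℂ) := FiniteDimensional.complete ℂ _
  (Units.isOpenEmbedding_val (R := Matrix ι ι ℂ)).isEmbedding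

end FrobeniusNorm

instance Matrix.borelSpaceGL {ι : Type} [Fintype ι] [DecidableEq ι] : BorelSpace (GL ι ℂ) := by
  constructor
  rw [Matrix.isEmbedding_val_GL.eq_induced, borel_comap,
    ← BorelSpace.measurable_eq (α := Matrix ι ι ℂ)]
  rfl

/-! ## Invariant measures normalized by a trace form -/

section Normalization

variable {ι : Type} [Fintype ι] [DecidableEq ι]

/-- The trace form `‖A‖² = c⁻¹ Tr (A * Aᴴ)`; it is `-c⁻¹ Tr A²` for skew-Hermitian `A`, and
`c⁻¹ Tr A²` for Hermitian `A`. -/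
noncomputable def traceForm (c : ℕ) (A : Matrix ι ι ℂ) : ℝ :=
  (c : ℝ)⁻¹ * (trace (A * Aᴴ)).re

/-- The Lie algebra of a closed linear group: all `A` whose one-parameter group
`t ↦ exp (t A)` stays in the group. -/
def lieSet (K : Subgroup (GL ι ℂ)) : Set (Matrix ι ι ℂ) :=
  {A | ∀ t : ℝ, ∃ k ∈ K, (k : Matrix ι ι ℂ) = NormedSpace.exp (t • A)}

/-- The set of tangent vectors in `T` with trace form less than `r²`. -/
def traceBall (c : ℕ) (T : Set (Matrix ι ι ℂ)) (r : ℝ) : Set (Matrix ι ι ℂ) :=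
  {A | A ∈ T ∧ traceForm c A < r ^ 2}

/-- The Euclidean volume of the ball of radius `r` in a Euclidean space of the dimension of the
linear span of `T` (if `T` is a linear subspace, this is the volume of `traceBall c T r` in the
Euclidean structure given by the trace form). -/
noncomputable def ballVolume (T : Set (Matrix ι ι ℂ)) (r : ℝ) : ℝ≥0∞ :=
  volume (Metric.ball (0 : EuclideanSpace ℝ (Fin (T.finrank ℝ))) r)

/-- The density of the Haar measure of `K` at the identity, relative to the Euclidean volume of
`Lie K` given by the trace form, in the exponential chart. -/
noncomputable def haarDensityAtOne (c : ℕ) (K : Subgroup (GL ι ℂ)) [LocallyCompactSpace K] :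
    ℝ≥0∞ :=
  limUnder (𝓝[>] (0 : ℝ)) fun r : ℝ =>
    Measure.haar {k : K | ∃ A ∈ traceBall c (lieSet K) r,
      ((k : GL ι ℂ) : Matrix ι ι ℂ) = NormedSpace.exp A} / ballVolume (lieSet K) r

/-- The volume of `K` for the invariant measure which at the identity is the Euclidean volume
density of `Lie K` given by the trace form. -/
noncomputable def groupVolume (c : ℕ) (K : Subgroup (GL ι ℂ)) [LocallyCompactSpace K] : ℝ :=
  ((haarDensityAtOne c K)⁻¹ * Measure.haar (Set.univ : Set K)).toReal

/-- The group of unitary matrices inside `GL`. -/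
def unitaryGL (ι : Type) [Fintype ι] [DecidableEq ι] : Subgroup (GL ι ℂ) where
  carrier := {g | (g : Matrix ι ι ℂ) ∈ Matrix.unitaryGroup ι ℂ}
  one_mem' := one_mem (Matrix.unitaryGroup ι ℂ)
  mul_mem' := fun {a b} ha hb => by
    exact (Matrix.unitaryGroup ι ℂ).mul_mem ha hb
  inv_mem' := fun {g} hg => by
    have h1 : star (g : Matrix ι ι ℂ) * (g : Matrix ι ι ℂ) = 1 := (Unitary.mem_iff.1 hg).1
    have h2 : ((g⁻¹ : GL ι ℂ) : Matrix ι ι ℂ) = star (g : Matrix ι ι ℂ) :=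
      Units.inv_eq_of_mul_eq_one_left h1
    change ((g⁻¹ : GL ι ℂ) : Matrix ι ι ℂ) ∈ Matrix.unitaryGroup ι ℂ
    rw [h2]
    exact Unitary.star_mem hg

/-- The unitary elements of `G`, as a subgroup of `G`. -/
abbrev unitaryPart (G : Subgroup (GL ι ℂ)) : Subgroup G := (unitaryGL ι).subgroupOf G

/-- The tangent space at the base point of `G ⧸ unitaryPart G`, for `G` stable under the Hermitian
adjoint: the Hermitian elements of `Lie G`. -/
def hermSet (G : Subgroup (GL ι ℂ)) : Set (Matrix ι ι ℂ) := {B | B ∈ lieSet G ∧ Bᴴ = B}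

/-- A `G`-invariant measure on `G ⧸ unitaryPart G`: the image of the Haar measure of `G` (the
unitary part is compact). -/
noncomputable def quotientHaar (G : Subgroup (GL ι ℂ)) [LocallyCompactSpace G] :
    Measure (G ⧸ unitaryPart G) :=
  (Measure.haar : Measure G).map (QuotientGroup.mk : G → G ⧸ unitaryPart G)

/-- The density of `quotientHaar G` at the base point, relative to the Euclidean volume of the
tangent space given by the trace form, in the exponential chart. -/
noncomputable def quotientDensityAtBase (c : ℕ) (G : Subgroup (GL ι ℂ)) [LocallyCompactSpace G] :
    ℝ≥0∞ :=
  limUnder (𝓝[>] (0 : ℝ)) fun r : ℝ =>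
    quotientHaar G {x | ∃ g : G, ((g : GL ι ℂ) : Matrix ι ι ℂ) ∈
      NormedSpace.exp '' traceBall c (hermSet G) r ∧ x = (g : G ⧸ unitaryPart G)} /
      ballVolume (hermSet G) r

/-- The `G`-invariant measure on `G ⧸ unitaryPart G` which at the base point is the Euclidean
volume density of the tangent space given by the trace form. -/
noncomputable def symmetricMeasure (c : ℕ) (G : Subgroup (GL ι ℂ)) [LocallyCompactSpace G] :
    Measure (G ⧸ unitaryPart G) :=
  (quotientDensityAtBase c G)⁻¹ • quotientHaar G

/-- Complex matrices preserving the bilinear form with matrix `β`. -/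
def formSubgroup (β : Matrix ι ι ℂ) : Subgroup (GL ι ℂ) where
  carrier := {h | (h : Matrix ι ι ℂ)ᵀ * β * (h : Matrix ι ι ℂ) = β}
  one_mem' := by simp
  mul_mem' := fun {a b} ha hb => by
    simp only [Set.mem_ofPred_eq] at ha hb ⊢
    calc ((a * b : GL ι ℂ) : Matrix ι ι ℂ)ᵀ * β * ((a * b : GL ι ℂ) : Matrix ι ι ℂ)
        = (b : Matrix ι ι ℂ)ᵀ * ((a : Matrix ι ι ℂ)ᵀ * β * a) * b := by
          simp [Matrix.mul_assoc]
      _ = β := by rw [ha, hb]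
  inv_mem' := fun {a} ha => by
    simp only [Set.mem_ofPred_eq] at ha ⊢
    have h1 : (a : Matrix ι ι ℂ) * ((a⁻¹ : GL ι ℂ) : Matrix ι ι ℂ) = 1 := a.mul_inv
    have h2 : ((a⁻¹ : GL ι ℂ) : Matrix ι ι ℂ)ᵀ * (a : Matrix ι ι ℂ)ᵀ = 1 := by
      rw [← transpose_mul, h1, transpose_one]
    generalize ((a⁻¹ : GL ι ℂ) : Matrix ι ι ℂ) = b at h1 h2 ⊢
    calc bᵀ * β * b = bᵀ * ((a : Matrix ι ι ℂ)ᵀ * β * a) * b := by rw [ha]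
      _ = (bᵀ * (a : Matrix ι ι ℂ)ᵀ) * β * ((a : Matrix ι ι ℂ) * b) := by
          simp only [Matrix.mul_assoc]
      _ = β := by rw [h1, h2, Matrix.one_mul, Matrix.mul_one]

/-- Invertible matrices commuting with the anti-linear map `v ↦ J *ᵥ star v`. -/
def antilinearCommutant (J : Matrix ι ι ℂ) : Subgroup (GL ι ℂ) where
  carrier := {g | J * (g : Matrix ι ι ℂ).map star = (g : Matrix ι ι ℂ) * J}
  one_mem' := by simp
  mul_mem' := fun {a b} ha hb => by
    simp only [Set.mem_ofPred_eq] at ha hb ⊢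
    have e : ((a * b : GL ι ℂ) : Matrix ι ι ℂ).map star =
        (a : Matrix ι ι ℂ).map star * (b : Matrix ι ι ℂ).map star := by
      ext i j
      simp [Matrix.mul_apply]
    rw [e, ← Matrix.mul_assoc, ha, Matrix.mul_assoc, hb, ← Matrix.mul_assoc]
    rfl
  inv_mem' := fun {a} ha => by
    simp only [Set.mem_ofPred_eq] at ha ⊢
    have h1 : (a : Matrix ι ι ℂ) * ((a⁻¹ : GL ι ℂ) : Matrix ι ι ℂ) = 1 := a.mul_inv
    have h2 : ((a⁻¹ : GL ι ℂ) : Matrix ι ι ℂ) * (a : Matrix ι ι ℂ) = 1 := a.inv_mul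
    generalize ((a⁻¹ : GL ι ℂ) : Matrix ι ι ℂ) = b at h1 h2 ⊢
    have h3 : (a : Matrix ι ι ℂ).map star * b.map star = 1 := by
      have := Matrix.map_mul (L := (a : Matrix ι ι ℂ)) (M := b) (f := starRingEnd ℂ)
      rw [h1] at this
      simpa using this.symm
    calc J * b.map star = (b * (a : Matrix ι ι ℂ)) * (J * b.map star) := by
          rw [h2, Matrix.one_mul]
      _ = b * ((a : Matrix ι ι ℂ) * J) * b.map star := by simp only [Matrix.mul_assoc]
      _ = b * (J * (a : Matrix ι ι ℂ).map star) * b.map star := by rw [ha]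
      _ = b * J * ((a : Matrix ι ι ℂ).map star * b.map star) := by
          simp only [Matrix.mul_assoc]
      _ = b * J := by rw [h3, Matrix.mul_one]

/-- Complex linear maps `M` intertwining `v ↦ T *ᵥ star v` with `u ↦ J *ᵥ star u`. -/
noncomputable def antilinearIntertwiners {κ : Type} [Fintype κ] (J : Matrix κ κ ℂ) (T : Matrix ι ι ℂ) :
    Submodule ℝ (Matrix κ ι ℂ) where
  carrier := {M | J * M.map star = M * T}
  zero_mem' := by simp
  add_mem' := fun {a b} ha hb => by
    simp only [Set.mem_ofPred_eq] at ha hb ⊢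
    rw [Matrix.map_add _ star_add, Matrix.mul_add, Matrix.add_mul, ha, hb]
  smul_mem' := fun c M hM => by
    simp only [Set.mem_ofPred_eq] at hM ⊢
    have e : (c • M).map star = c • M.map star := by
      ext i j
      simp
    rw [e, Matrix.mul_smul, Matrix.smul_mul, hM]

theorem isClosed_unitaryGL : IsClosed (unitaryGL ι : Set (GL ι ℂ)) := by
  have : (unitaryGL ι : Set (GL ι ℂ)) =
      {g : GL ι ℂ | star (g : Matrix ι ι ℂ) * (g : Matrix ι ι ℂ) = 1} := by
    ext g
    exact Matrix.mem_unitaryGroup_iff'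
  rw [this]
  exact isClosed_eq (by have := Units.continuous_val (M := Matrix ι ι ℂ); fun_prop)
    continuous_const

theorem isClosed_formSubgroup (β : Matrix ι ι ℂ) :
    IsClosed (formSubgroup β : Set (GL ι ℂ)) :=
  isClosed_eq (by
    have h := Units.continuous_val (M := Matrix ι ι ℂ)
    exact ((h.matrix_transpose.matrix_mul continuous_const).matrix_mul h)) continuous_const

theorem isClosed_antilinearCommutant (J : Matrix ι ι ℂ) :
    IsClosed (antilinearCommutant J : Set (GL ι ℂ)) := by
  have h := Units.continuous_val (M := Matrix ι ι ℂ)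
  exact isClosed_eq (continuous_const.matrix_mul (h.matrix_map continuous_star))
    (h.matrix_mul continuous_const)

end Normalization

/-! ## The three symmetry classes -/

/-- The three cases `GL_n`, `O_n`, `Sp_n`.  In the last two cases `ℂⁿ` carries a bilinear form,
symmetric or alternating, which is compatible with the Hermitian structure of `ℂⁿ`. -/
inductive SymmetryClass (n : ℕ) : Type
  | gl : SymmetryClass n
  | orth (δ : Matrix (Fin n) (Fin n) ℂ) (symm : δᵀ = δ)
      (unit : δ ∈ Matrix.unitaryGroup (Fin n) ℂ) : SymmetryClass n
  | symp (ε : Matrix (Fin n) (Fin n) ℂ) (alt : εᵀ = -ε)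
      (unit : ε ∈ Matrix.unitaryGroup (Fin n) ℂ) : SymmetryClass n

namespace SymmetryClass

variable {n : ℕ}

/-- The factor `1 + |m|`, where `m = 0, 1, -1` for `GL`, `O`, `Sp`. -/
def factor : SymmetryClass n → ℕ
  | gl => 1
  | orth _ _ _ => 2
  | symp _ _ _ => 2

/-- Index type of the standard basis of `U_p`, which is `ℂᵖ` for `GL` and `ℂᵖ ⊕ (ℂᵖ)*` for
`O`, `Sp`. -/
abbrev UIdx (S : SymmetryClass n) (p : ℕ) : Type :=
  match S with
  | gl => Fin p
  | orth _ _ _ => Fin p ⊕ Fin p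
  | symp _ _ _ => Fin p ⊕ Fin p

instance (S : SymmetryClass n) (p : ℕ) : Fintype (S.UIdx p) :=
  match S with
  | gl => inferInstanceAs (Fintype (Fin p))
  | orth _ _ _ => inferInstanceAs (Fintype (Fin p ⊕ Fin p))
  | symp _ _ _ => inferInstanceAs (Fintype (Fin p ⊕ Fin p))

instance (S : SymmetryClass n) (p : ℕ) : DecidableEq (S.UIdx p) :=
  match S with
  | gl => inferInstanceAs (DecidableEq (Fin p))
  | orth _ _ _ => inferInstanceAs (DecidableEq (Fin p ⊕ Fin p))
  | symp _ _ _ => inferInstanceAs (DecidableEq (Fin p ⊕ Fin p))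

/-- `C (u ⊕ φ) = conj φ ⊕ σ conj u` is the anti-linear map `x ↦ CMatrix σ p *ᵥ star x`; here
`σ = 1` for `O` and `σ = -1` for `Sp`. -/
def CMatrix (σ : ℂ) (p : ℕ) : Matrix (Fin p ⊕ Fin p) (Fin p ⊕ Fin p) ℂ :=
  fromBlocks 0 1 (σ • 1) 0

/-- The complex group `G_n`. -/
def G : SymmetryClass n → Subgroup (GL (Fin n) ℂ)
  | gl => ⊤
  | orth δ _ _ => formSubgroup δ
  | symp ε _ _ => formSubgroup ε

/-- The compact group `K_n`. -/
def K (S : SymmetryClass n) : Subgroup (GL (Fin n) ℂ) := S.G ⊓ unitaryGL (Fin n)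

/-- The group `G_p`: all of `GL (U_p)` for `GL`, and the elements of `GL (U_p)` commuting with
`C` for `O` (a copy of `GL_{2p}(ℝ)`) and `Sp` (a copy of `GL_p(ℍ)`).  Its unitary part
is `K_p`. -/
def Gp (S : SymmetryClass n) (p : ℕ) : Subgroup (GL (S.UIdx p) ℂ) :=
  match S with
  | gl => ⊤
  | orth _ _ _ => antilinearCommutant (CMatrix 1 p)
  | symp _ _ _ => antilinearCommutant (CMatrix (-1) p)

/-- The space `X_{p,n}` of structure-preserving linear maps `ℂⁿ → U_p`: all linear maps for `GL`,
and those with `C M = M T` for `O`, `Sp`, where `T v = conj (β v)`. -/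
noncomputable def X (S : SymmetryClass n) (p : ℕ) : Submodule ℝ (Matrix (S.UIdx p) (Fin n) ℂ) :=
  match S with
  | gl => ⊤
  | orth δ _ _ => antilinearIntertwiners (CMatrix 1 p) (δ.map star)
  | symp ε _ _ => antilinearIntertwiners (CMatrix (-1) p) (ε.map star)

/-- The group `K_{n,p}` for a structure-preserving projector `P : ℂⁿ = U_p ⊕ U_{n,p} → U_p`:
the elements of `K_n` which are the identity on `U_p` (and hence act on `U_{n,p} = ker P`), a copy
of `U_{n-p}`, `O_{n-2p}(ℝ)`, `USp_{n-2p}`, respectively. -/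
def Knp (S : SymmetryClass n) {p : ℕ} (P : S.X p) : Subgroup (GL (Fin n) ℂ) where
  carrier := {k | k ∈ S.K ∧ P.1 * (k : Matrix (Fin n) (Fin n) ℂ) = P.1}
  one_mem' := ⟨one_mem _, by simp⟩
  mul_mem' := fun {a b} ha hb => ⟨mul_mem ha.1 hb.1, by
    rw [Units.val_mul, ← Matrix.mul_assoc, ha.2, hb.2]⟩
  inv_mem' := fun {a} ha => ⟨inv_mem ha.1, by
    have h1 : (a : Matrix (Fin n) (Fin n) ℂ) * ((a⁻¹ : GL (Fin n) ℂ) : Matrix (Fin n) (Fin n) ℂ)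
        = 1 := a.mul_inv
    conv_lhs => rw [← ha.2]
    rw [Matrix.mul_assoc, h1, Matrix.mul_one]⟩

theorem isClosed_G (S : SymmetryClass n) : IsClosed (S.G : Set (GL (Fin n) ℂ)) :=
  match S with
  | gl => isClosed_univ
  | orth δ _ _ => isClosed_formSubgroup δ
  | symp ε _ _ => isClosed_formSubgroup ε

theorem isClosed_K (S : SymmetryClass n) : IsClosed (S.K : Set (GL (Fin n) ℂ)) :=
  S.isClosed_G.inter isClosed_unitaryGL

theorem isClosed_Knp (S : SymmetryClass n) {p : ℕ} (P : S.X p) :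
    IsClosed (S.Knp P : Set (GL (Fin n) ℂ)) :=
  S.isClosed_K.inter (isClosed_eq
    (continuous_const.matrix_mul Units.continuous_val) continuous_const)

theorem isClosed_Gp (S : SymmetryClass n) (p : ℕ) :
    IsClosed (S.Gp p : Set (GL (S.UIdx p) ℂ)) :=
  match S with
  | gl => isClosed_univ
  | orth _ _ _ => isClosed_antilinearCommutant _
  | symp _ _ _ => isClosed_antilinearCommutant _

instance (S : SymmetryClass n) : LocallyCompactSpace S.K := S.isClosed_K.locallyCompactSpace

instance (S : SymmetryClass n) {p : ℕ} (P : S.X p) : LocallyCompactSpace (S.Knp P) :=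
  (S.isClosed_Knp P).locallyCompactSpace

instance (S : SymmetryClass n) (p : ℕ) : LocallyCompactSpace (S.Gp p) :=
  (S.isClosed_Gp p).locallyCompactSpace

theorem mul_map_star_of_unitary {σ : ℂ} {β : Matrix (Fin n) (Fin n) ℂ} (hσ : star σ * σ = 1)
    (hβ : βᵀ = σ • β) (hu : β ∈ Matrix.unitaryGroup (Fin n) ℂ) :
    β * β.map star = σ • (1 : Matrix (Fin n) (Fin n) ℂ) := by
  have h1 : β * star β = 1 := (Unitary.mem_iff.1 hu).2
  have h2 : star β = star σ • β.map star := by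
    rw [Matrix.star_eq_conjTranspose, Matrix.conjTranspose, hβ]
    ext i j
    simp
  rw [h2, Matrix.mul_smul] at h1
  rw [← h1, smul_smul, mul_comm, hσ, one_smul]

theorem fromRows_mem_intertwiners {σ : ℂ} (p : ℕ) {β : Matrix (Fin n) (Fin n) ℂ}
    (hβ : β * β.map star = σ • (1 : Matrix (Fin n) (Fin n) ℂ))
    (L : Matrix (Fin p) (Fin n) ℂ) :
    fromRows L (L.map star * β) ∈ antilinearIntertwiners (CMatrix σ p) (β.map star) := by
  have e : (fromRows L (L.map star * β)).map star =
      fromRows (L.map star) (L * β.map star) := by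
    ext (i | i) j <;> simp [Matrix.mul_apply]
  change CMatrix σ p * (fromRows L (L.map star * β)).map star = _ * _
  rw [e, CMatrix, fromBlocks_mul_fromRows, fromRows_mul, Matrix.mul_assoc, hβ]
  simp

/-- The isomorphism `ψ (L) = L ⊕ conj(L) β` onto the space of structure-preserving maps, with
inverse the projection to the upper block. -/
noncomputable def psiForm {σ : ℂ} (p : ℕ) {β : Matrix (Fin n) (Fin n) ℂ}
    (hβ : β * β.map star = σ • (1 : Matrix (Fin n) (Fin n) ℂ)) :
    Matrix (Fin p) (Fin n) ℂ ≃ₗ[ℝ] antilinearIntertwiners (CMatrix σ p) (β.map star) where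
  toFun L := ⟨fromRows L (L.map star * β), fromRows_mem_intertwiners p hβ L⟩
  map_add' A B := by
    ext (i | i) j
    · simp
    · simp [Matrix.mul_apply, add_mul, Finset.sum_add_distrib]
  map_smul' c A := by
    ext (i | i) j
    · simp
    · simp [Matrix.mul_apply, mul_assoc, Finset.mul_sum]
  invFun M := toRows₁ M.1
  left_inv L := by simp
  right_inv M := by
    obtain ⟨M, hM⟩ := M
    have hM' : CMatrix σ p * M.map star = M * β.map star := hM
    have h1 : (toRows₂ M).map star = toRows₁ M * β.map star := by
      ext i j
      have := congrFun (congrFun hM' (Sum.inl i)) j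
      simpa [CMatrix, Matrix.mul_apply, Fintype.sum_sum_type, Matrix.one_apply] using this
    have h2 : (toRows₁ M).map star * β = toRows₂ M := by
      ext i j
      have := congrArg star (congrFun (congrFun h1 i) j)
      simpa [Matrix.mul_apply] using this.symm
    apply Subtype.ext
    change fromRows (toRows₁ M) ((toRows₁ M).map star * β) = M
    rw [h2, fromRows_toRows]

/-- The `K_n`-equivariant isomorphism `ψ`: `ψ (L) = L` for `GL`, `ψ (L) = L ⊕ conj(L) δ` for `O`,
and `ψ (L) = L ⊕ conj(L) ε` for `Sp`. -/
noncomputable def psi (S : SymmetryClass n) (p : ℕ) : Matrix (Fin p) (Fin n) ℂ ≃ₗ[ℝ] S.X p :=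
  match S with
  | gl => (Submodule.topEquiv (R := ℝ) (M := Matrix (Fin p) (Fin n) ℂ)).symm
  | orth _ symm unit =>
      psiForm p (mul_map_star_of_unitary (σ := 1) (by simp) (by simpa using symm) unit)
  | symp _ alt unit =>
      psiForm p (mul_map_star_of_unitary (σ := -1) (by simp) (by simpa using alt) unit)

theorem mul_mem_intertwiners {ι κ : Type} [Fintype ι] [DecidableEq ι] [Fintype κ] [DecidableEq κ]
    {J : Matrix κ κ ℂ} {T : Matrix ι ι ℂ} {g : GL κ ℂ} (hg : g ∈ antilinearCommutant J)
    {M : Matrix κ ι ℂ} (hM : M ∈ antilinearIntertwiners J T) :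
    (g : Matrix κ κ ℂ) * M ∈ antilinearIntertwiners J T := by
  have hg' : J * (g : Matrix κ κ ℂ).map star = (g : Matrix κ κ ℂ) * J := hg
  have hM' : J * M.map star = M * T := hM
  have e : ((g : Matrix κ κ ℂ) * M).map star = (g : Matrix κ κ ℂ).map star * M.map star := by
    ext i j
    simp [Matrix.mul_apply]
  change J * ((g : Matrix κ κ ℂ) * M).map star = _
  rw [e, ← Matrix.mul_assoc, hg', Matrix.mul_assoc, hM', ← Matrix.mul_assoc]

theorem mul_mem_X (S : SymmetryClass n) {p : ℕ} (g : S.Gp p) (M : S.X p) :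
    ((g : GL (S.UIdx p) ℂ) : Matrix (S.UIdx p) (S.UIdx p) ℂ) * M.1 ∈ S.X p :=
  match S, g, M with
  | gl, _, _ => trivial
  | orth _ _ _, g, M => mul_mem_intertwiners g.2 M.2
  | symp _ _ _, g, M => mul_mem_intertwiners g.2 M.2

/-- The restriction `f_r (L) = f (L ⊕ Lᴴ)` of a function `f` on
`V = Hom(ℂⁿ, ℂᵖ) ⊕ Hom(ℂᵖ, ℂⁿ)`. -/
def realRestriction {p : ℕ} (f : Matrix (Fin p) (Fin n) ℂ × Matrix (Fin n) (Fin p) ℂ → ℂ)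
    (L : Matrix (Fin p) (Fin n) ℂ) : ℂ :=
  f (L, Lᴴ)

/-- The left translation `M ↦ g M` of `X_{p,n}` by `g ∈ G_p`. -/
def translate (S : SymmetryClass n) {p : ℕ} (g : S.Gp p) (M : S.X p) : S.X p :=
  ⟨((g : GL (S.UIdx p) ℂ) : Matrix (S.UIdx p) (S.UIdx p) ℂ) * M.1, S.mul_mem_X g M⟩

/-- The Jacobian: `2^(p²-pn) |Det g|^(2n)` for `GL`, and `2^(2p²-pn) |Det g|^n` for `O`, `Sp`. -/
noncomputable def J (S : SymmetryClass n) (p : ℕ) (g : S.Gp p) : ℝ :=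
  let absDet : ℝ := ‖((g : GL (S.UIdx p) ℂ) : Matrix (S.UIdx p) (S.UIdx p) ℂ).det‖
  match S with
  | gl => (2 : ℝ) ^ ((p : ℤ) ^ 2 - p * n) * absDet ^ (2 * n)
  | orth _ _ _ => (2 : ℝ) ^ (2 * (p : ℤ) ^ 2 - p * n) * absDet ^ n
  | symp _ _ _ => (2 : ℝ) ^ (2 * (p : ℤ) ^ 2 - p * n) * absDet ^ n

end SymmetryClass

/-! The three cases have one shape, recorded in `MatrixBimodule`: real `*`-algebras `A` on `U_p` and
`N` on `ℂⁿ`, and a real space `X` of maps `ℂⁿ → U_p`, with `A X ⊆ X`, `X N ⊆ X`, `X Xᴴ ⊆ A` and `Xᴴ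
X ⊆ N`. Then `G_p` is the unit group of `A`, `K_n` is the unitary group of `N`, and `P` is a
coisometry in `X`. For `O` and `Sp` the three spaces consist of the matrices that commute with, or
intertwine, the anti-linear maps `C` and `T`; a unitary matrix preserves `β` exactly when it
commutes with `T`.

Shape of the formula. Almost every `M` in `X` has `M Pᴴ` invertible, and then `M = h P k` with `h`
in `G_p` and `k` in `K_n` (`MatrixBimodule.exists_polar`). Hence a function on `X` that is invariant
under right multiplication by `K_n` is determined almost everywhere by its values on the orbit `G_p
P`. The function `f_r` is invariant because `k⁻¹ = kᴴ` on `K_n`. Left multiplication by `g` scales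
Lebesgue measure on `X` by `|det g| ^ N`, where `N` is `2n` for `GL` and `n` otherwise. A Tonelli
argument (`exists_measure_eq_mul_orbitWeight`) then shows that, on right `K_n`-invariant sets,
Lebesgue measure is a constant `C` times the image of `|det g| ^ N dg` under `g ↦ g P`.

The constant. Let the tube of radius `r` be the set of all `exp(B) P k` with `B` Hermitian in `A`,
of norm below `r`, and `k` in `K_n`. Its volume divided by that of the `r`-ball is computed twice as
`r → 0`. On the group side the tube pulls back to the exponential ball in `G_p / K_p`, where the
weight tends to `1`; this gives `C` times the density of `quotientHaar` at the base point
(`quotientDensityAtBase_eq`). On the side of `X` the chart `(B, Z) ↦ exp(B) P exp(Z)` has derivative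
`B P + P Z`, and the orbit `P K_n` fibres `K_n` with fibre `K_{n,p}`; this gives `vol(K_n) /
vol(K_{n,p})` in the coordinates `(B, Z)` (`exists_tube_density`). The constant `C` cancels at the
end.

Existence of the densities, which the definitions take as limits, follows from the same computation.
The tube density times the density of the orbit converges when the two radii shrink independently,
so each factor converges (`ENNReal.exists_tendsto_of_tendsto_mul`). The case `P = 1`, with `N`
acting on itself, yields the density of Haar measure on `K_n`.

The powers of two. Split `Z` into its corner block on `U_p` and its off-diagonal part. By
`norm_sq_tangent`, `B P + P Z` has norm square `‖B‖² + ‖corner‖² + ‖off-diagonal‖² / 2`. The halved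
directions number `dim X - dim A`, which is `2pn - 2p²` for `GL` and `2pn - 4p²` otherwise, and they
contribute `2 ^ (-(dim X - dim A) / 2)`. The map `ψ` multiplies norm squares by `1 + |m|`, which is
the factor in the trace form. All such comparisons of linear charts are made by integrating a
Gaussian. -/

open scoped ComplexOrder

set_option linter.unusedSectionVars false

open scoped ENNReal

/-! ### Limits of products, maps tangent to the identity, averaging, linear images of Haar measure
-/

section Generalities

/-- If `f x * g y` converges to a finite nonzero limit as `x` and `y` move independently, then
both factors converge. -/
theorem ENNReal.exists_tendsto_of_tendsto_mul {α β : Type*} {l₁ : Filter α} {l₂ : Filter β}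
    [NeBot l₁] [NeBot l₂] {f : α → ℝ≥0∞} {g : β → ℝ≥0∞} {c : ℝ≥0∞} (hc₀ : c ≠ 0) (hc : c ≠ ⊤)
    (h : Tendsto (fun x : α × β => f x.1 * g x.2) (l₁ ×ˢ l₂) (𝓝 c)) :
    ∃ a, a ≠ 0 ∧ a ≠ ⊤ ∧ Tendsto f l₁ (𝓝 a) ∧ Tendsto g l₂ (𝓝 (c / a)) := by
  obtain ⟨u, hu, hu1⟩ := exists_between (pos_iff_ne_zero.2 hc₀)
  obtain ⟨v, hv, hv1⟩ := exists_between (lt_top_iff_ne_top.2 hc)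
  have hev : ∀ᶠ z in l₁ ×ˢ l₂, f z.1 * g z.2 ∈ Set.Icc u v :=
    h.eventually (_root_.Icc_mem_nhds hu1 hv)
  have hne : ∀ᶠ z in l₁ ×ˢ l₂, f z.1 * g z.2 ≠ 0 ∧ f z.1 * g z.2 ≠ ⊤ := by
    filter_upwards [hev] with z hz
    exact ⟨(hu.trans_le hz.1).ne', (hz.2.trans_lt hv1).ne⟩
  have hfne : ∀ᶠ x in l₁, f x ≠ 0 ∧ f x ≠ ⊤ := by
    filter_upwards [hne.curry] with x hx
    obtain ⟨y, hy⟩ := hx.exists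
    have h0 := mul_ne_zero_iff.1 hy.1
    refine ⟨h0.1, fun ht => hy.2 ?_⟩
    rw [ht]
    exact ENNReal.top_mul h0.2
  -- Compactness of `[0, ∞]` gives a limit `a` of `f` along an ultrafilter finer than `l₁`. Dividing
  -- by `f` forces `g` to converge to `c / a` along all of `l₂`, and dividing by `g` then forces `f`
  -- to converge to `a` along all of `l₁`.
  set w : Ultrafilter α := Ultrafilter.of l₁
  have hw : (w : Filter α) ≤ l₁ := Ultrafilter.of_le l₁
  obtain ⟨a, -, ha⟩ := isCompact_univ.ultrafilter_le_nhds (w.map f) (by simp)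
  have ha : Tendsto f w (𝓝 a) := ha
  have hsw : ∀ᶠ y in l₂, ∀ᶠ x in l₁, f x * g y ∈ Set.Icc u v :=
    (Filter.eventually_swap_iff.1 hev).curry
  obtain ⟨y, hy⟩ := hsw.exists
  have hgy : g y ≠ 0 ∧ g y ≠ ⊤ := by
    obtain ⟨x, hx⟩ := (hy.and hfne).exists
    have h0 : f x * g y ≠ 0 := (hu.trans_le hx.1.1).ne'
    refine ⟨(mul_ne_zero_iff.1 h0).2, fun ht => ?_⟩
    have := hx.1.2
    rw [ht, ENNReal.mul_top hx.2.1] at this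
    exact (this.trans_lt hv1).ne rfl
  have hlim : a * g y ∈ Set.Icc u v :=
    isClosed_Icc.mem_of_tendsto (ENNReal.Tendsto.mul_const ha (Or.inr hgy.2)) (hw hy)
  have ha0 : a ≠ 0 := by
    rintro rfl
    rw [zero_mul] at hlim
    exact (hu.trans_le hlim.1).ne rfl
  have hat : a ≠ ⊤ := by
    rintro rfl
    rw [ENNReal.top_mul hgy.1] at hlim
    exact (hlim.2.trans_lt hv1).ne rfl
  have hg : Tendsto g l₂ (𝓝 (c / a)) := by
    have h1 : Tendsto (fun z : α × β => f z.1 * g z.2 / f z.1) ((w : Filter α) ×ˢ l₂)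
        (𝓝 (c / a)) :=
      ENNReal.Tendsto.div (h.mono_left (Filter.prod_mono_left _ hw)) (Or.inl hc₀)
        (ha.comp tendsto_fst) (Or.inl hat)
    have h2 : Tendsto (fun z : α × β => g z.2) ((w : Filter α) ×ˢ l₂) (𝓝 (c / a)) := by
      refine h1.congr' ?_
      filter_upwards [Eventually.prod_inl (hfne.filter_mono hw) l₂] with z hz
      rw [mul_comm, ENNReal.mul_div_cancel_right hz.1 hz.2]
    rw [← Filter.map_snd_prod (w : Filter α) l₂]
    exact tendsto_map'_iff.2 h2
  refine ⟨a, ha0, hat, ?_, hg⟩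
  have hca0 : c / a ≠ 0 := (ENNReal.div_pos hc₀ hat).ne'
  have hcat : c / a ≠ ⊤ := ENNReal.div_ne_top hc ha0
  have h1 : Tendsto (fun z : α × β => f z.1 * g z.2 / g z.2) (l₁ ×ˢ l₂) (𝓝 (c / (c / a))) :=
    ENNReal.Tendsto.div h (Or.inl hc₀) (hg.comp tendsto_snd) (Or.inl hcat)
  have hca : c / (c / a) = a := by
    rw [div_eq_mul_inv, ENNReal.inv_div (Or.inl hat) (Or.inl ha0),
      ENNReal.mul_div_cancel hc₀ hc]
  rw [hca] at h1
  have hg2 : ∀ᶠ y in l₂, g y ≠ 0 ∧ g y ≠ ⊤ :=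
    (hg.eventually_ne hca0).and (hg.eventually_ne hcat)
  have h2 : Tendsto (fun z : α × β => f z.1) (l₁ ×ˢ l₂) (𝓝 a) := by
    refine h1.congr' ?_
    filter_upwards [hg2.prod_inr l₁] with z hz
    rw [ENNReal.mul_div_cancel_right hz.1 hz.2]
  rw [← Filter.map_fst_prod l₁ l₂]
  exact tendsto_map'_iff.2 h2

/-- Near `0` the map differs from the identity by a map with Lipschitz constant `1/2`, so it cannot
identify two points. -/
theorem HasStrictFDerivAt.exists_ball_injOn {D : Type*} [NormedAddCommGroup D]
    [NormedSpace ℝ D] {φ : D → D}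
    (hφ : HasStrictFDerivAt φ (ContinuousLinearMap.id ℝ D) 0) :
    ∃ δ > 0, Set.InjOn φ (Metric.ball 0 δ) := by
  obtain ⟨s, hs, happ⟩ := hφ.approximates_deriv_on_nhds (c := 1 / 2) (Or.inr (by simp))
  obtain ⟨δ, hδ, hsub⟩ := Metric.mem_nhds_iff.1 hs
  refine ⟨δ, hδ, fun x hx y hy hxy => ?_⟩
  have h4 := happ x (hsub hx) y (hsub hy)
  rw [hxy, sub_self, zero_sub, norm_neg, ContinuousLinearMap.id_apply] at h4
  have h5 : ((1 / 2 : NNReal) : ℝ) = 1 / 2 := by simp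
  rw [h5] at h4
  have h6 := norm_nonneg (x - y)
  exact sub_eq_zero.1 (norm_eq_zero.1 (by linarith))

/-- A map which is tangent to the identity at `0` nearly preserves the
volume of small sets. -/
theorem HasStrictFDerivAt.exists_ball_measure_image {D : Type*} [NormedAddCommGroup D]
    [NormedSpace ℝ D] [FiniteDimensional ℝ D] [MeasurableSpace D] [BorelSpace D]
    (μ : Measure D) [μ.IsAddHaarMeasure] {φ : D → D}
    (hφ : HasStrictFDerivAt φ (ContinuousLinearMap.id ℝ D) 0) {m : NNReal} (hm : 1 < m) :
    ∃ δ > 0, ∀ S ⊆ Metric.ball (0 : D) δ, μ (φ '' S) ≤ m * μ S ∧ μ S ≤ m * μ (φ '' S) := by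
  have hdet : (ContinuousLinearMap.id ℝ D).det = 1 := LinearMap.det_id
  have h1 := addHaar_image_le_mul_of_det_lt μ (ContinuousLinearMap.id ℝ D) (m := m)
    (by rw [hdet]; simpa using hm)
  have hm' : m⁻¹ < 1 := inv_lt_one_of_one_lt₀ hm
  have h2 := mul_le_addHaar_image_of_lt_det μ (ContinuousLinearMap.id ℝ D) (m := m⁻¹)
    (by rw [hdet]; simpa using hm')
  obtain ⟨δ₀, ⟨h1, h2⟩, hδ₀⟩ := (h1.and h2).and self_mem_nhdsWithin |>.exists
  obtain ⟨s, hs, happ⟩ := hφ.approximates_deriv_on_nhds (c := δ₀) (Or.inr hδ₀)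
  obtain ⟨δ, hδ, hsub⟩ := Metric.mem_nhds_iff.1 hs
  refine ⟨δ, hδ, fun S hS => ?_⟩
  have hS' := happ.mono_set (hS.trans hsub)
  refine ⟨h1 S φ hS', ?_⟩
  have h4 := h2 S φ hS'
  have hm0 : (m : ℝ≥0∞) ≠ 0 := by
    have : m ≠ 0 := (zero_lt_one.trans hm).ne'
    exact_mod_cast this
  calc μ S = m * ((m⁻¹ : NNReal) * μ S) := by
        rw [← mul_assoc, ENNReal.coe_inv (zero_lt_one.trans hm).ne',
          ENNReal.mul_inv_cancel hm0 ENNReal.coe_ne_top, one_mul]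
    _ ≤ _ := by gcongr

/-- Averaging over a measure preserving family of maps. -/
theorem MeasureTheory.measure_mul_measure_univ_of_orbit {H Y : Type*} [MeasurableSpace H]
    [MeasurableSpace Y] (η : Measure H) [SFinite η] (ν : Measure Y) [SFinite ν] {act : H → Y → Y}
    (hact : Measurable fun z : H × Y => act z.1 z.2)
    (hpres : ∀ h, ∀ E, MeasurableSet E → ν (act h ⁻¹' E) = ν E)
    {E E' : Set Y} (hE : MeasurableSet E) (hE' : MeasurableSet E') {c : ℝ≥0∞}
    (hin : ∀ y ∈ E', η {h | act h y ∈ E} = c) (hout : ∀ y ∉ E', ∀ h, act h y ∉ E) :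
    ν E * η Set.univ = c * ν E' := by
  -- Tonelli for the set of pairs with `act h y ∈ E`: every slice at fixed `h` has measure `ν E`,
  -- and a slice at fixed `y` has measure `c` or `0` according to whether `y ∈ E'`.
  have hT : MeasurableSet ((fun z : H × Y => act z.1 z.2) ⁻¹' E) := hact hE
  have h1 := Measure.prod_apply (μ := η) (ν := ν) hT
  rw [Measure.prod_apply_symm hT] at h1
  have h2 : ∀ h : H, ν (Prod.mk h ⁻¹' ((fun z : H × Y => act z.1 z.2) ⁻¹' E)) = ν E :=
    fun h => hpres h E hE
  simp only [h2, lintegral_const] at h1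
  rw [← h1, ← lintegral_indicator_const hE']
  congr 1
  ext y
  by_cases hy : y ∈ E'
  · rw [Set.indicator_of_mem hy, ← hin y hy]
    rfl
  · rw [Set.indicator_of_notMem hy]
    convert measure_empty (μ := η)
    ext h
    simpa using hout y hy h

/-- Images of Haar measures under injective linear maps with the same range are proportional; the
factor can be read off from the integral of one function. -/
theorem MeasureTheory.Measure.map_linear_eq_smul {D D' W : Type*}
    [NormedAddCommGroup D] [NormedSpace ℝ D] [FiniteDimensional ℝ D] [MeasurableSpace D]
    [BorelSpace D] [NormedAddCommGroup D'] [NormedSpace ℝ D'] [FiniteDimensional ℝ D']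
    [MeasurableSpace D'] [BorelSpace D'] [NormedAddCommGroup W] [NormedSpace ℝ W]
    [MeasurableSpace W] [BorelSpace W] (μ : Measure D) [μ.IsAddHaarMeasure] (μ' : Measure D')
    [μ'.IsAddHaarMeasure] {Λ : D →ₗ[ℝ] W} {Λ' : D' →ₗ[ℝ] W} (hΛ : Function.Injective Λ)
    (hΛ' : Function.Injective Λ') (hr : LinearMap.range Λ = LinearMap.range Λ')
    {Q : W → ℝ≥0∞} (hQ : Measurable Q) {t : ℝ≥0∞} (h0 : ∫⁻ x, Q (Λ x) ∂μ ≠ 0)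
    (h1 : ∫⁻ x, Q (Λ x) ∂μ ≠ ⊤) (ht : ∫⁻ x, Q (Λ' x) ∂μ' = t * ∫⁻ x, Q (Λ x) ∂μ) :
    μ'.map Λ' = t • μ.map Λ := by
  -- Since the ranges agree, `Λ = Λ' ∘ T`. Uniqueness of Haar measure on `D'` makes `μ'` a multiple
  -- of the image of `μ` under `T`, and integrating `Q` identifies the multiple.
  let T : D ≃ₗ[ℝ] D' := (LinearEquiv.ofInjective Λ hΛ).trans
    ((LinearEquiv.ofEq _ _ hr).trans (LinearEquiv.ofInjective Λ' hΛ').symm)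
  have hT : ∀ x, Λ' (T x) = Λ x := fun x => by
    have : (LinearEquiv.ofInjective Λ' hΛ') (T x) =
        (LinearEquiv.ofEq _ _ hr) (LinearEquiv.ofInjective Λ hΛ x) := by
      simp [T]
    exact congrArg Subtype.val this
  let Tc : D ≃L[ℝ] D' := T.toContinuousLinearEquiv
  have hTm : Measurable T := Tc.continuous.measurable
  have : (μ.map T).IsAddHaarMeasure := Tc.isAddHaarMeasure_map μ
  have hs := Measure.isAddLeftInvariant_eq_smul μ' (μ.map T)
  set c := Measure.addHaarScalarFactor μ' (μ.map T)
  have hΛm : Measurable Λ := (LinearMap.continuous_of_finiteDimensional Λ).measurable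
  have hΛm' : Measurable Λ' := (LinearMap.continuous_of_finiteDimensional Λ').measurable
  have hcomp : (μ.map T).map Λ' = μ.map Λ := by
    rw [Measure.map_map hΛm' hTm]
    congr 1
    ext x
    exact hT x
  have hfin : μ'.map Λ' = (c : ℝ≥0∞) • μ.map Λ := by
    rw [hs, ← hcomp]
    exact Measure.map_smul _ _ _
  rw [hfin]
  congr 1
  have e1 : ∫⁻ x, Q (Λ' x) ∂μ' = ∫⁻ y, Q y ∂(μ'.map Λ') := (lintegral_map hQ hΛm').symm
  have e2 : ∫⁻ x, Q (Λ x) ∂μ = ∫⁻ y, Q y ∂(μ.map Λ) := (lintegral_map hQ hΛm).symm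
  rw [e1, hfin, lintegral_smul_measure, e2] at ht
  rw [e2] at h0 h1
  exact (ENNReal.mul_left_inj h0 h1).1 ht

end Generalities

/-! ### Matrix spaces: trace form, exponentials, Lie algebras, square roots, compactness -/

instance Matrix.secondCountableTopologyComplex {ι κ : Type} [Fintype ι] [Fintype κ] :
    SecondCountableTopology (Matrix κ ι ℂ) :=
  inferInstanceAs (SecondCountableTopology (κ → ι → ℂ))

instance Matrix.secondCountableTopologyGL {ι : Type} [Fintype ι] [DecidableEq ι] :
    SecondCountableTopology (GL ι ℂ) :=
  Matrix.isEmbedding_val_GL.secondCountableTopology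

instance Subgroup.secondCountableTopologyGL {ι : Type} [Fintype ι] [DecidableEq ι]
    (K : Subgroup (GL ι ℂ)) : SecondCountableTopology K :=
  TopologicalSpace.Subtype.secondCountableTopology (K : Set (GL ι ℂ))

instance Matrix.isAddHaarMeasure_volume {ι κ : Type} [Fintype ι] [Fintype κ] :
    (volume : Measure (Matrix κ ι ℂ)).IsAddHaarMeasure :=
  haveI : (volume : Measure (ι → ℂ)).IsAddHaarMeasure := Measure.pi.isAddHaarMeasure _
  Measure.pi.isAddHaarMeasure fun _ : κ => (volume : Measure (ι → ℂ))

section MatrixAnalysis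

attribute [local instance] Matrix.frobeniusNormedAddCommGroup Matrix.frobeniusNormedSpace
  Matrix.frobeniusNormedRing Matrix.frobeniusNormedAlgebra

variable {ι κ : Type} [Fintype ι] [DecidableEq ι] [Fintype κ] [DecidableEq κ]

theorem Matrix.borelSpace_frobenius : @BorelSpace (Matrix κ ι ℂ)
    Matrix.frobeniusNormedAddCommGroup.toPseudoMetricSpace.toUniformSpace.toTopologicalSpace _ :=
  Matrix.borelSpaceComplex

attribute [local instance] Matrix.borelSpace_frobenius

theorem Matrix.frobenius_norm_sq (A : Matrix κ ι ℂ) : ‖A‖ ^ 2 = ∑ i, ∑ j, ‖A i j‖ ^ 2 := by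
  rw [frobenius_norm_def, ← Real.rpow_natCast, ← Real.rpow_mul (by positivity)]
  simp

theorem Matrix.re_trace_mul_conjTranspose (A : Matrix κ ι ℂ) : (trace (A * Aᴴ)).re = ‖A‖ ^ 2 := by
  rw [frobenius_norm_sq]
  simp [trace, Matrix.mul_apply, Complex.mul_conj, Complex.ofReal_re,
    Complex.normSq_eq_norm_sq, -Complex.ofReal_pow]

theorem traceForm_eq_norm_sq (c : ℕ) (A : Matrix ι ι ℂ) :
    traceForm c A = (c : ℝ)⁻¹ * ‖A‖ ^ 2 := by
  rw [traceForm, re_trace_mul_conjTranspose]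

/-- Orthonormal coordinates on a space of matrices, with respect to the trace form. -/
theorem exists_traceForm_frame {c : ℕ} (hc : c ≠ 0) (p : Submodule ℝ (Matrix ι ι ℂ)) :
    ∃ e : EuclideanSpace ℝ (Fin ((p : Set (Matrix ι ι ℂ)).finrank ℝ)) →ₗ[ℝ] Matrix ι ι ℂ,
      LinearMap.range e = p ∧ ∀ x, ‖e x‖ ^ 2 = c * ‖x‖ ^ 2 := by
  let L : Matrix ι ι ℂ ≃ₗ[ℝ] EuclideanSpace ℂ (ι × ι) :=
    { toFun := fun A => WithLp.toLp 2 fun ij => A ij.1 ij.2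
      invFun := fun x => Matrix.of fun i j => x (i, j)
      map_add' := fun A B => by ext; simp
      map_smul' := fun r A => by ext; simp
      left_inv := fun A => by ext; simp
      right_inv := fun x => by ext; simp }
  have hL : ∀ A, ‖L A‖ ^ 2 = ‖A‖ ^ 2 := fun A => by
    rw [EuclideanSpace.norm_sq_eq, frobenius_norm_sq, Fintype.sum_prod_type]
    rfl
  have hfr : Module.finrank ℝ (p.map (L : Matrix ι ι ℂ →ₗ[ℝ] EuclideanSpace ℂ (ι × ι))) =
      (p : Set (Matrix ι ι ℂ)).finrank ℝ := by
    rw [Set.finrank, Submodule.span_eq]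
    exact LinearEquiv.finrank_map_eq L p
  let b := (stdOrthonormalBasis ℝ (p.map (L : Matrix ι ι ℂ →ₗ[ℝ]
    EuclideanSpace ℂ (ι × ι)))).reindex (finCongr hfr)
  let e₀ : EuclideanSpace ℝ (Fin ((p : Set (Matrix ι ι ℂ)).finrank ℝ)) →ₗ[ℝ] Matrix ι ι ℂ :=
    (L.symm : EuclideanSpace ℂ (ι × ι) →ₗ[ℝ] Matrix ι ι ℂ) ∘ₗ
      (p.map (L : Matrix ι ι ℂ →ₗ[ℝ] EuclideanSpace ℂ (ι × ι))).subtype ∘ₗ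
      (b.repr.symm.toLinearEquiv : _ →ₗ[ℝ] _)
  have he₀ : ∀ x, e₀ x = L.symm (b.repr.symm x : EuclideanSpace ℂ (ι × ι)) := fun x => rfl
  have hrange : ∀ A, A ∈ p → ∃ x, e₀ x = A := fun A hA => by
    refine ⟨b.repr ⟨L A, Submodule.mem_map_of_mem hA⟩, ?_⟩
    rw [he₀]
    simp
  have hmem : ∀ x, e₀ x ∈ p := fun x => by
    obtain ⟨A, hA, hAx⟩ := Submodule.mem_map.1 (b.repr.symm x).2
    rw [he₀, ← hAx]
    simpa using hA
  have hn : ∀ x, ‖e₀ x‖ ^ 2 = ‖x‖ ^ 2 := fun x => by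
    rw [← hL, he₀, LinearEquiv.apply_symm_apply, Submodule.norm_coe,
      LinearIsometryEquiv.norm_map]
  have hs : Real.sqrt c ≠ 0 := (Real.sqrt_pos.2 (by positivity)).ne'
  refine ⟨Real.sqrt c • e₀, ?_, fun x => ?_⟩
  · ext A
    constructor
    · rintro ⟨x, rfl⟩
      exact p.smul_mem _ (hmem x)
    · intro hA
      obtain ⟨x, hx⟩ := hrange A hA
      refine ⟨(Real.sqrt c)⁻¹ • x, ?_⟩
      rw [LinearMap.smul_apply, map_smul, hx, smul_smul, mul_inv_cancel₀ hs, one_smul]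
  · rw [LinearMap.smul_apply, norm_smul, mul_pow, hn, Real.norm_eq_abs, sq_abs,
      Real.sq_sqrt (by positivity)]

theorem StarSubalgebra.isClosed_matrix (N : StarSubalgebra ℝ (Matrix ι ι ℂ)) :
    IsClosed (N : Set (Matrix ι ι ℂ)) :=
  Submodule.closed_of_finiteDimensional (Subalgebra.toSubmodule N.toSubalgebra)

theorem StarSubalgebra.exp_mem_matrix (N : StarSubalgebra ℝ (Matrix ι ι ℂ)) {A : Matrix ι ι ℂ}
    (hA : A ∈ N) : NormedSpace.exp A ∈ N :=
  NormedSpace.exp_mem (s := N) N.isClosed_matrix hA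

theorem hasDerivAt_exp_smul_zero (A : Matrix ι ι ℂ) :
    HasDerivAt (fun t : ℝ => NormedSpace.exp (t • A)) A 0 := by
  have := hasDerivAt_exp_smul_const (𝕂 := ℝ) A 0
  rw [zero_smul, NormedSpace.exp_zero, one_mul] at this
  exact this

/-- A subspace which contains `g - 1` for all `g` in a one-parameter group contains its
generator. -/
theorem Submodule.mem_of_forall_exp_smul_sub_one_mem (p : Submodule ℝ (Matrix ι ι ℂ))
    {A : Matrix ι ι ℂ} (h : ∀ t : ℝ, NormedSpace.exp (t • A) - 1 ∈ p) : A ∈ p := by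
  have hd := hasDerivAt_iff_tendsto_slope.1 (hasDerivAt_exp_smul_zero A)
  refine (Submodule.closed_of_finiteDimensional p).mem_of_tendsto hd (Eventually.of_forall ?_)
  intro t
  rw [slope_def_module]
  have h0 := p.sub_mem (h t) (h 0)
  rw [sub_sub_sub_cancel_right] at h0
  exact p.smul_mem _ h0

theorem StarSubalgebra.mem_of_forall_exp_smul_mem (N : StarSubalgebra ℝ (Matrix ι ι ℂ))
    {A : Matrix ι ι ℂ} (h : ∀ t : ℝ, NormedSpace.exp (t • A) ∈ N) : A ∈ N :=
  Submodule.mem_of_forall_exp_smul_sub_one_mem (Subalgebra.toSubmodule N.toSubalgebra)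
    fun t => N.sub_mem (h t) N.one_mem

/-- Multiplying the exponential series by `P` kills every term except the constant one. -/
theorem mul_exp_of_mul_eq_zero {P : Matrix κ ι ℂ} {A : Matrix ι ι ℂ} (h : P * A = 0) :
    P * NormedSpace.exp A = P := by
  have h1 := NormedSpace.exp_series_hasSum_exp' (𝕂 := ℝ) A
  let f : Matrix ι ι ℂ →+ Matrix κ ι ℂ :=
    { toFun := fun B => P * B
      map_zero' := by simp
      map_add' := fun B C => by rw [Matrix.mul_add] }
  have hf : Continuous f := continuous_const.matrix_mul continuous_id
  have h2 := hasSum_single (f := f ∘ fun n : ℕ => (n.factorial : ℝ)⁻¹ • A ^ n) 0 fun n hn => by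
    obtain ⟨m, rfl⟩ := Nat.exists_eq_succ_of_ne_zero hn
    simp [f, pow_succ', ← Matrix.mul_assoc, h]
  have h3 : f (NormedSpace.exp A) = f (((Nat.factorial 0 : ℕ) : ℝ)⁻¹ • A ^ 0) :=
    (h1.map f hf).unique h2
  rw [Nat.factorial_zero, Nat.cast_one, inv_one, one_smul, pow_zero] at h3
  exact h3.trans (Matrix.mul_one P)

theorem exp_mul_conjTranspose_of_skew {A : Matrix ι ι ℂ} (hA : Aᴴ = -A) :
    NormedSpace.exp A * (NormedSpace.exp A)ᴴ = 1 := by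
  rw [← exp_conjTranspose, hA,
    ← Matrix.exp_add_of_commute A (-A) ((Commute.refl A).neg_right), add_neg_cancel,
    NormedSpace.exp_zero]

/-- Unitarity says that the one-parameter groups of `Aᴴ` and `-A` coincide; compare derivatives at
`0`. -/
theorem conjTranspose_eq_neg_of_forall_exp {A : Matrix ι ι ℂ}
    (h : ∀ t : ℝ, NormedSpace.exp (t • A) * (NormedSpace.exp (t • A))ᴴ = 1) : Aᴴ = -A := by
  have h1 : ∀ t : ℝ, NormedSpace.exp (t • Aᴴ) = NormedSpace.exp (t • -A) := fun t => by
    have e1 : (t • A)ᴴ = t • Aᴴ := by simp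
    rw [← e1, exp_conjTranspose, smul_neg, Matrix.exp_neg]
    exact (Matrix.inv_eq_right_inv (h t)).symm
  have h2 := hasDerivAt_exp_smul_zero Aᴴ
  simp only [h1] at h2
  exact h2.unique (hasDerivAt_exp_smul_zero (-A))

/-- The Lie algebra of the group of unitary elements of a real matrix `*`-algebra. -/
theorem lieSet_eq_of_unitary {N : StarSubalgebra ℝ (Matrix ι ι ℂ)} {K : Subgroup (GL ι ℂ)}
    (hK : ∀ k : GL ι ℂ, k ∈ K ↔ (k : Matrix ι ι ℂ) ∈ N ∧
      (k : Matrix ι ι ℂ) * (k : Matrix ι ι ℂ)ᴴ = 1) :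
    lieSet K = {A | A ∈ N ∧ Aᴴ = -A} := by
  ext A
  constructor
  · intro hA
    have h : ∀ t : ℝ, NormedSpace.exp (t • A) ∈ N ∧
        NormedSpace.exp (t • A) * (NormedSpace.exp (t • A))ᴴ = 1 := fun t => by
      obtain ⟨k, hk, hkt⟩ := hA t
      rw [← hkt]
      exact (hK k).1 hk
    exact ⟨N.mem_of_forall_exp_smul_mem fun t => (h t).1, conjTranspose_eq_neg_of_forall_exp fun t => (h t).2⟩
  · rintro ⟨hA, hs⟩ t
    have h1 : (t • A)ᴴ = -(t • A) := by simp [hs]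
    have h2 := exp_mul_conjTranspose_of_skew h1
    exact ⟨⟨_, _, h2, mul_eq_one_comm.1 h2⟩,
      (hK _).2 ⟨N.exp_mem_matrix (N.smul_mem hA t), h2⟩, rfl⟩

/-- The Lie algebra of the stabilizer of `P` in the group of unitary elements of a real matrix
`*`-algebra. -/
theorem lieSet_eq_of_stabilizer {N : StarSubalgebra ℝ (Matrix ι ι ℂ)} {P : Matrix κ ι ℂ}
    {K : Subgroup (GL ι ℂ)}
    (hK : ∀ k : GL ι ℂ, k ∈ K ↔ ((k : Matrix ι ι ℂ) ∈ N ∧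
      (k : Matrix ι ι ℂ) * (k : Matrix ι ι ℂ)ᴴ = 1) ∧ P * (k : Matrix ι ι ℂ) = P) :
    lieSet K = {A | (A ∈ N ∧ Aᴴ = -A) ∧ P * A = 0} := by
  ext A
  constructor
  · intro hA
    have h : ∀ t : ℝ, (NormedSpace.exp (t • A) ∈ N ∧
        NormedSpace.exp (t • A) * (NormedSpace.exp (t • A))ᴴ = 1) ∧
        P * NormedSpace.exp (t • A) = P := fun t => by
      obtain ⟨k, hk, hkt⟩ := hA t
      rw [← hkt]
      exact (hK k).1 hk
    refine ⟨⟨N.mem_of_forall_exp_smul_mem fun t => (h t).1.1,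
      conjTranspose_eq_neg_of_forall_exp fun t => (h t).1.2⟩, ?_⟩
    let p : Submodule ℝ (Matrix ι ι ℂ) :=
      { carrier := {B | P * B = 0}
        zero_mem' := Matrix.mul_zero P
        add_mem' := fun {a b} (ha : P * a = 0) (hb : P * b = 0) =>
          show P * (a + b) = 0 by rw [Matrix.mul_add, ha, hb, add_zero]
        smul_mem' := fun c a (ha : P * a = 0) =>
          show P * (c • a) = 0 by rw [Matrix.mul_smul, ha, smul_zero] }
    refine p.mem_of_forall_exp_smul_sub_one_mem fun t => ?_
    change P * (NormedSpace.exp (t • A) - 1) = 0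
    rw [Matrix.mul_sub, (h t).2, Matrix.mul_one, sub_self]
  · rintro ⟨⟨hA, hs⟩, hP⟩ t
    have h1 : (t • A)ᴴ = -(t • A) := by simp [hs]
    have h2 := exp_mul_conjTranspose_of_skew h1
    refine ⟨⟨_, _, h2, mul_eq_one_comm.1 h2⟩,
      (hK _).2 ⟨⟨N.exp_mem_matrix (N.smul_mem hA t), h2⟩, ?_⟩, rfl⟩
    exact mul_exp_of_mul_eq_zero (by rw [Matrix.mul_smul, hP, smul_zero])

theorem lieSet_eq_of_units {A : StarSubalgebra ℝ (Matrix κ κ ℂ)} {G : Subgroup (GL κ ℂ)}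
    (hG : ∀ g : GL κ ℂ, g ∈ G ↔ (g : Matrix κ κ ℂ) ∈ A) : lieSet G = A := by
  ext B
  constructor
  · intro hB
    refine A.mem_of_forall_exp_smul_mem fun t => ?_
    obtain ⟨g, hg, hgt⟩ := hB t
    rw [← hgt]
    exact (hG g).1 hg
  · intro hB t
    have h2 : NormedSpace.exp (t • B) * NormedSpace.exp (-(t • B)) = 1 := by
      rw [← Matrix.exp_add_of_commute (t • B) (-(t • B)) ((Commute.refl (t • B)).neg_right),
        add_neg_cancel, NormedSpace.exp_zero]
    exact ⟨⟨_, _, h2, mul_eq_one_comm.1 h2⟩, (hG _).2 (A.exp_mem_matrix (A.smul_mem hB t)), rfl⟩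

/-- A positive definite matrix has a square root which is a real polynomial in it. -/
theorem Matrix.PosDef.exists_polynomial_mul_self {D : Matrix ι ι ℂ} (hD : D.PosDef) :
    ∃ q : Polynomial ℝ, Polynomial.aeval D q * Polynomial.aeval D q = D := by
  have hsa : IsSelfAdjoint D := hD.1
  have hfin : (spectrum ℝ D).Finite := Matrix.finite_real_spectrum
  -- The polynomial interpolates the square root on the finite real spectrum. Polynomiality is what
  -- later keeps the root inside `N` and commuting with everything that commutes with `D`.
  let q := Lagrange.interpolate hfin.toFinset id (fun x => Real.sqrt x)
  refine ⟨q, ?_⟩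
  rw [← map_mul, ← cfc_polynomial (q * q) D hsa]
  conv_rhs => rw [← cfc_id' ℝ D hsa]
  refine cfc_congr fun x hx => ?_
  have h1 : Polynomial.eval x q = Real.sqrt x :=
    Lagrange.eval_interpolate_at_node (s := hfin.toFinset) (v := id) (i := x)
      (fun x => Real.sqrt x) (Set.injOn_id _) (hfin.mem_toFinset.2 hx)
  have hx0 : 0 ≤ x := by
    rw [hD.1.spectrum_real_eq_range_eigenvalues] at hx
    obtain ⟨i, rfl⟩ := hx
    exact (hD.eigenvalues_pos i).le
  simp only [Polynomial.eval_mul, h1]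
  exact Real.mul_self_sqrt hx0

theorem conjTranspose_aeval_of_isHermitian {D : Matrix ι ι ℂ} (hD : Dᴴ = D)
    (q : Polynomial ℝ) : (Polynomial.aeval D q)ᴴ = Polynomial.aeval D q := by
  induction q using Polynomial.induction_on' with
  | add p q hp hq => rw [map_add, conjTranspose_add, hp, hq]
  | monomial n a =>
    rw [Polynomial.aeval_monomial, conjTranspose_mul, conjTranspose_pow, hD]
    rw [Algebra.algebraMap_eq_smul_one]
    simp

/-- A closed group of unitary matrices is compact. -/
theorem compactSpace_of_isClosed_of_unitary {K : Subgroup (GL ι ℂ)}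
    (hcl : IsClosed (K : Set (GL ι ℂ)))
    (hK : ∀ k ∈ K, (k : Matrix ι ι ℂ) * (k : Matrix ι ι ℂ)ᴴ = 1) : CompactSpace K := by
  let j : K → Matrix ι ι ℂ := fun k => ((k : GL ι ℂ) : Matrix ι ι ℂ)
  have hj : IsEmbedding j := Matrix.isEmbedding_val_GL.comp IsEmbedding.subtypeVal
  have hU : IsClosed {A : Matrix ι ι ℂ | A * Aᴴ = 1} :=
    isClosed_eq (continuous_id.matrix_mul continuous_id.matrix_conjTranspose) continuous_const
  have hrange : IsClosed (Set.range j) := by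
    -- The image of `K` among matrices is the preimage of the closed set `K` under this continuous
    -- lift, hence closed in the closed set of unitary matrices. It is bounded since each of its
    -- elements has Frobenius norm square `card ι`.
    let u : {A : Matrix ι ι ℂ | A * Aᴴ = 1} → GL ι ℂ := fun A =>
      ⟨A.1, A.1ᴴ, A.2, mul_eq_one_comm.1 A.2⟩
    have hu : Continuous u := by
      rw [Matrix.isEmbedding_val_GL.continuous_iff]
      exact continuous_subtype_val
    have : Set.range j = Subtype.val '' (u ⁻¹' (K : Set (GL ι ℂ))) := by
      ext A
      constructor
      · rintro ⟨k, rfl⟩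
        refine ⟨⟨_, hK k k.2⟩, ?_, rfl⟩
        have : u ⟨j k, hK k k.2⟩ = k := Units.ext rfl
        rw [Set.mem_preimage, this]
        exact k.2
      · rintro ⟨A, hA, rfl⟩
        exact ⟨⟨u A, hA⟩, rfl⟩
    rw [this]
    exact hU.isClosedEmbedding_subtypeVal.isClosedMap _ (hcl.preimage hu)
  have hbdd : Bornology.IsBounded (Set.range j) := by
    rw [isBounded_iff_forall_norm_le]
    refine ⟨Real.sqrt (Fintype.card ι), ?_⟩
    rintro _ ⟨k, rfl⟩
    refine Real.le_sqrt_of_sq_le ?_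
    rw [← re_trace_mul_conjTranspose, hK k k.2]
    simp
  have hc : IsCompact (Set.range j) := Metric.isCompact_of_isClosed_isBounded hrange hbdd
  rw [← Set.image_univ] at hc
  exact ⟨hj.isCompact_iff.2 hc⟩

end MatrixAnalysis

/-! ### Volume distortion in exponential charts; bimodules and tubes -/

section LocalVolume

attribute [local instance] Matrix.frobeniusNormedAddCommGroup Matrix.frobeniusNormedSpace
  Matrix.frobeniusNormedRing Matrix.frobeniusNormedAlgebra Matrix.borelSpace_frobenius

theorem IsOpen.isSigmaCompact_of_locallyCompact {Y : Type*} [TopologicalSpace Y]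
    [LocallyCompactSpace Y] [SecondCountableTopology Y] {U : Set Y} (hU : IsOpen U) :
    IsSigmaCompact U := by
  have : LocallyCompactSpace U := hU.locallyCompactSpace
  have h : SigmaCompactSpace U := inferInstance
  have := isSigmaCompact_univ (X := U) |>.image continuous_subtype_val
  simpa using this

theorem IsOpen.measurableSet_image {Y Z : Type*} [TopologicalSpace Y]
    [LocallyCompactSpace Y] [SecondCountableTopology Y] [TopologicalSpace Z] [T2Space Z]
    [MeasurableSpace Z] [BorelSpace Z] {U : Set Y} (hU : IsOpen U) {f : Y → Z}
    (hf : Continuous f) : MeasurableSet (f '' U) := by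
  obtain ⟨s, hs, hsU⟩ := hU.isSigmaCompact_of_locallyCompact.image hf
  rw [← hsU]
  exact MeasurableSet.iUnion fun n => (hs n).measurableSet

theorem ENNReal.tendsto_div_one_of_forall {α : Type*} {l : Filter α} {g h : α → ℝ≥0∞}
    (h0 : ∀ᶠ z in l, h z ≠ 0 ∧ h z ≠ ⊤)
    (H : ∀ m : NNReal, 1 < m → ∀ᶠ z in l, g z ≤ m * h z ∧ h z ≤ m * g z) :
    Tendsto (fun z => g z / h z) l (𝓝 1) := by
  refine tendsto_order.2 ⟨fun a ha => ?_, fun a ha => ?_⟩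
  · have ha' : 1 < a⁻¹ := ENNReal.one_lt_inv.2 ha
    obtain ⟨m, hm1, hm⟩ := ENNReal.lt_iff_exists_nnreal_btwn.1 ha'
    filter_upwards [h0, H m (by exact_mod_cast hm1)] with z hz hz2
    have h1 : a < (m : ℝ≥0∞)⁻¹ := by
      rw [← inv_inv a]
      exact ENNReal.inv_lt_inv.2 hm
    refine h1.trans_le ?_
    have hm0 : (m : ℝ≥0∞) ≠ 0 := (zero_lt_one.trans hm1).ne'
    rw [ENNReal.le_div_iff_mul_le (Or.inl hz.1) (Or.inl hz.2),
      ENNReal.inv_mul_le_iff hm0 ENNReal.coe_ne_top]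
    exact hz2.2
  · obtain ⟨m, hm1, hm⟩ := ENNReal.lt_iff_exists_nnreal_btwn.1 ha
    filter_upwards [h0, H m (by exact_mod_cast hm1)] with z hz hz2
    refine lt_of_le_of_lt ?_ hm
    exact ENNReal.div_le_of_le_mul hz2.1

/-- The image of a Haar measure under an injective linear map is invariant under linear
isometries which preserve the range. -/
theorem MeasureTheory.Measure.map_map_linear_isometry {D W : Type*}
    [NormedAddCommGroup D] [NormedSpace ℝ D] [FiniteDimensional ℝ D] [MeasurableSpace D]
    [BorelSpace D] [NormedAddCommGroup W] [NormedSpace ℝ W]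
    [MeasurableSpace W] [BorelSpace W] (μ : Measure D) [μ.IsAddHaarMeasure]
    {Λ : D →ₗ[ℝ] W} (hΛ : Function.Injective Λ) {R : W →ₗ[ℝ] W} (hR : ∀ w, ‖R w‖ = ‖w‖)
    (hr : ∀ x, R (Λ x) ∈ LinearMap.range Λ) : (μ.map Λ).map R = μ.map Λ := by
  have hΛc := LinearMap.continuous_of_finiteDimensional Λ
  have hRc : Continuous R := AddMonoidHomClass.continuous_of_bound R 1 fun w => by
    rw [hR, one_mul]
  have hRinj : Function.Injective R := by
    refine (injective_iff_map_eq_zero R).2 fun w hw => ?_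
    rw [← norm_eq_zero, ← hR, hw, norm_zero]
  have hinj : Function.Injective (R ∘ₗ Λ) := hRinj.comp hΛ
  have hrange : LinearMap.range Λ = LinearMap.range (R ∘ₗ Λ) := by
    refine (Submodule.eq_of_le_of_finrank_eq ?_ ?_).symm
    · rintro _ ⟨x, rfl⟩
      exact hr x
    · rw [LinearMap.finrank_range_of_inj hinj, LinearMap.finrank_range_of_inj hΛ]
  -- The indicator of the unit ball serves as test function: it is unchanged by the isometry `R`, so
  -- the proportionality factor is `1`.
  have hint : ∫⁻ x, (Metric.ball (0 : W) 1).indicator 1 (Λ x) ∂μ = μ (Λ ⁻¹' Metric.ball 0 1) := by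
    rw [← lintegral_indicator_one (hΛc.measurable measurableSet_ball)]
    rfl
  rw [Measure.map_map hRc.measurable hΛc.measurable]
  have := Measure.map_linear_eq_smul μ μ hΛ hinj hrange
    (Q := (Metric.ball (0 : W) 1).indicator 1) (t := 1)
    (measurable_one.indicator measurableSet_ball) ?_ ?_ ?_
  · rw [one_smul] at this
    exact this
  · rw [hint]
    exact ((Metric.isOpen_ball.preimage hΛc).measure_pos μ ⟨0, by simp⟩).ne'
  · rw [hint]
    obtain ⟨C, -, hC⟩ := Λ.exists_antilipschitzWith (LinearMap.ker_eq_bot.2 hΛ)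
    exact (hC.isBounded_preimage Metric.isBounded_ball).measure_lt_top.ne
  · rw [one_mul]
    refine lintegral_congr fun x => ?_
    have : (Metric.ball (0 : W) 1).indicator (1 : W → ℝ≥0∞) ((R ∘ₗ Λ) x) =
        (Metric.ball (0 : W) 1).indicator 1 (Λ x) := by
      simp only [Set.indicator, mem_ball_zero_iff, LinearMap.comp_apply, hR, Pi.one_apply]
    exact this

/-- Product rule at the origin, using that `exp` is tangent to the identity at `0`. It serves for
products of two exponentials and for `exp(B) P σ(y)` alike. -/
theorem HasStrictFDerivAt.exp_bilinear {E F 𝔸 V W : Type*} [NormedAddCommGroup E]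
    [NormedSpace ℝ E] [FiniteDimensional ℝ E] [NormedAddCommGroup F] [NormedSpace ℝ F]
    [FiniteDimensional ℝ F] [NormedRing 𝔸] [NormedAlgebra ℝ 𝔸] [CompleteSpace 𝔸]
    [NormedAddCommGroup V] [NormedSpace ℝ V] [NormedAddCommGroup W] [NormedSpace ℝ W]
    {f : 𝔸 × V → W} (hf : IsBoundedBilinearMap ℝ f) (e : E →ₗ[ℝ] 𝔸) {σ : F → V}
    {σ' : F →L[ℝ] V} (hσ : HasStrictFDerivAt σ σ' 0) {Λ : E × F →ₗ[ℝ] W}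
    (hΛ : ∀ z, Λ z = f (e z.1, σ 0) + f (1, σ' z.2)) :
    HasStrictFDerivAt (fun z : E × F => f (NormedSpace.exp (e z.1), σ z.2))
      (LinearMap.toContinuousLinearMap Λ) 0 := by
  let ec : E →L[ℝ] 𝔸 := LinearMap.toContinuousLinearMap e
  have h1 : HasStrictFDerivAt (NormedSpace.exp : 𝔸 → 𝔸) (1 : 𝔸 →L[ℝ] 𝔸)
      ((ec.comp (ContinuousLinearMap.fst ℝ E F)) 0) := by
    rw [map_zero]
    exact hasStrictFDerivAt_exp_zero
  have h2 := h1.comp (0 : E × F) (ec.comp (ContinuousLinearMap.fst ℝ E F)).hasStrictFDerivAt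
  have h3 : HasStrictFDerivAt (fun z : E × F => σ z.2)
      (σ'.comp (ContinuousLinearMap.snd ℝ E F)) 0 :=
    HasStrictFDerivAt.comp (g := σ) (0 : E × F) hσ (ContinuousLinearMap.snd ℝ E F).hasStrictFDerivAt
  refine ((hf.hasStrictFDerivAt _).comp (0 : E × F) (h2.prodMk h3)).congr_fderiv
    (ContinuousLinearMap.ext fun z => ?_)
  simp [hΛ, ec, add_comm]

/-- A map into the range of its injective derivative at `0` nearly transports a Haar measure to
its image under the derivative. -/
theorem HasStrictFDerivAt.exists_ball_map_measure_image {D W : Type*} [NormedAddCommGroup D]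
    [NormedSpace ℝ D] [FiniteDimensional ℝ D] [MeasurableSpace D] [BorelSpace D]
    [NormedAddCommGroup W] [NormedSpace ℝ W] [FiniteDimensional ℝ W] [MeasurableSpace W]
    [BorelSpace W] (ν : Measure D) [ν.IsAddHaarMeasure] {Λ : D →ₗ[ℝ] W}
    (hΛi : Function.Injective Λ) {ψ : D → W}
    (hψ : HasStrictFDerivAt ψ (LinearMap.toContinuousLinearMap Λ) 0)
    (hψr : ∀ z, ψ z ∈ LinearMap.range Λ) (hψc : Continuous ψ) {m : NNReal} (hm : 1 < m) :
    ∃ δ > 0, ∀ S ⊆ Metric.ball (0 : D) δ, IsOpen S →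
      ν.map Λ (ψ '' S) ≤ m * ν S ∧ ν S ≤ m * ν.map Λ (ψ '' S) := by
  have hΛc : Continuous Λ := LinearMap.continuous_of_finiteDimensional Λ
  -- Composing with a left inverse of `Λ` turns `ψ` into a self-map of `D` tangent to the identity.
  -- Nothing is lost, because `ψ` takes values in the range of `Λ`.
  obtain ⟨Γ, hΓ⟩ := Λ.exists_leftInverse_of_injective (LinearMap.ker_eq_bot.2 hΛi)
  have hΓΛ : ∀ z, Γ (Λ z) = z := fun z => LinearMap.congr_fun hΓ z
  have hΛΓ : ∀ z, Λ (Γ (ψ z)) = ψ z := fun z => by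
    obtain ⟨y, hy⟩ := hψr z
    rw [← hy, hΓΛ]
  have hφ : HasStrictFDerivAt (fun z => Γ (ψ z)) (ContinuousLinearMap.id ℝ D) 0 :=
    ((LinearMap.toContinuousLinearMap Γ).hasStrictFDerivAt.comp (0 : D) hψ).congr_fderiv
      (ContinuousLinearMap.ext fun z => hΓΛ z)
  have hpre : ∀ S : Set D, Λ ⁻¹' (ψ '' S) = (fun z => Γ (ψ z)) '' S := fun S => by
    ext z
    constructor
    · rintro ⟨s, hs, hsz⟩
      exact ⟨s, hs, by simp only [hsz, hΓΛ]⟩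
    · rintro ⟨s, hs, rfl⟩
      exact ⟨s, hs, (hΛΓ s).symm⟩
  obtain ⟨δ, hδ, h⟩ := hφ.exists_ball_measure_image ν hm
  refine ⟨δ, hδ, fun S hS hSo => ?_⟩
  rw [Measure.map_apply hΛc.measurable (hSo.measurableSet_image hψc), hpre]
  exact h S hS

variable {ι κ : Type} [Fintype ι] [DecidableEq ι] [Fintype κ] [DecidableEq κ]

/-- A real `*`-algebra `A` of matrices on `ℂ^κ`, another one `N` on `ℂ^ι`, and a real space `X` of
linear maps `ℂ^ι → ℂ^κ` which is a bimodule, with inner products in `A` and `N`. -/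
structure MatrixBimodule (κ ι : Type) [Fintype κ] [DecidableEq κ] [Fintype ι] [DecidableEq ι] where
  A : StarSubalgebra ℝ (Matrix κ κ ℂ)
  X : Submodule ℝ (Matrix κ ι ℂ)
  N : StarSubalgebra ℝ (Matrix ι ι ℂ)
  mul_mem_left : ∀ {a x}, a ∈ A → x ∈ X → a * x ∈ X
  mul_mem_right : ∀ {x b}, x ∈ X → b ∈ N → x * b ∈ X
  mul_conjTranspose_mem : ∀ {x y}, x ∈ X → y ∈ X → x * yᴴ ∈ A
  conjTranspose_mul_mem : ∀ {x y}, x ∈ X → y ∈ X → xᴴ * y ∈ N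

/-- The group of unitary elements of a real matrix `*`-algebra. -/
def IsUnitaryGroupOf (K : Subgroup (GL ι ℂ)) (N : StarSubalgebra ℝ (Matrix ι ι ℂ)) : Prop :=
  ∀ k : GL ι ℂ, k ∈ K ↔ (k : Matrix ι ι ℂ) ∈ N ∧ (k : Matrix ι ι ℂ) * (k : Matrix ι ι ℂ)ᴴ = 1

theorem norm_mul_of_unitary (M : Matrix κ ι ℂ) {k : Matrix ι ι ℂ} (hk : k * kᴴ = 1) :
    ‖M * k‖ = ‖M‖ := by
  have h : ‖M * k‖ ^ 2 = ‖M‖ ^ 2 := by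
    rw [← re_trace_mul_conjTranspose, ← re_trace_mul_conjTranspose, conjTranspose_mul,
      Matrix.mul_assoc, ← Matrix.mul_assoc k, hk, Matrix.one_mul]
  exact (pow_left_inj₀ (norm_nonneg _) (norm_nonneg _) two_ne_zero).1 h

variable {E : Type*} [NormedAddCommGroup E] [NormedSpace ℝ E] [FiniteDimensional ℝ E]
  [MeasurableSpace E] [BorelSpace E]

/-- The matrices `exp (B) * P * k` with `k ∈ K` and `B = e x`, `‖x‖ < r`. -/
def tube (e : E →ₗ[ℝ] Matrix κ κ ℂ) (P : Matrix κ ι ℂ) (K : Subgroup (GL ι ℂ)) (r : ℝ) :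
    Set (Matrix κ ι ℂ) :=
  {M | ∃ x ∈ Metric.ball (0 : E) r, ∃ k ∈ K,
    M = NormedSpace.exp (e x) * P * ((k : GL ι ℂ) : Matrix ι ι ℂ)}

theorem continuous_exp_comp (e : E →ₗ[ℝ] Matrix κ κ ℂ) :
    Continuous fun x => NormedSpace.exp (e x) :=
  (NormedSpace.exp_continuous (𝔸 := Matrix κ κ ℂ)).comp
    (LinearMap.continuous_of_finiteDimensional e)

theorem continuous_val_subgroup (K : Subgroup (GL ι ℂ)) :
    Continuous fun k : K => ((k : GL ι ℂ) : Matrix ι ι ℂ) :=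
  Units.continuous_val.comp continuous_subtype_val

theorem measurableSet_tube (e : E →ₗ[ℝ] Matrix κ κ ℂ) (P : Matrix κ ι ℂ)
    (K : Subgroup (GL ι ℂ)) [LocallyCompactSpace K] (r : ℝ) : MeasurableSet (tube e P K r) := by
  have h : tube e P K r = (fun z : E × K => NormedSpace.exp (e z.1) * P *
      ((z.2 : GL ι ℂ) : Matrix ι ι ℂ)) '' (Metric.ball 0 r ×ˢ Set.univ) := by
    ext M
    constructor
    · rintro ⟨x, hx, k, hk, rfl⟩
      exact ⟨(x, ⟨k, hk⟩), ⟨hx, trivial⟩, rfl⟩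
    · rintro ⟨⟨x, k⟩, ⟨hx, -⟩, rfl⟩
      exact ⟨x, hx, k, k.2, rfl⟩
  rw [h]
  refine (Metric.isOpen_ball.prod isOpen_univ).measurableSet_image ?_
  exact (((continuous_exp_comp e).comp continuous_fst).matrix_mul
    continuous_const).matrix_mul ((continuous_val_subgroup K).comp continuous_snd)

/-- In `exp (B) * P * k` with small Hermitian `B` and unitary `k`, the first factor is determined
by the product. -/
theorem exists_exp_eq_of_exp_mul_eq {e : E →ₗ[ℝ] Matrix κ κ ℂ} (he : ∀ x, (e x)ᴴ = e x)
    {P : Matrix κ ι ℂ} (hP : P * Pᴴ = 1) :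
    ∃ ρ > 0, ∀ x ∈ Metric.ball (0 : E) ρ, ∀ y ∈ Metric.ball (0 : E) ρ, ∀ k k' : Matrix ι ι ℂ,
      k * kᴴ = 1 → k' * k'ᴴ = 1 →
      NormedSpace.exp (e x) * P * k = NormedSpace.exp (e y) * P * k' → e x = e y := by
  have h1 : HasStrictFDerivAt (NormedSpace.exp : Matrix κ κ ℂ → Matrix κ κ ℂ)
      (ContinuousLinearMap.id ℝ (Matrix κ κ ℂ)) 0 := hasStrictFDerivAt_exp_zero
  obtain ⟨δ, hδ, hinj⟩ := h1.exists_ball_injOn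
  have hc : Continuous fun x => (2 : ℝ) • e x :=
    (LinearMap.continuous_of_finiteDimensional e).const_smul (2 : ℝ)
  obtain ⟨ρ, hρ, hsub⟩ := Metric.mem_nhds_iff.1
    ((hc.tendsto' 0 0 (by simp)).eventually (Metric.ball_mem_nhds 0 hδ))
  refine ⟨ρ, hρ, fun x hx y hy k k' hk hk' h => ?_⟩
  -- The product `M = exp(B) P k` determines `M Mᴴ = exp(2B)`, and `exp` is injective near `0`; the
  -- radius `ρ` is chosen so that `2B` stays in that range.
  have key : ∀ (z : E) (k : Matrix ι ι ℂ), k * kᴴ = 1 →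
      (NormedSpace.exp (e z) * P * k) * (NormedSpace.exp (e z) * P * k)ᴴ =
        NormedSpace.exp ((2 : ℝ) • e z) := fun z k hk => by
    rw [two_smul, Matrix.exp_add_of_commute _ _ (Commute.refl (e z)), conjTranspose_mul,
      conjTranspose_mul, ← exp_conjTranspose, he]
    calc _ = NormedSpace.exp (e z) * (P * (k * kᴴ) * Pᴴ) * NormedSpace.exp (e z) := by
          simp only [Matrix.mul_assoc]
      _ = _ := by rw [hk, Matrix.mul_one, hP, Matrix.mul_one]
  have h2 := key x k hk
  rw [h, key y k' hk'] at h2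
  have h3 := hinj (hsub hx) (hsub hy) h2.symm
  have h4 := congrArg (fun M => (2 : ℝ)⁻¹ • M) h3
  simpa [smul_smul] using h4

end LocalVolume

/-! ### Volume of a tube around the orbit of the compact group -/

section TubeVolume

attribute [local instance] Matrix.frobeniusNormedAddCommGroup Matrix.frobeniusNormedSpace
  Matrix.frobeniusNormedRing Matrix.frobeniusNormedAlgebra Matrix.borelSpace_frobenius

variable {ι κ : Type} [Fintype ι] [DecidableEq ι] [Fintype κ] [DecidableEq κ]
variable {E F : Type*} [NormedAddCommGroup E] [NormedSpace ℝ E] [FiniteDimensional ℝ E]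
  [MeasurableSpace E] [BorelSpace E] [NormedAddCommGroup F] [NormedSpace ℝ F]
  [FiniteDimensional ℝ F] [MeasurableSpace F] [BorelSpace F]

theorem isBoundedBilinearMap_mul_mul (P : Matrix κ ι ℂ) :
    IsBoundedBilinearMap ℝ fun z : Matrix κ κ ℂ × Matrix ι ι ℂ => z.1 * P * z.2 where
  add_left := fun a b c => by rw [Matrix.add_mul, Matrix.add_mul]
  smul_left := fun c a b => by rw [Matrix.smul_mul, Matrix.smul_mul]
  add_right := fun a b c => by rw [Matrix.mul_add]
  smul_right := fun c a b => by rw [Matrix.mul_smul]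
  bound := by
    refine ⟨‖P‖ + 1, by positivity, fun a b => ?_⟩
    calc ‖a * P * b‖ ≤ ‖a * P‖ * ‖b‖ := frobenius_norm_mul _ _
      _ ≤ ‖a‖ * ‖P‖ * ‖b‖ :=
          mul_le_mul_of_nonneg_right (frobenius_norm_mul _ _) (norm_nonneg _)
      _ ≤ (‖P‖ + 1) * ‖a‖ * ‖b‖ := by
          nlinarith [mul_nonneg (norm_nonneg a) (norm_nonneg b)]

theorem measurableSet_coset_image {K : Subgroup (GL ι ℂ)} (P : Matrix κ ι ℂ)
    {σ : F → Matrix ι ι ℂ} (hσ : Continuous σ) {T : Set F} (hT : IsOpen T) :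
    MeasurableSet {k : K | ∃ y ∈ T, P * ((k : GL ι ℂ) : Matrix ι ι ℂ) = P * σ y} := by
  have h1 := hT.measurableSet_image (f := fun y => P * σ y)
    (continuous_const.matrix_mul hσ)
  have h2 : Continuous fun k : K => P * ((k : GL ι ℂ) : Matrix ι ι ℂ) :=
    continuous_const.matrix_mul (continuous_val_subgroup K)
  convert h2.measurable h1 using 1
  ext k
  simp [eq_comm]

/-- Right multiplication by a unitary matrix is an isometry for the Frobenius norm, and `hr` says
that it preserves the range of `Λ`. -/
theorem measure_preimage_mul_right {D : Type*} [NormedAddCommGroup D] [NormedSpace ℝ D]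
    [FiniteDimensional ℝ D] [MeasurableSpace D] [BorelSpace D] (ν : Measure D)
    [ν.IsAddHaarMeasure] {Λ : D →ₗ[ℝ] Matrix κ ι ℂ} (hΛi : Function.Injective Λ)
    {K : Subgroup (GL ι ℂ)}
    (hKu : ∀ k ∈ K, ((k : GL ι ℂ) : Matrix ι ι ℂ) * ((k : GL ι ℂ) : Matrix ι ι ℂ)ᴴ = 1)
    (hr : ∀ z, ∀ k ∈ K, Λ z * ((k : GL ι ℂ) : Matrix ι ι ℂ) ∈ LinearMap.range Λ)
    (k : K) (S : Set (Matrix κ ι ℂ)) (hS : MeasurableSet S) :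
    ν.map Λ ((fun M => M * ((k : GL ι ℂ) : Matrix ι ι ℂ)) ⁻¹' S) = ν.map Λ S := by
  let R : Matrix κ ι ℂ →ₗ[ℝ] Matrix κ ι ℂ :=
    { toFun := fun M => M * ((k : GL ι ℂ) : Matrix ι ι ℂ)
      map_add' := fun M M' => Matrix.add_mul _ _ _
      map_smul' := fun c M => Matrix.smul_mul _ _ _ }
  have h : (ν.map Λ).map R = ν.map Λ := Measure.map_map_linear_isometry ν hΛi (R := R)
    (fun M => norm_mul_of_unitary M (hKu k k.2)) (fun z => hr z k k.2)
  have hRm : Measurable R :=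
    (continuous_id.matrix_mul continuous_const : Continuous fun M : Matrix κ ι ℂ =>
      M * ((k : GL ι ℂ) : Matrix ι ι ℂ)).measurable
  conv_rhs => rw [← h, Measure.map_apply hRm hS]
  rfl

/-- Averaging the chart image over right multiplication by `K` spreads it over the whole tube. The
elements that carry a point `exp(B) P k₀` of the tube into the chart image form a left translate by
`k₀⁻¹` of the coset set on the right, because `hexp` forces the Hermitian factors to agree; so their
measure does not depend on the point. -/
theorem measure_tube_mul_coset {K : Subgroup (GL ι ℂ)} [LocallyCompactSpace K]
    {P : Matrix κ ι ℂ} {e : E →ₗ[ℝ] Matrix κ κ ℂ} {σ : F → Matrix ι ι ℂ} (hσc : Continuous σ)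
    (hσK : ∀ y, ∃ k ∈ K, ((k : GL ι ℂ) : Matrix ι ι ℂ) = σ y)
    (hKu : ∀ k ∈ K, ((k : GL ι ℂ) : Matrix ι ι ℂ) * ((k : GL ι ℂ) : Matrix ι ι ℂ)ᴴ = 1)
    {η : Measure K} [η.IsMulLeftInvariant] [SFinite η] {m : Measure (Matrix κ ι ℂ)} [SFinite m]
    (hpres : ∀ k : K, ∀ S, MeasurableSet S →
      m ((fun M => M * ((k : GL ι ℂ) : Matrix ι ι ℂ)) ⁻¹' S) = m S) {r : ℝ}
    (hexp : ∀ x ∈ Metric.ball (0 : E) r, ∀ y ∈ Metric.ball (0 : E) r, ∀ k k' : Matrix ι ι ℂ,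
      k * kᴴ = 1 → k' * k'ᴴ = 1 →
      NormedSpace.exp (e x) * P * k = NormedSpace.exp (e y) * P * k' → e x = e y)
    {S : Set F} (hS : IsOpen S) :
    m ((fun z : E × F => NormedSpace.exp (e z.1) * P * σ z.2) '' (Metric.ball 0 r ×ˢ S)) *
        η Set.univ =
      η {k : K | ∃ y ∈ S, P * ((k : GL ι ℂ) : Matrix ι ι ℂ) = P * σ y} * m (tube e P K r) := by
  have hψc : Continuous fun z : E × F => NormedSpace.exp (e z.1) * P * σ z.2 :=
    (((continuous_exp_comp e).comp continuous_fst).matrix_mul continuous_const).matrix_mul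
      (hσc.comp continuous_snd)
  have hact : Measurable fun z : K × Matrix κ ι ℂ => z.2 * ((z.1 : GL ι ℂ) : Matrix ι ι ℂ) :=
    (continuous_snd.matrix_mul ((continuous_val_subgroup K).comp continuous_fst)).measurable
  have hσu : ∀ y, σ y * (σ y)ᴴ = 1 := fun y => by
    obtain ⟨k, hk, hky⟩ := hσK y
    rw [← hky]
    exact hKu k hk
  refine measure_mul_measure_univ_of_orbit η m hact hpres
    ((Metric.isOpen_ball.prod hS).measurableSet_image hψc) (measurableSet_tube e P K r) ?_ ?_
  · rintro _ ⟨x, hx, k₀, hk₀, rfl⟩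
    have hinv := measure_preimage_mul η (⟨k₀, hk₀⟩ : K)
      {k : K | ∃ y ∈ S, P * ((k : GL ι ℂ) : Matrix ι ι ℂ) = P * σ y}
    rw [← hinv]
    refine congrArg η (Set.ext fun k => ?_)
    change (∃ z ∈ Metric.ball (0 : E) r ×ˢ S, NormedSpace.exp (e z.1) * P * σ z.2 =
      NormedSpace.exp (e x) * P * (k₀ : Matrix ι ι ℂ) * ((k : GL ι ℂ) : Matrix ι ι ℂ)) ↔
      ∃ y ∈ S, P * (((⟨k₀, hk₀⟩ * k : K) : GL ι ℂ) : Matrix ι ι ℂ) = P * σ y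
    have hkk : NormedSpace.exp (e x) * P * (k₀ : Matrix ι ι ℂ) * ((k : GL ι ℂ) : Matrix ι ι ℂ) =
        NormedSpace.exp (e x) * (P * (((⟨k₀, hk₀⟩ * k : K) : GL ι ℂ) : Matrix ι ι ℂ)) := by
      simp only [Matrix.mul_assoc, Subgroup.coe_mul, Units.val_mul]
    have hu := hKu _ (⟨k₀, hk₀⟩ * k : K).2
    rw [hkk]
    generalize (((⟨k₀, hk₀⟩ * k : K) : GL ι ℂ) : Matrix ι ι ℂ) = u at hu
    constructor
    · rintro ⟨⟨x', y⟩, ⟨hx', hy⟩, hxy⟩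
      refine ⟨y, hy, ?_⟩
      rw [← Matrix.mul_assoc] at hxy
      have hee := hexp x' hx' x hx (σ y) u (hσu y) hu hxy
      simp only [hee] at hxy
      have h1 : NormedSpace.exp (-e x) * NormedSpace.exp (e x) = 1 := by
        rw [← Matrix.exp_add_of_commute (-e x) (e x) ((Commute.refl (e x)).neg_left),
          neg_add_cancel, NormedSpace.exp_zero]
      have h2 := congrArg (fun M => NormedSpace.exp (-e x) * M) hxy
      simp only [← Matrix.mul_assoc, h1, Matrix.one_mul] at h2
      exact h2.symm
    · rintro ⟨y, hy, hxy⟩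
      refine ⟨(x, y), ⟨hx, hy⟩, ?_⟩
      rw [hxy, Matrix.mul_assoc]
  · rintro M hM k ⟨⟨x, y⟩, ⟨hx, hy⟩, hxy⟩
    obtain ⟨k', hk', hky⟩ := hσK y
    refine hM ⟨x, hx, k' * (k : GL ι ℂ)⁻¹, K.mul_mem hk' (K.inv_mem k.2), ?_⟩
    have h1 : ((k : GL ι ℂ) : Matrix ι ι ℂ) * (((k : GL ι ℂ)⁻¹ : GL ι ℂ) : Matrix ι ι ℂ) = 1 :=
      (k : GL ι ℂ).mul_inv
    have h2 : NormedSpace.exp (e x) * P * σ y = M * ((k : GL ι ℂ) : Matrix ι ι ℂ) := hxy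
    calc M = M * ((k : GL ι ℂ) : Matrix ι ι ℂ) *
          (((k : GL ι ℂ)⁻¹ : GL ι ℂ) : Matrix ι ι ℂ) := by
          rw [Matrix.mul_assoc, h1, Matrix.mul_one]
      _ = _ := by rw [← h2, ← hky, Units.val_mul]; simp only [Matrix.mul_assoc]

/-- Volumes of tubes around the orbit `P * K`, for the image of a Haar measure under `Λ`, against
volumes of subsets of `K`. -/
theorem tendsto_tube_mul_coset (B : MatrixBimodule κ ι) {K : Subgroup (GL ι ℂ)}
    [LocallyCompactSpace K] (hK : IsUnitaryGroupOf K B.N) {P : Matrix κ ι ℂ} (hPX : P ∈ B.X)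
    (hP : P * Pᴴ = 1) {e : E →ₗ[ℝ] Matrix κ κ ℂ} (he : ∀ x, e x ∈ B.A ∧ (e x)ᴴ = e x)
    {σ : F → Matrix ι ι ℂ} (hσc : Continuous σ)
    (hσK : ∀ y, ∃ k ∈ K, ((k : GL ι ℂ) : Matrix ι ι ℂ) = σ y)
    {Λ : E × F →ₗ[ℝ] Matrix κ ι ℂ}
    (hψ : HasStrictFDerivAt (fun z : E × F => NormedSpace.exp (e z.1) * P * σ z.2)
      (LinearMap.toContinuousLinearMap Λ) 0)
    (hΛi : Function.Injective Λ) (hΛr : LinearMap.range Λ = B.X)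
    (μ : Measure E) [μ.IsAddHaarMeasure] (μ' : Measure F) [μ'.IsAddHaarMeasure]
    (η : Measure K) [η.IsMulLeftInvariant] [SFinite η] (hη : η Set.univ ≠ ⊤)
    {β : Type*} {l : Filter β} {T : β → Set F} (hT : Tendsto T l (𝓝 0).smallSets)
    (hTo : ∀ᶠ j in l, IsOpen (T j) ∧ (T j).Nonempty) :
    Tendsto (fun z : ℝ × β => ((μ.prod μ').map Λ (tube e P K z.1) / μ (Metric.ball 0 z.1)) *
      (η {k : K | ∃ y ∈ T z.2, P * ((k : GL ι ℂ) : Matrix ι ι ℂ) = P * σ y} / μ' (T z.2)))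
      (𝓝[>] 0 ×ˢ l) (𝓝 (η Set.univ)) := by
  have hKu : ∀ k ∈ K, ((k : GL ι ℂ) : Matrix ι ι ℂ) * ((k : GL ι ℂ) : Matrix ι ι ℂ)ᴴ = 1 :=
    fun k hk => ((hK k).1 hk).2
  have hKN : ∀ k ∈ K, ((k : GL ι ℂ) : Matrix ι ι ℂ) ∈ B.N := fun k hk => ((hK k).1 hk).1
  have hψc : Continuous fun z : E × F => NormedSpace.exp (e z.1) * P * σ z.2 :=
    (((continuous_exp_comp e).comp continuous_fst).matrix_mul continuous_const).matrix_mul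
      (hσc.comp continuous_snd)
  have hψr : ∀ z : E × F, NormedSpace.exp (e z.1) * P * σ z.2 ∈ LinearMap.range Λ := fun z => by
    obtain ⟨k, hk, hky⟩ := hσK z.2
    rw [hΛr, ← hky]
    exact B.mul_mem_right (B.mul_mem_left (B.A.exp_mem_matrix (he _).1) hPX) (hKN k hk)
  set ν : Measure (E × F) := μ.prod μ' with hν
  obtain ⟨ρ, hρ, hexp⟩ := exists_exp_eq_of_exp_mul_eq (E := E) (fun x => (he x).2) hP
  have hpres := measure_preimage_mul_right ν hΛi hKu fun z k hk => by
    rw [hΛr]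
    exact B.mul_mem_right (hΛr ▸ LinearMap.mem_range_self Λ z) (hKN k hk)
  have horbit : ∀ r ≤ ρ, ∀ S : Set F, IsOpen S →
      ν.map Λ ((fun z : E × F => NormedSpace.exp (e z.1) * P * σ z.2) ''
        (Metric.ball 0 r ×ˢ S)) * η Set.univ =
        η {k : K | ∃ y ∈ S, P * ((k : GL ι ℂ) : Matrix ι ι ℂ) = P * σ y} *
          ν.map Λ (tube e P K r) := fun r hr S hS =>
    measure_tube_mul_coset hσc hσK hKu hpres (fun x hx y hy k k' hk hk' h =>
      hexp x (Metric.ball_subset_ball hr hx) y (Metric.ball_subset_ball hr hy) k k' hk hk' h) hS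
  have hsmall : ∀ δ > 0, ∀ᶠ z : ℝ × β in 𝓝[>] 0 ×ˢ l,
      (0 < z.1 ∧ z.1 < δ) ∧ T z.2 ⊆ Metric.ball 0 δ ∧ IsOpen (T z.2) ∧ (T z.2).Nonempty :=
    fun δ hδ => by
      have h1 : ∀ᶠ r : ℝ in 𝓝[>] 0, 0 < r ∧ r < δ := Ioo_mem_nhdsGT hδ
      have h2 : ∀ᶠ j in l, T j ⊆ Metric.ball 0 δ :=
        hT.eventually (eventually_smallSets_subset.2 (Metric.ball_mem_nhds 0 hδ))
      exact h1.prod_mk (h2.and hTo)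
  have hfin : ∀ᶠ z : ℝ × β in 𝓝[>] 0 ×ˢ l, (μ (Metric.ball 0 z.1) ≠ 0 ∧
      μ (Metric.ball 0 z.1) ≠ ⊤) ∧ μ' (T z.2) ≠ 0 ∧ μ' (T z.2) ≠ ⊤ := by
    filter_upwards [hsmall 1 one_pos] with z hz
    exact ⟨⟨(Metric.measure_ball_pos μ 0 hz.1.1).ne', measure_ball_lt_top.ne⟩,
      (hz.2.2.1.measure_pos μ' hz.2.2.2).ne',
      ((measure_mono hz.2.1).trans_lt measure_ball_lt_top).ne⟩
  -- To first order the chart is the linear map `Λ`, so the image of a small box has asymptotically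
  -- the volume of the box. The orbit identity then replaces the box image by tube and coset set.
  have hratio : Tendsto (fun z : ℝ × β =>
      ν.map Λ ((fun z : E × F => NormedSpace.exp (e z.1) * P * σ z.2) ''
        (Metric.ball 0 z.1 ×ˢ T z.2)) /
      (μ (Metric.ball 0 z.1) * μ' (T z.2))) (𝓝[>] 0 ×ˢ l) (𝓝 1) := by
    refine ENNReal.tendsto_div_one_of_forall ?_ fun m hm => ?_
    · filter_upwards [hfin] with z hz
      exact ⟨mul_ne_zero hz.1.1 hz.2.1, ENNReal.mul_ne_top hz.1.2 hz.2.2⟩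
    · obtain ⟨δ, hδ, h⟩ := hψ.exists_ball_map_measure_image ν hΛi hψr hψc hm
      filter_upwards [hsmall δ hδ] with z hz
      rw [← Measure.prod_prod]
      refine h _ ?_ (Metric.isOpen_ball.prod hz.2.2.1)
      rw [← Prod.mk_zero_zero, ← ball_prod_same]
      exact Set.prod_mono (Metric.ball_subset_ball hz.1.2.le) hz.2.1
  have h1 := ENNReal.Tendsto.mul_const (b := η Set.univ) hratio (Or.inr hη)
  rw [one_mul] at h1
  refine h1.congr' ?_
  filter_upwards [hsmall ρ hρ, hfin] with z hz hz2
  rw [div_eq_mul_inv, mul_right_comm, horbit z.1 hz.1.2.le _ hz.2.2.1,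
    ENNReal.mul_inv (Or.inl hz2.1.1) (Or.inl hz2.1.2), div_eq_mul_inv, div_eq_mul_inv]
  ring

end TubeVolume

/-! ### The tangent space of the orbit and its norm -/

section Tangent

attribute [local instance] Matrix.frobeniusNormedAddCommGroup Matrix.frobeniusNormedSpace
  Matrix.frobeniusNormedRing Matrix.frobeniusNormedAlgebra Matrix.borelSpace_frobenius

variable {ι κ : Type} [Fintype ι] [DecidableEq ι] [Fintype κ] [DecidableEq κ]

theorem HasStrictFDerivAt.exp_linear {F 𝔸 : Type*} [NormedAddCommGroup F]
    [NormedSpace ℝ F] [FiniteDimensional ℝ F] [NormedRing 𝔸] [NormedAlgebra ℝ 𝔸] [CompleteSpace 𝔸]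
    (q : F →ₗ[ℝ] 𝔸) :
    HasStrictFDerivAt (fun y => NormedSpace.exp (q y)) (LinearMap.toContinuousLinearMap q) 0 := by
  have h1 : HasStrictFDerivAt (NormedSpace.exp : 𝔸 → 𝔸) (1 : 𝔸 →L[ℝ] 𝔸)
      (LinearMap.toContinuousLinearMap q 0) := by
    rw [map_zero]
    exact hasStrictFDerivAt_exp_zero
  exact h1.comp (0 : F) (LinearMap.toContinuousLinearMap q).hasStrictFDerivAt

theorem HasStrictFDerivAt.exp_mul_exp_linear {E F 𝔸 : Type*} [NormedAddCommGroup E]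
    [NormedSpace ℝ E] [FiniteDimensional ℝ E] [NormedAddCommGroup F]
    [NormedSpace ℝ F] [FiniteDimensional ℝ F] [NormedRing 𝔸] [NormedAlgebra ℝ 𝔸] [CompleteSpace 𝔸]
    (e : E →ₗ[ℝ] 𝔸) (q : F →ₗ[ℝ] 𝔸) :
    HasStrictFDerivAt (fun z : E × F => NormedSpace.exp (e z.1) * NormedSpace.exp (q z.2))
      (LinearMap.toContinuousLinearMap (e.coprod q)) 0 := by
  refine HasStrictFDerivAt.exp_bilinear (f := fun z : 𝔸 × 𝔸 => z.1 * z.2)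
    (isBoundedBilinearMap_mul (𝕜 := ℝ) (A := 𝔸)) e (HasStrictFDerivAt.exp_linear q) fun z => ?_
  simp

theorem HasStrictFDerivAt.exists_ball_injOn_of_injective {D W : Type*} [NormedAddCommGroup D]
    [NormedSpace ℝ D] [FiniteDimensional ℝ D] [NormedAddCommGroup W] [NormedSpace ℝ W]
    [FiniteDimensional ℝ W] {Λ : D →ₗ[ℝ] W} (hΛi : Function.Injective Λ) {ψ : D → W}
    (hψ : HasStrictFDerivAt ψ (LinearMap.toContinuousLinearMap Λ) 0) :
    ∃ δ > 0, Set.InjOn ψ (Metric.ball 0 δ) := by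
  obtain ⟨Γ, hΓ⟩ := Λ.exists_leftInverse_of_injective (LinearMap.ker_eq_bot.2 hΛi)
  have hφ : HasStrictFDerivAt (fun z => Γ (ψ z)) (ContinuousLinearMap.id ℝ D) 0 :=
    ((LinearMap.toContinuousLinearMap Γ).hasStrictFDerivAt.comp (0 : D) hψ).congr_fderiv
      (ContinuousLinearMap.ext fun z => LinearMap.congr_fun hΓ z)
  obtain ⟨δ, hδ, h⟩ := hφ.exists_ball_injOn
  exact ⟨δ, hδ, fun x hx y hy hxy => h hx hy (congrArg Γ hxy)⟩

/-- The linear map `(x, y) ↦ e x * P + P * q y`. -/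
noncomputable def orbitTangent {E F : Type*} [AddCommGroup E] [Module ℝ E] [AddCommGroup F] [Module ℝ F]
    (e : E →ₗ[ℝ] Matrix κ κ ℂ) (P : Matrix κ ι ℂ) (q : F →ₗ[ℝ] Matrix ι ι ℂ) :
    E × F →ₗ[ℝ] Matrix κ ι ℂ where
  toFun := fun z => e z.1 * P + P * q z.2
  map_add' := fun z w => by
    simp only [Prod.fst_add, Prod.snd_add, map_add, Matrix.add_mul, Matrix.mul_add]
    abel
  map_smul' := fun c z => by
    simp only [Prod.smul_fst, Prod.smul_snd, map_smul, Matrix.smul_mul, Matrix.mul_smul,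
      smul_add, RingHom.id_apply]

theorem hasStrictFDerivAt_exp_mul_mul {E F : Type*} [NormedAddCommGroup E] [NormedSpace ℝ E]
    [FiniteDimensional ℝ E] [NormedAddCommGroup F] [NormedSpace ℝ F] [FiniteDimensional ℝ F]
    (e : E →ₗ[ℝ] Matrix κ κ ℂ) (P : Matrix κ ι ℂ) {σ : F → Matrix ι ι ℂ}
    {q : F →ₗ[ℝ] Matrix ι ι ℂ}
    (hσ : HasStrictFDerivAt σ (LinearMap.toContinuousLinearMap q) 0) (hσ₀ : σ 0 = 1) :
    HasStrictFDerivAt (fun z : E × F => NormedSpace.exp (e z.1) * P * σ z.2)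
      (LinearMap.toContinuousLinearMap (orbitTangent e P q)) 0 :=
  HasStrictFDerivAt.exp_bilinear (isBoundedBilinearMap_mul_mul P) e hσ fun z => by
    change e z.1 * P + P * q z.2 = e z.1 * P * σ 0 + (1 : Matrix κ κ ℂ) * P * q z.2
    rw [hσ₀, Matrix.mul_one, Matrix.one_mul]

theorem frobenius_norm_sq_add {M M' : Matrix κ ι ℂ} (h : (trace (M * M'ᴴ)).re = 0) :
    ‖M + M'‖ ^ 2 = ‖M‖ ^ 2 + ‖M'‖ ^ 2 := by
  have h2 : (trace (M' * Mᴴ)).re = 0 := by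
    have : M' * Mᴴ = (M * M'ᴴ)ᴴ := by rw [conjTranspose_mul, conjTranspose_conjTranspose]
    rw [this, trace_conjTranspose]
    simpa using h
  simp only [← re_trace_mul_conjTranspose, conjTranspose_add, Matrix.add_mul, Matrix.mul_add,
    trace_add, Complex.add_re, h, h2]
  ring

/-- The trace equals minus its own conjugate, hence is purely imaginary. -/
theorem re_trace_herm_mul_skew {H S : Matrix ι ι ℂ} (hH : Hᴴ = H) (hS : Sᴴ = -S) :
    (trace (H * Sᴴ)).re = 0 := by
  have h1 : (H * Sᴴ)ᴴ = S * H := by rw [conjTranspose_mul, conjTranspose_conjTranspose, hH]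
  have h2 : star (trace (H * Sᴴ)) = -trace (H * Sᴴ) := by
    rw [← trace_conjTranspose, h1, hS, Matrix.mul_neg, trace_neg, neg_neg, trace_mul_comm]
  have h3 := congrArg Complex.re h2
  simp only [Complex.star_def, Complex.conj_re, Complex.neg_re] at h3
  linarith

/-- Hermitian elements. -/
def hermSubmodule (A : StarSubalgebra ℝ (Matrix κ κ ℂ)) : Submodule ℝ (Matrix κ κ ℂ) where
  carrier := {B | B ∈ A ∧ Bᴴ = B}
  zero_mem' := ⟨A.zero_mem, conjTranspose_zero⟩
  add_mem' := fun ha hb => ⟨A.add_mem ha.1 hb.1, by rw [conjTranspose_add, ha.2, hb.2]⟩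
  smul_mem' := fun c _ ha => ⟨A.smul_mem ha.1 c, by
    rw [conjTranspose_smul, ha.2, star_trivial]⟩

/-- Skew-Hermitian elements. -/
def skewSubmodule (A : StarSubalgebra ℝ (Matrix κ κ ℂ)) : Submodule ℝ (Matrix κ κ ℂ) where
  carrier := {B | B ∈ A ∧ Bᴴ = -B}
  zero_mem' := ⟨A.zero_mem, by simp⟩
  add_mem' := fun ha hb => ⟨A.add_mem ha.1 hb.1, by
    rw [conjTranspose_add, ha.2, hb.2, neg_add]⟩
  smul_mem' := fun c _ ha => ⟨A.smul_mem ha.1 c, by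
    rw [conjTranspose_smul, ha.2, star_trivial, smul_neg]⟩

/-- Skew-Hermitian elements killed by `P`. -/
def stabSubmodule (N : StarSubalgebra ℝ (Matrix ι ι ℂ)) (P : Matrix κ ι ℂ) :
    Submodule ℝ (Matrix ι ι ℂ) where
  carrier := {B | (B ∈ N ∧ Bᴴ = -B) ∧ P * B = 0}
  zero_mem' := ⟨(skewSubmodule N).zero_mem, Matrix.mul_zero P⟩
  add_mem' := fun ha hb => ⟨(skewSubmodule N).add_mem ha.1 hb.1, by
    rw [Matrix.mul_add, ha.2, hb.2, add_zero]⟩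
  smul_mem' := fun c _ ha => ⟨(skewSubmodule N).smul_mem c ha.1, by
    rw [Matrix.mul_smul, ha.2, smul_zero]⟩

/-- Skew-Hermitian elements supported on the corner of the projection `F`. -/
def cornerSubmodule (N : StarSubalgebra ℝ (Matrix ι ι ℂ)) (F : Matrix ι ι ℂ) :
    Submodule ℝ (Matrix ι ι ℂ) where
  carrier := {B | (B ∈ N ∧ Bᴴ = -B) ∧ F * B * F = B}
  zero_mem' := ⟨(skewSubmodule N).zero_mem, by simp⟩
  add_mem' := fun ha hb => ⟨(skewSubmodule N).add_mem ha.1 hb.1, by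
    rw [Matrix.mul_add, Matrix.add_mul, ha.2, hb.2]⟩
  smul_mem' := fun c _ ha => ⟨(skewSubmodule N).smul_mem c ha.1, by
    rw [Matrix.mul_smul, Matrix.smul_mul, ha.2]⟩

/-- Skew-Hermitian elements which are off-diagonal with respect to the projection `F`. -/
def offDiagSubmodule (N : StarSubalgebra ℝ (Matrix ι ι ℂ)) (F : Matrix ι ι ℂ) :
    Submodule ℝ (Matrix ι ι ℂ) where
  carrier := {B | (B ∈ N ∧ Bᴴ = -B) ∧ F * B + B * F = B}
  zero_mem' := ⟨(skewSubmodule N).zero_mem, by simp⟩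
  add_mem' := fun {a b} ha hb => ⟨(skewSubmodule N).add_mem ha.1 hb.1, by
    conv_rhs => rw [← ha.2, ← hb.2]
    rw [Matrix.mul_add, Matrix.add_mul]
    abel⟩
  smul_mem' := fun c _ ha => ⟨(skewSubmodule N).smul_mem c ha.1, by
    rw [Matrix.mul_smul, Matrix.smul_mul, ← smul_add, ha.2]⟩

/-- `e` is, up to the factor `c`, an isometric parametrization of `p`. -/
structure IsFrame (c : ℕ) {d : ℕ} (e : EuclideanSpace ℝ (Fin d) →ₗ[ℝ] Matrix ι ι ℂ)
    (p : Submodule ℝ (Matrix ι ι ℂ)) : Prop where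
  range_eq : LinearMap.range e = p
  norm_sq : ∀ x, ‖e x‖ ^ 2 = c * ‖x‖ ^ 2

theorem IsFrame.mem {c d : ℕ} {e : EuclideanSpace ℝ (Fin d) →ₗ[ℝ] Matrix ι ι ℂ}
    {p : Submodule ℝ (Matrix ι ι ℂ)} (h : IsFrame c e p) (x : EuclideanSpace ℝ (Fin d)) :
    e x ∈ p := h.range_eq ▸ LinearMap.mem_range_self e x

theorem IsFrame.exists_eq {c d : ℕ} {e : EuclideanSpace ℝ (Fin d) →ₗ[ℝ] Matrix ι ι ℂ}
    {p : Submodule ℝ (Matrix ι ι ℂ)} (h : IsFrame c e p) {A : Matrix ι ι ℂ} (hA : A ∈ p) :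
    ∃ x, e x = A := by
  rw [← h.range_eq] at hA
  exact hA

section Projection

variable {P : Matrix κ ι ℂ}

theorem frobenius_norm_mul_coisometry (hP : P * Pᴴ = 1) {κ' : Type} [Fintype κ'] [DecidableEq κ']
    (M : Matrix κ' κ ℂ) : ‖M * P‖ = ‖M‖ := by
  have h : ‖M * P‖ ^ 2 = ‖M‖ ^ 2 := by
    rw [← re_trace_mul_conjTranspose, ← re_trace_mul_conjTranspose, conjTranspose_mul,
      Matrix.mul_assoc, ← Matrix.mul_assoc P, hP, Matrix.one_mul]
  exact (pow_left_inj₀ (norm_nonneg _) (norm_nonneg _) two_ne_zero).1 h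

theorem frobenius_norm_conjTranspose_mul_coisometry (hP : P * Pᴴ = 1) {κ' : Type} [Fintype κ'] [DecidableEq κ']
    (M : Matrix κ κ' ℂ) : ‖Pᴴ * M‖ = ‖M‖ := by
  rw [← frobenius_norm_conjTranspose, conjTranspose_mul, conjTranspose_conjTranspose,
    frobenius_norm_mul_coisometry hP, frobenius_norm_conjTranspose]

theorem proj_mul_proj (hP : P * Pᴴ = 1) : Pᴴ * P * (Pᴴ * P) = Pᴴ * P := by
  rw [Matrix.mul_assoc, ← Matrix.mul_assoc P, hP, Matrix.one_mul]

theorem mul_proj (hP : P * Pᴴ = 1) : P * (Pᴴ * P) = P := by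
  rw [← Matrix.mul_assoc, hP, Matrix.one_mul]

theorem proj_mul_conjTranspose (hP : P * Pᴴ = 1) : Pᴴ * P * Pᴴ = Pᴴ := by
  rw [Matrix.mul_assoc, hP, Matrix.mul_one]

theorem corner_norm (hP : P * Pᴴ = 1) {a : Matrix ι ι ℂ} (ha : Pᴴ * P * a * (Pᴴ * P) = a) :
    ‖P * a * Pᴴ‖ = ‖a‖ := by
  conv_rhs => rw [← ha]
  have : Pᴴ * P * a * (Pᴴ * P) = Pᴴ * (P * a * Pᴴ * P) := by simp only [Matrix.mul_assoc]
  rw [this, frobenius_norm_conjTranspose_mul_coisometry hP, frobenius_norm_mul_coisometry hP]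

theorem corner_mul (hP : P * Pᴴ = 1) {a : Matrix ι ι ℂ} (ha : Pᴴ * P * a * (Pᴴ * P) = a) :
    P * a = P * a * Pᴴ * P := by
  conv_lhs => rw [← ha]
  simp only [← Matrix.mul_assoc, hP, Matrix.one_mul]

/-- Sandwiching `hb` between `P` and `Pᴴ` gives `x + x = x` for the corner `x` of `b`. -/
theorem offDiag_mul_proj (hP : P * Pᴴ = 1) {b : Matrix ι ι ℂ} (hb : Pᴴ * P * b + b * (Pᴴ * P) = b) :
    P * b * Pᴴ = 0 := by
  have h1 := congrArg (fun M => P * M * Pᴴ) hb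
  have h2 : P * (Pᴴ * P * b + b * (Pᴴ * P)) * Pᴴ = P * b * Pᴴ + P * b * Pᴴ := by
    rw [Matrix.mul_add, Matrix.add_mul, ← Matrix.mul_assoc, mul_proj hP, ← Matrix.mul_assoc,
      Matrix.mul_assoc (P * b), proj_mul_conjTranspose hP]
  simp only [h2] at h1
  exact add_eq_left.1 h1

/-- With `F = Pᴴ P`, the summands `F b` and `b F` of `b` are orthogonal and are minus adjoints of
each other. They have the same norm `‖P b‖`, while `P` sees only the first one. -/
theorem offDiag_norm (hP : P * Pᴴ = 1) {b : Matrix ι ι ℂ} (hs : bᴴ = -b)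
    (hb : Pᴴ * P * b + b * (Pᴴ * P) = b) : ‖b‖ ^ 2 = 2 * ‖P * b‖ ^ 2 := by
  have h1 : b * (Pᴴ * P) = -(Pᴴ * P * b)ᴴ := by
    rw [conjTranspose_mul, hs, conjTranspose_mul, conjTranspose_conjTranspose, Matrix.neg_mul,
      neg_neg]
  have h2 : ‖Pᴴ * P * b‖ = ‖P * b‖ := by
    rw [Matrix.mul_assoc, frobenius_norm_conjTranspose_mul_coisometry hP]
  have h0 := offDiag_mul_proj hP hb
  have h3 : (trace (Pᴴ * P * b * (b * (Pᴴ * P))ᴴ)).re = 0 := by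
    have : Pᴴ * P * b * (b * (Pᴴ * P))ᴴ = Pᴴ * (P * b * Pᴴ) * P * bᴴ := by
      simp only [conjTranspose_mul, conjTranspose_conjTranspose, Matrix.mul_assoc]
    rw [this, h0]
    simp
  conv_lhs => rw [← hb]
  rw [frobenius_norm_sq_add h3, h1, norm_neg, frobenius_norm_conjTranspose, h2]
  ring

/-- The source of the powers of two in the Jacobian. The part `(B + P a Pᴴ) P` lives on `U_p` and is
a Hermitian plus a skew-Hermitian matrix, so its norms add with weight one; `P b` is orthogonal to
it and retains half of `‖b‖²`. -/
theorem norm_sq_tangent (hP : P * Pᴴ = 1) {a b : Matrix ι ι ℂ} {B : Matrix κ κ ℂ} (hB : Bᴴ = B)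
    (has : aᴴ = -a) (ha : Pᴴ * P * a * (Pᴴ * P) = a) (hbs : bᴴ = -b)
    (hb : Pᴴ * P * b + b * (Pᴴ * P) = b) :
    ‖B * P + P * (a + b)‖ ^ 2 = ‖B‖ ^ 2 + ‖a‖ ^ 2 + ‖b‖ ^ 2 / 2 := by
  have h1 : B * P + P * (a + b) = (B + P * a * Pᴴ) * P + P * b := by
    rw [Matrix.mul_add, Matrix.add_mul, ← corner_mul hP ha, add_assoc]
  have h2 : (trace ((B + P * a * Pᴴ) * P * (P * b)ᴴ)).re = 0 := by
    have h3 : P * (P * b)ᴴ = (P * b * Pᴴ)ᴴ := by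
      simp only [conjTranspose_mul, conjTranspose_conjTranspose, Matrix.mul_assoc]
    rw [Matrix.mul_assoc, h3, offDiag_mul_proj hP hb]
    simp
  have h4 : (P * a * Pᴴ)ᴴ = -(P * a * Pᴴ) := by
    simp only [conjTranspose_mul, conjTranspose_conjTranspose, has, Matrix.mul_assoc,
      Matrix.neg_mul, Matrix.mul_neg]
  rw [h1, frobenius_norm_sq_add h2, frobenius_norm_mul_coisometry hP,
    frobenius_norm_sq_add (re_trace_herm_mul_skew hB h4), corner_norm hP ha,
    offDiag_norm hP hbs hb]
  ring

/-- The three blocks are mutually orthogonal, so inside the Lie algebra of `K_n` each has full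
weight. The contrast with the halved weight in `norm_sq_tangent` produces the Jacobian constant. -/
theorem norm_sq_skew (hP : P * Pᴴ = 1) {A a b : Matrix ι ι ℂ} (hA : P * A = 0) (hAs : Aᴴ = -A)
    (has : aᴴ = -a) (ha : Pᴴ * P * a * (Pᴴ * P) = a) (hbs : bᴴ = -b)
    (hb : Pᴴ * P * b + b * (Pᴴ * P) = b) :
    ‖A + (a + b)‖ ^ 2 = ‖A‖ ^ 2 + ‖a‖ ^ 2 + ‖b‖ ^ 2 := by
  have hA2 : A * Pᴴ = 0 := by
    have := congrArg conjTranspose hA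
    rw [conjTranspose_mul, hAs, conjTranspose_zero, Matrix.neg_mul, neg_eq_zero] at this
    exact this
  have h0 := offDiag_mul_proj hP hb
  have ha' : a = Pᴴ * (P * a * Pᴴ * P) := by
    conv_lhs => rw [← ha]
    simp only [Matrix.mul_assoc]
  have h1 : trace (a * b) = 0 := by
    rw [ha', Matrix.mul_assoc, trace_mul_comm]
    have : P * a * Pᴴ * P * b * Pᴴ = P * a * Pᴴ * (P * b * Pᴴ) := by simp only [Matrix.mul_assoc]
    rw [this, h0, Matrix.mul_zero, trace_zero]
  have h2 : trace (A * a) = 0 := by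
    rw [ha', ← Matrix.mul_assoc, hA2, Matrix.zero_mul, trace_zero]
  have h3 : trace (A * b) = 0 := by
    rw [← hb, Matrix.mul_add, ← Matrix.mul_assoc, ← Matrix.mul_assoc, hA2, Matrix.zero_mul,
      Matrix.zero_mul, zero_add, trace_mul_comm, Matrix.mul_assoc, Matrix.mul_assoc, hA,
      Matrix.mul_zero, Matrix.mul_zero, trace_zero]
  have h4 : (trace (A * (a + b)ᴴ)).re = 0 := by
    rw [conjTranspose_add, has, hbs, Matrix.mul_add, Matrix.mul_neg, Matrix.mul_neg, trace_add,
      trace_neg, trace_neg, h2, h3]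
    simp
  have h5 : (trace (a * bᴴ)).re = 0 := by
    rw [hbs, Matrix.mul_neg, trace_neg, h1]
    simp
  rw [frobenius_norm_sq_add h4, frobenius_norm_sq_add h5, add_assoc]

end Projection

end Tangent

/-! ### Gaussian integrals and block decompositions of `X` and of the skew part of `N` -/

section Densities

attribute [local instance] Matrix.frobeniusNormedAddCommGroup Matrix.frobeniusNormedSpace
  Matrix.frobeniusNormedRing Matrix.frobeniusNormedAlgebra Matrix.borelSpace_frobenius

variable {ι κ : Type} [Fintype ι] [DecidableEq ι] [Fintype κ] [DecidableEq κ]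

theorem lintegral_gaussian {d : ℕ} {b : ℝ} (hb : 0 < b) :
    ∫⁻ x : EuclideanSpace ℝ (Fin d), ENNReal.ofReal (Real.exp (-b * ‖x‖ ^ 2)) =
      ENNReal.ofReal ((Real.pi / b) ^ ((d : ℝ) / 2)) := by
  have h1 := GaussianFourier.integral_rexp_neg_mul_sq_norm (V := EuclideanSpace ℝ (Fin d)) hb
  rw [finrank_euclideanSpace_fin] at h1
  have h2 : Integrable fun x : EuclideanSpace ℝ (Fin d) => Real.exp (-b * ‖x‖ ^ 2) := by
    -- A nonintegrable function has Bochner integral `0` by convention, whereas the known value is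
    -- positive.
    by_contra h
    rw [integral_undef h] at h1
    have : 0 < (Real.pi / b) ^ ((d : ℝ) / 2) := by positivity
    exact this.ne h1
  rw [← h1, ofReal_integral_eq_lintegral_ofReal h2
    (Eventually.of_forall fun x => (Real.exp_pos _).le)]

/-- With the coefficient `π` the integral is one in every dimension, so comparing linear charts by
this Gaussian requires no knowledge of the dimensions of the undistorted blocks. -/
theorem lintegral_gaussian_pi {d : ℕ} :
    ∫⁻ x : EuclideanSpace ℝ (Fin d), ENNReal.ofReal (Real.exp (-Real.pi * ‖x‖ ^ 2)) = 1 := by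
  rw [lintegral_gaussian Real.pi_pos, div_self Real.pi_ne_zero, Real.one_rpow,
    ENNReal.ofReal_one]

theorem lintegral_exp_add {E F : Type*} [MeasureSpace E] [MeasureSpace F]
    [SFinite (volume : Measure F)] {f : E → ℝ} {g : F → ℝ} (hf : Measurable f)
    (hg : Measurable g) :
    ∫⁻ z : E × F, ENNReal.ofReal (Real.exp (f z.1 + g z.2)) =
      (∫⁻ x, ENNReal.ofReal (Real.exp (f x))) * ∫⁻ y, ENNReal.ofReal (Real.exp (g y)) := by
  have h : ∀ z : E × F, ENNReal.ofReal (Real.exp (f z.1 + g z.2)) =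
      ENNReal.ofReal (Real.exp (f z.1)) * ENNReal.ofReal (Real.exp (g z.2)) := fun z => by
    rw [Real.exp_add, ENNReal.ofReal_mul (Real.exp_pos _).le]
  simp only [h]
  exact lintegral_prod_mul (Real.measurable_exp.comp hf).ennreal_ofReal.aemeasurable
    (Real.measurable_exp.comp hg).ennreal_ofReal.aemeasurable

/-- The bimodule of a single `*`-algebra over itself. -/
noncomputable def MatrixBimodule.self (N : StarSubalgebra ℝ (Matrix ι ι ℂ)) : MatrixBimodule ι ι where
  A := N
  X := Subalgebra.toSubmodule N.toSubalgebra
  N := N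
  mul_mem_left := fun ha hx => N.mul_mem ha hx
  mul_mem_right := fun hx hb => N.mul_mem hx hb
  mul_conjTranspose_mem := fun hx hy => N.mul_mem hx (star_mem (S := StarSubalgebra ℝ _) hy)
  conjTranspose_mul_mem := fun hx hy => N.mul_mem (star_mem (S := StarSubalgebra ℝ _) hx) hy

theorem exists_herm_add_skew {A : StarSubalgebra ℝ (Matrix κ κ ℂ)} {M : Matrix κ κ ℂ}
    (hM : M ∈ A) : ∃ H ∈ hermSubmodule A, ∃ S ∈ skewSubmodule A, M = H + S := by
  have hM' : Mᴴ ∈ A := star_mem (S := StarSubalgebra ℝ _) hM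
  refine ⟨(2 : ℝ)⁻¹ • (M + Mᴴ), ⟨A.smul_mem (A.add_mem hM hM') _, ?_⟩,
    (2 : ℝ)⁻¹ • (M - Mᴴ), ⟨A.smul_mem (A.sub_mem hM hM') _, ?_⟩, ?_⟩
  · rw [conjTranspose_smul, conjTranspose_add, conjTranspose_conjTranspose, star_trivial,
      add_comm]
  · rw [conjTranspose_smul, conjTranspose_sub, conjTranspose_conjTranspose, star_trivial,
      ← smul_neg, neg_sub]
  · rw [← smul_add, add_add_sub_cancel, ← two_smul ℝ M, smul_smul]
    norm_num

variable {B : MatrixBimodule κ ι} {P : Matrix κ ι ℂ}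

theorem MatrixBimodule.proj_mem (hPX : P ∈ B.X) : Pᴴ * P ∈ B.N := B.conjTranspose_mul_mem hPX hPX

/-- Block decomposition with respect to the projection `F = Pᴴ P`; the blocks stay in `N` because
`F` does. The block of `1 - F` is the Lie algebra of the stabilizer. -/
theorem exists_stab_add_corner_add_offDiag (hPX : P ∈ B.X) (hP : P * Pᴴ = 1)
    {S : Matrix ι ι ℂ} (hS : S ∈ skewSubmodule B.N) :
    ∃ A ∈ stabSubmodule B.N P, ∃ a ∈ cornerSubmodule B.N (Pᴴ * P),
      ∃ b ∈ offDiagSubmodule B.N (Pᴴ * P), S = A + (a + b) := by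
  have hF := B.proj_mem hPX
  have hFF := proj_mul_proj hP
  have hPF := mul_proj hP
  have hFs : (Pᴴ * P)ᴴ = Pᴴ * P := by rw [conjTranspose_mul, conjTranspose_conjTranspose]
  generalize Pᴴ * P = F at hF hFF hPF hFs ⊢
  obtain ⟨hSN, hSs⟩ := hS
  have hG : 1 - F ∈ B.N := B.N.sub_mem B.N.one_mem hF
  have hGs : (1 - F)ᴴ = 1 - F := by rw [conjTranspose_sub, conjTranspose_one, hFs]
  have hGF : (1 - F) * F = 0 := by rw [Matrix.sub_mul, Matrix.one_mul, hFF, sub_self]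
  have hFG : F * (1 - F) = 0 := by rw [Matrix.mul_sub, Matrix.mul_one, hFF, sub_self]
  refine ⟨(1 - F) * S * (1 - F), ⟨⟨B.N.mul_mem (B.N.mul_mem hG hSN) hG, ?_⟩, ?_⟩,
    F * S * F, ⟨⟨B.N.mul_mem (B.N.mul_mem hF hSN) hF, ?_⟩, ?_⟩,
    (1 - F) * S * F + F * S * (1 - F), ⟨⟨B.N.add_mem (B.N.mul_mem (B.N.mul_mem hG hSN) hF)
      (B.N.mul_mem (B.N.mul_mem hF hSN) hG), ?_⟩, ?_⟩, ?_⟩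
  · simp only [conjTranspose_mul, hGs, hSs, Matrix.mul_neg, Matrix.neg_mul, Matrix.mul_assoc]
  · have hPG : P * (1 - F) = 0 := by rw [Matrix.mul_sub, Matrix.mul_one, hPF, sub_self]
    rw [← Matrix.mul_assoc, ← Matrix.mul_assoc, hPG, Matrix.zero_mul, Matrix.zero_mul]
  · simp only [conjTranspose_mul, hFs, hSs, Matrix.mul_neg, Matrix.neg_mul, Matrix.mul_assoc]
  · simp only [Matrix.mul_assoc, hFF]
    rw [← Matrix.mul_assoc F F, hFF]
  · simp only [conjTranspose_add, conjTranspose_mul, hFs, hGs, hSs, Matrix.mul_neg,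
      Matrix.neg_mul, Matrix.mul_assoc, neg_add]
    rw [add_comm]
  · simp only [Matrix.mul_add, Matrix.add_mul, Matrix.mul_assoc, hFF, hGF, Matrix.mul_zero]
    simp only [← Matrix.mul_assoc, hFF, hFG, Matrix.zero_mul]
    abel
  · noncomm_ring

/-- Write `M = M Pᴴ P + M (1 - F)` with `F = Pᴴ P`. The element `M Pᴴ` of `A` splits as `H + S`,
Hermitian plus skew: `H` is kept, and `S` becomes the corner element `Pᴴ S P`. The remainder is `P`
times the skew off-diagonal matrix built from `Pᴴ M (1 - F)`. -/
theorem exists_corner_add_offDiag (hPX : P ∈ B.X) (hP : P * Pᴴ = 1) {M : Matrix κ ι ℂ}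
    (hM : M ∈ B.X) :
    ∃ H ∈ hermSubmodule B.A, ∃ a ∈ cornerSubmodule B.N (Pᴴ * P),
      ∃ b ∈ offDiagSubmodule B.N (Pᴴ * P), M = H * P + P * (a + b) := by
  obtain ⟨H, hH, S, hS, hHS⟩ := exists_herm_add_skew (B.mul_conjTranspose_mem hM hPX)
  have hF := B.proj_mem hPX
  have hPF := mul_proj hP
  have hFP := proj_mul_conjTranspose hP
  have hFs : (Pᴴ * P)ᴴ = Pᴴ * P := by rw [conjTranspose_mul, conjTranspose_conjTranspose]
  have hGN : 1 - Pᴴ * P ∈ B.N := B.N.sub_mem B.N.one_mem hF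
  have hPG : P * (1 - Pᴴ * P) = 0 := by rw [Matrix.mul_sub, Matrix.mul_one, hPF, sub_self]
  have hGF : (1 - Pᴴ * P) * (Pᴴ * P) = 0 := by
    rw [Matrix.sub_mul, Matrix.one_mul, proj_mul_proj hP, sub_self]
  have hFG : Pᴴ * P * (1 - Pᴴ * P) = 0 := by rw [Matrix.mul_assoc, hPG, Matrix.mul_zero]
  have hGs : (1 - Pᴴ * P)ᴴ = 1 - Pᴴ * P := by rw [conjTranspose_sub, conjTranspose_one, hFs]
  have h1 : M = M * Pᴴ * P + M * (1 - Pᴴ * P) := by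
    rw [Matrix.mul_sub, Matrix.mul_one, Matrix.mul_assoc]
    abel
  have hSa : Pᴴ * (S * P) ∈ B.N := B.conjTranspose_mul_mem hPX (B.mul_mem_left hS.1 hPX)
  have hMP : Pᴴ * M ∈ B.N := B.conjTranspose_mul_mem hPX hM
  have hPM : Mᴴ * P ∈ B.N := B.conjTranspose_mul_mem hM hPX
  generalize 1 - Pᴴ * P = G at hGN hPG hGF hFG hGs h1
  refine ⟨H, hH, Pᴴ * (S * P), ⟨⟨hSa, ?_⟩, ?_⟩,
    Pᴴ * M * G - G * (Mᴴ * P),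
    ⟨⟨B.N.sub_mem (B.N.mul_mem hMP hGN) (B.N.mul_mem hGN hPM), ?_⟩, ?_⟩, ?_⟩
  · simp only [conjTranspose_mul, conjTranspose_conjTranspose, hS.2, Matrix.neg_mul,
      Matrix.mul_neg, Matrix.mul_assoc]
  · rw [← Matrix.mul_assoc (Pᴴ * P), hFP, Matrix.mul_assoc, Matrix.mul_assoc, hPF]
  · simp only [conjTranspose_sub, conjTranspose_mul, conjTranspose_conjTranspose, hGs, neg_sub,
      Matrix.mul_assoc]
  · have e1 : Pᴴ * P * (Pᴴ * M * G) = Pᴴ * M * G := by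
      rw [← Matrix.mul_assoc (Pᴴ * P), ← Matrix.mul_assoc (Pᴴ * P), hFP]
    have e2 : Pᴴ * P * (G * (Mᴴ * P)) = 0 := by
      rw [← Matrix.mul_assoc (Pᴴ * P), hFG, Matrix.zero_mul]
    have e3 : Pᴴ * M * G * (Pᴴ * P) = 0 := by
      rw [Matrix.mul_assoc, hGF, Matrix.mul_zero]
    have e4 : G * (Mᴴ * P) * (Pᴴ * P) = G * (Mᴴ * P) := by
      rw [Matrix.mul_assoc, Matrix.mul_assoc, hPF]
    rw [Matrix.mul_sub, Matrix.sub_mul, e1, e2, e3, e4, sub_zero, zero_sub, sub_eq_add_neg]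
  · have e1 : P * (Pᴴ * (S * P)) = S * P := by rw [← Matrix.mul_assoc, hP, Matrix.one_mul]
    have e2 : P * (Pᴴ * M * G) = M * G := by
      rw [← Matrix.mul_assoc, ← Matrix.mul_assoc, hP, Matrix.one_mul]
    have e3 : P * (G * (Mᴴ * P)) = 0 := by rw [← Matrix.mul_assoc, hPG, Matrix.zero_mul]
    rw [Matrix.mul_add, Matrix.mul_sub, e1, e2, e3, sub_zero, ← add_assoc, ← Matrix.add_mul,
      ← hHS]
    exact h1

variable {c : ℕ} {dp dk dk' da db : ℕ} {ep : EuclideanSpace ℝ (Fin dp) →ₗ[ℝ] Matrix κ κ ℂ}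
  {ek : EuclideanSpace ℝ (Fin dk) →ₗ[ℝ] Matrix ι ι ℂ}
  {ek' : EuclideanSpace ℝ (Fin dk') →ₗ[ℝ] Matrix ι ι ℂ}
  {ea : EuclideanSpace ℝ (Fin da) →ₗ[ℝ] Matrix ι ι ℂ}
  {eb : EuclideanSpace ℝ (Fin db) →ₗ[ℝ] Matrix ι ι ℂ}

theorem range_orbitTangent (hPX : P ∈ B.X) (hP : P * Pᴴ = 1)
    (hp : IsFrame c ep (hermSubmodule B.A)) (ha : IsFrame c ea (cornerSubmodule B.N (Pᴴ * P)))
    (hb : IsFrame c eb (offDiagSubmodule B.N (Pᴴ * P))) :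
    LinearMap.range (orbitTangent ep P (ea.coprod eb)) = B.X := by
  ext M
  constructor
  · rintro ⟨⟨x, y, z⟩, rfl⟩
    exact B.X.add_mem (B.mul_mem_left (hp.mem x).1 hPX)
      (B.mul_mem_right hPX (B.N.add_mem (ha.mem y).1.1 (hb.mem z).1.1))
  · intro hM
    obtain ⟨H, hH, a, ha', b, hb', rfl⟩ := exists_corner_add_offDiag hPX hP hM
    obtain ⟨x, rfl⟩ := hp.exists_eq hH
    obtain ⟨y, rfl⟩ := ha.exists_eq ha'
    obtain ⟨z, rfl⟩ := hb.exists_eq hb'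
    exact ⟨(x, y, z), rfl⟩

theorem norm_sq_orbitTangent (hP : P * Pᴴ = 1)
    (hp : IsFrame c ep (hermSubmodule B.A)) (ha : IsFrame c ea (cornerSubmodule B.N (Pᴴ * P)))
    (hb : IsFrame c eb (offDiagSubmodule B.N (Pᴴ * P))) (x y z) :
    ‖orbitTangent ep P (ea.coprod eb) (x, y, z)‖ ^ 2 =
      c * (‖x‖ ^ 2 + (‖y‖ ^ 2 + ‖z‖ ^ 2 / 2)) := by
  have h := norm_sq_tangent hP (hp.mem x).2 (ha.mem y).1.2 (ha.mem y).2 (hb.mem z).1.2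
    (hb.mem z).2
  rw [hp.norm_sq, ha.norm_sq, hb.norm_sq] at h
  refine Eq.trans ?_ (h.trans (by ring))
  rfl

theorem injective_of_norm_sq {E W : Type*} [AddCommGroup E] [Module ℝ E] [NormedAddCommGroup W]
    [Module ℝ W] {Λ : E →ₗ[ℝ] W} (h : ∀ x, ‖Λ x‖ ^ 2 = 0 → x = 0) : Function.Injective Λ :=
  (injective_iff_map_eq_zero Λ).2 fun x hx => h x (by rw [hx, norm_zero, zero_pow two_ne_zero])

theorem injective_orbitTangent (hc : c ≠ 0) (hP : P * Pᴴ = 1)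
    (hp : IsFrame c ep (hermSubmodule B.A)) (ha : IsFrame c ea (cornerSubmodule B.N (Pᴴ * P)))
    (hb : IsFrame c eb (offDiagSubmodule B.N (Pᴴ * P))) :
    Function.Injective (orbitTangent ep P (ea.coprod eb)) := by
  refine injective_of_norm_sq ?_
  rintro ⟨x, y, z⟩ h
  rw [norm_sq_orbitTangent hP hp ha hb] at h
  have hc' : (c : ℝ) ≠ 0 := Nat.cast_ne_zero.2 hc
  have h1 := (mul_eq_zero.1 h).resolve_left hc'
  have hx : ‖x‖ ^ 2 = 0 := by nlinarith [sq_nonneg ‖x‖, sq_nonneg ‖y‖, sq_nonneg ‖z‖]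
  have hy : ‖y‖ ^ 2 = 0 := by nlinarith [sq_nonneg ‖x‖, sq_nonneg ‖y‖, sq_nonneg ‖z‖]
  have hz : ‖z‖ ^ 2 = 0 := by nlinarith [sq_nonneg ‖x‖, sq_nonneg ‖y‖, sq_nonneg ‖z‖]
  rw [pow_eq_zero_iff two_ne_zero, norm_eq_zero] at hx hy hz
  rw [hx, hy, hz]
  rfl

/-- The exponent splits over the three blocks. Only the off-diagonal block has the coefficient `π /
2`, and each of its `db` directions contributes `√2`. -/
theorem lintegral_exp_orbitTangent (hc : c ≠ 0) (hP : P * Pᴴ = 1)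
    (hp : IsFrame c ep (hermSubmodule B.A)) (ha : IsFrame c ea (cornerSubmodule B.N (Pᴴ * P)))
    (hb : IsFrame c eb (offDiagSubmodule B.N (Pᴴ * P))) :
    ∫⁻ z, ENNReal.ofReal
        (Real.exp (-(Real.pi / c) * ‖orbitTangent ep P (ea.coprod eb) z‖ ^ 2)) =
      ENNReal.ofReal (2 ^ ((db : ℝ) / 2)) := by
  have hc' : (c : ℝ) ≠ 0 := Nat.cast_ne_zero.2 hc
  have h : ∀ z : EuclideanSpace ℝ (Fin dp) × EuclideanSpace ℝ (Fin da) ×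
      EuclideanSpace ℝ (Fin db),
      -(Real.pi / c) * ‖orbitTangent ep P (ea.coprod eb) z‖ ^ 2 =
      -Real.pi * ‖z.1‖ ^ 2 + (-Real.pi * ‖z.2.1‖ ^ 2 + -(Real.pi / 2) * ‖z.2.2‖ ^ 2) := by
    rintro ⟨x, y, z⟩
    rw [norm_sq_orbitTangent hP hp ha hb]
    field_simp
    ring
  simp only [h]
  rw [lintegral_exp_add (E := EuclideanSpace ℝ (Fin dp))
      (F := EuclideanSpace ℝ (Fin da) × EuclideanSpace ℝ (Fin db))
      (f := fun x => -Real.pi * ‖x‖ ^ 2)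
      (g := fun z => -Real.pi * ‖z.1‖ ^ 2 + -(Real.pi / 2) * ‖z.2‖ ^ 2)
      (by fun_prop) (by fun_prop),
    lintegral_exp_add (E := EuclideanSpace ℝ (Fin da)) (F := EuclideanSpace ℝ (Fin db))
      (f := fun x => -Real.pi * ‖x‖ ^ 2)
      (g := fun z => -(Real.pi / 2) * ‖z‖ ^ 2) (by fun_prop) (by fun_prop),
    lintegral_gaussian_pi, lintegral_gaussian_pi, lintegral_gaussian (by positivity), one_mul,
    one_mul, div_div_cancel₀ Real.pi_ne_zero]

end Densities

theorem isAddHaarMeasure_prod {E F : Type*} [NormedAddCommGroup E] [NormedSpace ℝ E]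
    [FiniteDimensional ℝ E] [MeasurableSpace E] [BorelSpace E] [NormedAddCommGroup F]
    [NormedSpace ℝ F] [FiniteDimensional ℝ F] [MeasurableSpace F] [BorelSpace F]
    (μ : Measure E) [μ.IsAddHaarMeasure] (ν : Measure F) [ν.IsAddHaarMeasure] :
    (μ.prod ν).IsAddHaarMeasure := by
  infer_instance

/-! ### Two linear charts of `N`, and the fibration of `K_n` over its orbit -/

section GroupDensities

attribute [local instance] Matrix.frobeniusNormedAddCommGroup Matrix.frobeniusNormedSpace
  Matrix.frobeniusNormedRing Matrix.frobeniusNormedAlgebra Matrix.borelSpace_frobenius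

variable {ι κ : Type} [Fintype ι] [DecidableEq ι] [Fintype κ] [DecidableEq κ]
variable {B : MatrixBimodule κ ι} {P : Matrix κ ι ℂ}
variable {c : ℕ} {dp dh dk dk' da db : ℕ}
  {ep : EuclideanSpace ℝ (Fin dp) →ₗ[ℝ] Matrix κ κ ℂ}
  {eh : EuclideanSpace ℝ (Fin dh) →ₗ[ℝ] Matrix ι ι ℂ}
  {ek : EuclideanSpace ℝ (Fin dk) →ₗ[ℝ] Matrix ι ι ℂ}
  {ek' : EuclideanSpace ℝ (Fin dk') →ₗ[ℝ] Matrix ι ι ℂ}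
  {ea : EuclideanSpace ℝ (Fin da) →ₗ[ℝ] Matrix ι ι ℂ}
  {eb : EuclideanSpace ℝ (Fin db) →ₗ[ℝ] Matrix ι ι ℂ}

section SelfTangent

variable {N : StarSubalgebra ℝ (Matrix ι ι ℂ)}

theorem orbitTangent_one_apply {F : Type*} [AddCommGroup F] [Module ℝ F]
    (q : F →ₗ[ℝ] Matrix ι ι ℂ) (z : EuclideanSpace ℝ (Fin dh) × F) :
    orbitTangent eh 1 q z = eh z.1 + q z.2 := by
  change eh z.1 * 1 + 1 * q z.2 = _
  rw [Matrix.mul_one, Matrix.one_mul]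

theorem range_orbitTangent_one {F : Type*} [AddCommGroup F] [Module ℝ F]
    {q : F →ₗ[ℝ] Matrix ι ι ℂ} (hh : IsFrame c eh (hermSubmodule N))
    (hq : LinearMap.range q = skewSubmodule N) :
    LinearMap.range (orbitTangent eh 1 q) = (MatrixBimodule.self N).X := by
  have hqm : ∀ y, q y ∈ skewSubmodule N := fun y => hq ▸ LinearMap.mem_range_self q y
  ext M
  constructor
  · rintro ⟨z, rfl⟩
    rw [orbitTangent_one_apply]
    exact N.add_mem (hh.mem _).1 (hqm _).1
  · intro hM
    obtain ⟨H, hH, S, hS, rfl⟩ := exists_herm_add_skew (A := N) hM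
    obtain ⟨x, rfl⟩ := hh.exists_eq hH
    rw [← hq] at hS
    obtain ⟨y, rfl⟩ := hS
    exact ⟨(x, y), orbitTangent_one_apply _ _⟩

theorem norm_sq_orbitTangent_one {F : Type*} [AddCommGroup F] [Module ℝ F]
    {q : F →ₗ[ℝ] Matrix ι ι ℂ} (hh : IsFrame c eh (hermSubmodule N))
    (hq : LinearMap.range q = skewSubmodule N) (x : EuclideanSpace ℝ (Fin dh)) (y : F) :
    ‖orbitTangent eh 1 q (x, y)‖ ^ 2 = c * ‖x‖ ^ 2 + ‖q y‖ ^ 2 := by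
  have hqm : q y ∈ skewSubmodule N := hq ▸ LinearMap.mem_range_self q y
  have h := frobenius_norm_sq_add (re_trace_herm_mul_skew (hh.mem x).2 hqm.2)
  rw [hh.norm_sq] at h
  rw [orbitTangent_one_apply]
  exact h

theorem range_coprod_skew (hP : P * Pᴴ = 1) (hPX : P ∈ B.X)
    (hk' : IsFrame c ek' (stabSubmodule B.N P))
    (ha : IsFrame c ea (cornerSubmodule B.N (Pᴴ * P)))
    (hb : IsFrame c eb (offDiagSubmodule B.N (Pᴴ * P))) :
    LinearMap.range (ek'.coprod (ea.coprod eb)) = skewSubmodule B.N := by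
  ext M
  constructor
  · rintro ⟨⟨x, y, z⟩, rfl⟩
    exact (skewSubmodule B.N).add_mem (hk'.mem x).1
      ((skewSubmodule B.N).add_mem (ha.mem y).1 (hb.mem z).1)
  · intro hM
    obtain ⟨A, hA, a, ha', b, hb', rfl⟩ := exists_stab_add_corner_add_offDiag hPX hP hM
    obtain ⟨x, rfl⟩ := hk'.exists_eq hA
    obtain ⟨y, rfl⟩ := ha.exists_eq ha'
    obtain ⟨z, rfl⟩ := hb.exists_eq hb'
    exact ⟨(x, y, z), rfl⟩

theorem norm_sq_coprod_skew (hP : P * Pᴴ = 1)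
    (hk' : IsFrame c ek' (stabSubmodule B.N P))
    (ha : IsFrame c ea (cornerSubmodule B.N (Pᴴ * P)))
    (hb : IsFrame c eb (offDiagSubmodule B.N (Pᴴ * P))) (x y z) :
    ‖ek'.coprod (ea.coprod eb) (x, y, z)‖ ^ 2 = c * (‖x‖ ^ 2 + (‖y‖ ^ 2 + ‖z‖ ^ 2)) := by
  have h := norm_sq_skew hP (hk'.mem x).2 (hk'.mem x).1.2 (ha.mem y).1.2 (ha.mem y).2
    (hb.mem z).1.2 (hb.mem z).2
  rw [hk'.norm_sq, ha.norm_sq, hb.norm_sq] at h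
  refine Eq.trans ?_ (h.trans (by ring))
  rfl

theorem lintegral_gaussian_prod {d₁ d₂ : ℕ} :
    ∫⁻ z : EuclideanSpace ℝ (Fin d₁) × EuclideanSpace ℝ (Fin d₂),
      ENNReal.ofReal (Real.exp (-Real.pi * ‖z.1‖ ^ 2 + -Real.pi * ‖z.2‖ ^ 2)) = 1 := by
  rw [lintegral_exp_add (E := EuclideanSpace ℝ (Fin d₁)) (F := EuclideanSpace ℝ (Fin d₂))
      (f := fun x => -Real.pi * ‖x‖ ^ 2) (g := fun x => -Real.pi * ‖x‖ ^ 2)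
      (by fun_prop) (by fun_prop), lintegral_gaussian_pi, lintegral_gaussian_pi, one_mul]

theorem lintegral_gaussian_prod_four {d₁ d₂ d₃ d₄ : ℕ} :
    ∫⁻ z : EuclideanSpace ℝ (Fin d₁) × EuclideanSpace ℝ (Fin d₂) × EuclideanSpace ℝ (Fin d₃) ×
        EuclideanSpace ℝ (Fin d₄),
      ENNReal.ofReal (Real.exp (-Real.pi * ‖z.1‖ ^ 2 + (-Real.pi * ‖z.2.1‖ ^ 2 +
        (-Real.pi * ‖z.2.2.1‖ ^ 2 + -Real.pi * ‖z.2.2.2‖ ^ 2)))) = 1 := by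
  rw [lintegral_exp_add (E := EuclideanSpace ℝ (Fin d₁)) (F := EuclideanSpace ℝ (Fin d₂) ×
        EuclideanSpace ℝ (Fin d₃) × EuclideanSpace ℝ (Fin d₄))
      (f := fun x => -Real.pi * ‖x‖ ^ 2) (g := fun z => -Real.pi * ‖z.1‖ ^ 2 +
        (-Real.pi * ‖z.2.1‖ ^ 2 + -Real.pi * ‖z.2.2‖ ^ 2))
      (by fun_prop) (by fun_prop),
    lintegral_exp_add (E := EuclideanSpace ℝ (Fin d₂)) (F :=
        EuclideanSpace ℝ (Fin d₃) × EuclideanSpace ℝ (Fin d₄))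
      (f := fun x => -Real.pi * ‖x‖ ^ 2) (g := fun z => 
        -Real.pi * ‖z.1‖ ^ 2 + -Real.pi * ‖z.2‖ ^ 2)
      (by fun_prop) (by fun_prop), lintegral_gaussian_pi, lintegral_gaussian_pi,
      lintegral_gaussian_prod, one_mul, one_mul]

theorem injective_orbitTangent_one (hc : c ≠ 0) {F : Type*} [AddCommGroup F] [Module ℝ F]
    {q : F →ₗ[ℝ] Matrix ι ι ℂ} (hh : IsFrame c eh (hermSubmodule N))
    (hq : LinearMap.range q = skewSubmodule N) (hqi : Function.Injective q) :
    Function.Injective (orbitTangent eh 1 q) := by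
  refine injective_of_norm_sq ?_
  rintro ⟨x, y⟩ h
  rw [norm_sq_orbitTangent_one hh hq] at h
  have hc' : (0 : ℝ) < c := Nat.cast_pos.2 (Nat.pos_of_ne_zero hc)
  have hx : ‖x‖ ^ 2 = 0 := by nlinarith [mul_nonneg hc'.le (sq_nonneg ‖x‖), sq_nonneg ‖q y‖]
  have hy : ‖q y‖ ^ 2 = 0 := by nlinarith [mul_nonneg hc'.le (sq_nonneg ‖x‖), sq_nonneg ‖q y‖]
  have hx' : x = 0 := norm_eq_zero.1 (pow_eq_zero_iff two_ne_zero |>.1 hx)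
  have hy' : q y = 0 := norm_eq_zero.1 (pow_eq_zero_iff two_ne_zero |>.1 hy)
  rw [hx', (injective_iff_map_eq_zero q).1 hqi y hy']
  rfl

theorem IsFrame.injective (hc : c ≠ 0) {p : Submodule ℝ (Matrix ι ι ℂ)} (h : IsFrame c ek p) :
    Function.Injective ek := by
  refine injective_of_norm_sq fun x hx => ?_
  rw [h.norm_sq] at hx
  exact norm_eq_zero.1 (pow_eq_zero_iff two_ne_zero |>.1
    ((mul_eq_zero.1 hx).resolve_left (Nat.cast_ne_zero.2 hc)))

theorem injective_coprod_skew (hc : c ≠ 0) (hP : P * Pᴴ = 1)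
    (hk' : IsFrame c ek' (stabSubmodule B.N P))
    (ha : IsFrame c ea (cornerSubmodule B.N (Pᴴ * P)))
    (hb : IsFrame c eb (offDiagSubmodule B.N (Pᴴ * P))) :
    Function.Injective (ek'.coprod (ea.coprod eb)) := by
  refine injective_of_norm_sq ?_
  rintro ⟨x, y, z⟩ h
  rw [norm_sq_coprod_skew hP hk' ha hb] at h
  have h1 := (mul_eq_zero.1 h).resolve_left (Nat.cast_ne_zero.2 hc)
  have hx : ‖x‖ ^ 2 = 0 := by nlinarith [sq_nonneg ‖x‖, sq_nonneg ‖y‖, sq_nonneg ‖z‖]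
  have hy : ‖y‖ ^ 2 = 0 := by nlinarith [sq_nonneg ‖x‖, sq_nonneg ‖y‖, sq_nonneg ‖z‖]
  have hz : ‖z‖ ^ 2 = 0 := by nlinarith [sq_nonneg ‖x‖, sq_nonneg ‖y‖, sq_nonneg ‖z‖]
  rw [pow_eq_zero_iff two_ne_zero, norm_eq_zero] at hx hy hz
  rw [hx, hy, hz]
  rfl

/-- The two parametrizations of a matrix `*`-algebra by Hermitian and skew-Hermitian elements
define the same measure. -/
theorem map_orbitTangent_one_eq (hc : c ≠ 0) (hP : P * Pᴴ = 1) (hPX : P ∈ B.X)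
    (hh : IsFrame c eh (hermSubmodule B.N)) (hk : IsFrame c ek (skewSubmodule B.N))
    (hk' : IsFrame c ek' (stabSubmodule B.N P))
    (ha : IsFrame c ea (cornerSubmodule B.N (Pᴴ * P)))
    (hb : IsFrame c eb (offDiagSubmodule B.N (Pᴴ * P))) :
    Measure.map (orbitTangent eh 1 (ek'.coprod (ea.coprod eb))) volume =
      Measure.map (orbitTangent eh 1 ek) volume := by
  have hr := range_coprod_skew hP hPX hk' ha hb
  have hc' : (c : ℝ) ≠ 0 := Nat.cast_ne_zero.2 hc
  have h1 : ∫⁻ z, ENNReal.ofReal (Real.exp (-(Real.pi / c) * ‖orbitTangent eh 1 ek z‖ ^ 2)) = 1 := by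
    rw [← lintegral_gaussian_prod (d₁ := dh) (d₂ := dk)]
    refine lintegral_congr ?_
    rintro ⟨x, y⟩
    rw [norm_sq_orbitTangent_one hh hk.range_eq, hk.norm_sq]
    congr 2
    field_simp
    ring
  have h2 : ∫⁻ z, ENNReal.ofReal (Real.exp (-(Real.pi / c) *
      ‖orbitTangent eh 1 (ek'.coprod (ea.coprod eb)) z‖ ^ 2)) = 1 := by
    rw [← lintegral_gaussian_prod_four (d₁ := dh) (d₂ := dk') (d₃ := da) (d₄ := db)]
    refine lintegral_congr ?_
    rintro ⟨x, y, z, w⟩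
    rw [norm_sq_orbitTangent_one hh hr, norm_sq_coprod_skew hP hk' ha hb]
    congr 2
    field_simp
    ring
  have := isAddHaarMeasure_prod (volume : Measure (EuclideanSpace ℝ (Fin da)))
    (volume : Measure (EuclideanSpace ℝ (Fin db)))
  have := isAddHaarMeasure_prod (volume : Measure (EuclideanSpace ℝ (Fin dk')))
    ((volume : Measure (EuclideanSpace ℝ (Fin da))).prod
      (volume : Measure (EuclideanSpace ℝ (Fin db))))
  have := isAddHaarMeasure_prod (volume : Measure (EuclideanSpace ℝ (Fin dh)))
    ((volume : Measure (EuclideanSpace ℝ (Fin dk'))).prod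
      ((volume : Measure (EuclideanSpace ℝ (Fin da))).prod
        (volume : Measure (EuclideanSpace ℝ (Fin db)))))
  have h := Measure.map_linear_eq_smul
    ((volume : Measure (EuclideanSpace ℝ (Fin dh))).prod
      (volume : Measure (EuclideanSpace ℝ (Fin dk))))
    ((volume : Measure (EuclideanSpace ℝ (Fin dh))).prod
      ((volume : Measure (EuclideanSpace ℝ (Fin dk'))).prod
        ((volume : Measure (EuclideanSpace ℝ (Fin da))).prod
          (volume : Measure (EuclideanSpace ℝ (Fin db))))))
    (injective_orbitTangent_one hc hh hk.range_eq (hk.injective hc))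
    (injective_orbitTangent_one hc hh hr (injective_coprod_skew hc hP hk' ha hb))
    ((range_orbitTangent_one hh hk.range_eq).trans (range_orbitTangent_one hh hr).symm)
    (Q := fun M => ENNReal.ofReal (Real.exp (-(Real.pi / c) * ‖M‖ ^ 2))) (t := 1)
    (by fun_prop) (h1.symm ▸ one_ne_zero) (h1.symm ▸ ENNReal.one_ne_top)
    (h2.trans ((one_mul _).trans h1).symm)
  exact h.trans (one_smul _ _)

end SelfTangent

/-- Fibration of a neighbourhood of the identity in `K` over the orbit `P * K`, with the
stabilizer `K'` of `P` as fibre. -/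
theorem measure_exp_mul_exp_mul {K K' : Subgroup (GL ι ℂ)} [LocallyCompactSpace K]
    [LocallyCompactSpace K']
    (hK' : ∀ k, k ∈ K' ↔ k ∈ K ∧ P * (k : Matrix ι ι ℂ) = P) (η : Measure K)
    [η.IsMulLeftInvariant] [SFinite η] (η' : Measure K') [η'.IsMulLeftInvariant] [SFinite η']
    {E F : Type*} [NormedAddCommGroup E] [NormedSpace ℝ E] [FiniteDimensional ℝ E]
    [MeasurableSpace E] [BorelSpace E] [NormedAddCommGroup F] [NormedSpace ℝ F]
    [FiniteDimensional ℝ F] [MeasurableSpace F] [BorelSpace F]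
    {e : E →ₗ[ℝ] Matrix ι ι ℂ} (he : ∀ x, ∃ k ∈ K', ((k : GL ι ℂ) : Matrix ι ι ℂ) =
      NormedSpace.exp (e x))
    {q : F →ₗ[ℝ] Matrix ι ι ℂ} (hq : ∀ y, ∃ k ∈ K, ((k : GL ι ℂ) : Matrix ι ι ℂ) =
      NormedSpace.exp (q y)) {S : Set F} (hS : IsOpen S)
    (hinj : Set.InjOn (fun y => P * NormedSpace.exp (q y)) S) (t : ℝ) :
    η {k : K | ∃ z ∈ Metric.ball (0 : E) t ×ˢ S, 1 * ((k : GL ι ℂ) : Matrix ι ι ℂ) =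
        1 * (NormedSpace.exp (e z.1) * NormedSpace.exp (q z.2))} * η' Set.univ =
      η' {k : K' | ∃ x ∈ Metric.ball (0 : E) t, ((k : GL ι ℂ) : Matrix ι ι ℂ) =
        NormedSpace.exp (e x)} *
      η {k : K | ∃ y ∈ S, P * ((k : GL ι ℂ) : Matrix ι ι ℂ) = P * NormedSpace.exp (q y)} := by
  have hle : K' ≤ K := fun k hk => ((hK' k).1 hk).1
  have hcont : Continuous fun z : K' × K => (Subgroup.inclusion hle z.1)⁻¹ * z.2 :=
    (((continuous_subtype_val.subtype_mk _ : Continuous (Subgroup.inclusion hle)).comp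
      continuous_fst).inv).mul continuous_snd
  refine measure_mul_measure_univ_of_orbit η' η
    (act := fun h k => (Subgroup.inclusion hle h)⁻¹ * k) hcont.measurable
    (fun h E _ => measure_preimage_mul η _ E) ?_ ?_ ?_ ?_
  -- The stabilizer `K'` acts on `K` by `h ↦ h⁻¹ k`, and the averaging lemma is applied with the
  -- coset set as base.
  · exact measurableSet_coset_image (1 : Matrix ι ι ℂ) (σ := fun z : E × F =>
      NormedSpace.exp (e z.1) * NormedSpace.exp (q z.2))
      (((continuous_exp_comp e).comp continuous_fst).matrix_mul
        ((continuous_exp_comp q).comp continuous_snd)) (Metric.isOpen_ball.prod hS)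
  · exact measurableSet_coset_image P (continuous_exp_comp q) hS
  · rintro k ⟨y, hy, hky⟩
    obtain ⟨s, hs, hsy⟩ := hq y
    -- If `P k = P s` then `k = u s` with `u` in the stabilizer. Injectivity on `S` makes `h⁻¹ k ∈
    -- exp(ball) exp(S)` equivalent to `h⁻¹ u ∈ exp(ball)`; passing to inverses uses that the ball
    -- is symmetric and gives a translate of the exponential ball in `K'`.
    have hu : (k : GL ι ℂ) * s⁻¹ ∈ K' := by
      refine (hK' _).2 ⟨K.mul_mem k.2 (K.inv_mem hs), ?_⟩
      rw [Units.val_mul, ← Matrix.mul_assoc, hky, ← hsy, Matrix.mul_assoc, Units.mul_inv,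
        Matrix.mul_one]
    rw [← measure_preimage_mul η' (⟨_, hu⟩ : K')⁻¹ {k : K' | ∃ x ∈ Metric.ball (0 : E) t,
      ((k : GL ι ℂ) : Matrix ι ι ℂ) = NormedSpace.exp (e x)}]
    refine congrArg η' (Set.ext fun h => ?_)
    have hPh : P * (((h : GL ι ℂ)⁻¹ : GL ι ℂ) : Matrix ι ι ℂ) = P :=
      ((hK' _).1 (K'.inv_mem h.2)).2
    have hPe : ∀ x, P * NormedSpace.exp (e x) = P := fun x => by
      obtain ⟨k, hk, hkx⟩ := he x
      rw [← hkx]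
      exact ((hK' k).1 hk).2
    have hinv : ∀ (x) (g : GL ι ℂ), (g : Matrix ι ι ℂ) = NormedSpace.exp (e x) →
        ((g⁻¹ : GL ι ℂ) : Matrix ι ι ℂ) = NormedSpace.exp (e (-x)) := fun x g hg => by
      refine Units.inv_eq_of_mul_eq_one_left ?_
      rw [hg, map_neg, ← Matrix.exp_add_of_commute (-e x) (e x) ((Commute.refl (e x)).neg_left),
          neg_add_cancel, NormedSpace.exp_zero]
    change (∃ z ∈ Metric.ball (0 : E) t ×ˢ S, 1 * (((h : GL ι ℂ)⁻¹ * (k : GL ι ℂ) : GL ι ℂ) :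
        Matrix ι ι ℂ) = 1 * (NormedSpace.exp (e z.1) * NormedSpace.exp (q z.2))) ↔
      ∃ x ∈ Metric.ball (0 : E) t, ((((k : GL ι ℂ) * s⁻¹)⁻¹ * (h : GL ι ℂ) : GL ι ℂ) :
        Matrix ι ι ℂ) = NormedSpace.exp (e x)
    have hneg : ∀ x ∈ Metric.ball (0 : E) t, -x ∈ Metric.ball (0 : E) t := fun x hx => by
      simpa using hx
    have hrel : ((k : GL ι ℂ) * s⁻¹)⁻¹ * (h : GL ι ℂ) =
        ((h : GL ι ℂ)⁻¹ * (k : GL ι ℂ) * s⁻¹)⁻¹ := by group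
    constructor
    · rintro ⟨⟨x, y'⟩, ⟨hx, hy'⟩, hxy⟩
      rw [Matrix.one_mul, Matrix.one_mul] at hxy
      have h1 : P * NormedSpace.exp (q y) = P * NormedSpace.exp (q y') := by
        have h2 := congrArg (fun M => P * M) hxy
        simp only [← Matrix.mul_assoc, Units.val_mul, hPh, hPe, hky] at h2
        exact h2
      have h2 := hinj hy hy' h1
      subst h2
      refine ⟨-x, hneg x hx, ?_⟩
      rw [hrel]
      refine hinv x _ ?_
      rw [Units.val_mul, hxy, ← hsy, Matrix.mul_assoc, Units.mul_inv, Matrix.mul_one]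
    · rintro ⟨x, hx, hxh⟩
      refine ⟨(-x, y), ⟨hneg x hx, hy⟩, ?_⟩
      rw [hrel] at hxh
      have h1 := hinv x _ hxh
      rw [inv_inv] at h1
      rw [← h1, ← hsy, ← Units.val_mul, inv_mul_cancel_right]
  · rintro k hk h ⟨⟨x, y⟩, ⟨hx, hy⟩, hxy⟩
    refine hk ⟨y, hy, ?_⟩
    have hPh : P * (((h : GL ι ℂ)⁻¹ : GL ι ℂ) : Matrix ι ι ℂ) = P :=
      ((hK' _).1 (K'.inv_mem h.2)).2
    have hPe : P * NormedSpace.exp (e x) = P := by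
      obtain ⟨k, hk, hkx⟩ := he x
      rw [← hkx]
      exact ((hK' k).1 hk).2
    have hxy' : 1 * (((h : GL ι ℂ)⁻¹ * (k : GL ι ℂ) : GL ι ℂ) :
        Matrix ι ι ℂ) = 1 * (NormedSpace.exp (e x) * NormedSpace.exp (q y)) := hxy
    rw [Matrix.one_mul, Matrix.one_mul, Units.val_mul] at hxy'
    have h2 := congrArg (fun M => P * M) hxy'
    simp only [← Matrix.mul_assoc, hPh, hPe] at h2
    exact h2

end GroupDensities

/-! ### Existence of the Haar densities and the density of the tube -/

section TubeDensity

attribute [local instance] Matrix.frobeniusNormedAddCommGroup Matrix.frobeniusNormedSpace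
  Matrix.frobeniusNormedRing Matrix.frobeniusNormedAlgebra Matrix.borelSpace_frobenius

variable {ι κ : Type} [Fintype ι] [DecidableEq ι] [Fintype κ] [DecidableEq κ]

theorem tendsto_ball_smallSets {E : Type*} [NormedAddCommGroup E] :
    Tendsto (fun r : ℝ => Metric.ball (0 : E) r) (𝓝[>] 0) (𝓝 0).smallSets := by
  refine tendsto_smallSets_iff.2 fun s hs => ?_
  obtain ⟨δ, hδ, h⟩ := Metric.mem_nhds_iff.1 hs
  filter_upwards [Ioo_mem_nhdsGT hδ] with r hr
  exact (Metric.ball_subset_ball hr.2.le).trans h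

theorem tendsto_ball_prod_smallSets {E F : Type*} [NormedAddCommGroup E] [NormedAddCommGroup F] :
    Tendsto (fun r : ℝ × ℝ => Metric.ball (0 : E) r.1 ×ˢ Metric.ball (0 : F) r.2)
      (𝓝[>] 0 ×ˢ 𝓝[>] 0) (𝓝 (0 : E × F)).smallSets := by
  refine tendsto_smallSets_iff.2 fun s hs => ?_
  obtain ⟨δ, hδ, h⟩ := Metric.mem_nhds_iff.1 hs
  filter_upwards [prod_mem_prod (Ioo_mem_nhdsGT hδ) (Ioo_mem_nhdsGT hδ)] with r hr
  refine Set.Subset.trans (Set.prod_mono (Metric.ball_subset_ball hr.1.2.le)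
    (Metric.ball_subset_ball hr.2.2.le)) ?_
  rw [ball_prod_same]
  exact h

variable {N : StarSubalgebra ℝ (Matrix ι ι ℂ)} {P : Matrix κ ι ℂ} {K : Subgroup (GL ι ℂ)}

theorem IsUnitaryGroupOf.exists_exp_eq (hK : IsUnitaryGroupOf K N) {A : Matrix ι ι ℂ}
    (hA : A ∈ skewSubmodule N) : ∃ k ∈ K, ((k : GL ι ℂ) : Matrix ι ι ℂ) = NormedSpace.exp A := by
  have h := exp_mul_conjTranspose_of_skew hA.2
  refine ⟨⟨_, _, h, mul_eq_one_comm.1 h⟩, (hK _).2 ⟨N.exp_mem_matrix hA.1, h⟩, rfl⟩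

/-- The tube asymptotics are used three times: for `N` over itself with `P = 1` in the chart
`exp(skew)` of `K`, again in the chart `exp(stabilizer) exp(corner + off-diagonal)`, and for the
given `P`. The first yields the Haar density `dK`; the second shows that the split chart has the
same density; the fibration factors it into `dK'` and the density of the coset set; the third
converts the latter into the tube density. -/
theorem exists_tube_density {B : MatrixBimodule κ ι} {c : ℕ} (hc : c ≠ 0)
    {K' : Subgroup (GL ι ℂ)} [LocallyCompactSpace K] [LocallyCompactSpace K']
    (hK : IsUnitaryGroupOf K B.N) (hK' : ∀ k, k ∈ K' ↔ k ∈ K ∧ P * (k : Matrix ι ι ℂ) = P)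
    (hPX : P ∈ B.X) (hP : P * Pᴴ = 1) {dp dk dk' da db : ℕ}
    {ep : EuclideanSpace ℝ (Fin dp) →ₗ[ℝ] Matrix κ κ ℂ}
    {ek : EuclideanSpace ℝ (Fin dk) →ₗ[ℝ] Matrix ι ι ℂ}
    {ek' : EuclideanSpace ℝ (Fin dk') →ₗ[ℝ] Matrix ι ι ℂ}
    {ea : EuclideanSpace ℝ (Fin da) →ₗ[ℝ] Matrix ι ι ℂ}
    {eb : EuclideanSpace ℝ (Fin db) →ₗ[ℝ] Matrix ι ι ℂ}
    (hp : IsFrame c ep (hermSubmodule B.A)) (hk : IsFrame c ek (skewSubmodule B.N))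
    (hk' : IsFrame c ek' (stabSubmodule B.N P))
    (ha : IsFrame c ea (cornerSubmodule B.N (Pᴴ * P)))
    (hb : IsFrame c eb (offDiagSubmodule B.N (Pᴴ * P)))
    (η : Measure K) [η.IsHaarMeasure] [IsFiniteMeasure η]
    (η' : Measure K') [η'.IsHaarMeasure] [IsFiniteMeasure η'] :
    ∃ dK dK' : ℝ≥0∞, (dK ≠ 0 ∧ dK ≠ ⊤) ∧ (dK' ≠ 0 ∧ dK' ≠ ⊤) ∧
      Tendsto (fun r : ℝ => η {k : K | ∃ x ∈ Metric.ball (0 : EuclideanSpace ℝ (Fin dk)) r,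
        ((k : GL ι ℂ) : Matrix ι ι ℂ) = NormedSpace.exp (ek x)} /
          volume (Metric.ball (0 : EuclideanSpace ℝ (Fin dk)) r)) (𝓝[>] 0) (𝓝 dK) ∧
      Tendsto (fun r : ℝ => η' {k : K' | ∃ x ∈ Metric.ball (0 : EuclideanSpace ℝ (Fin dk')) r,
        ((k : GL ι ℂ) : Matrix ι ι ℂ) = NormedSpace.exp (ek' x)} /
          volume (Metric.ball (0 : EuclideanSpace ℝ (Fin dk')) r)) (𝓝[>] 0) (𝓝 dK') ∧
      Tendsto (fun r : ℝ => Measure.map (orbitTangent ep P (ea.coprod eb)) volume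
        (tube ep P K r) / volume (Metric.ball (0 : EuclideanSpace ℝ (Fin dp)) r)) (𝓝[>] 0)
        (𝓝 (η Set.univ * dK' / (dK * η' Set.univ))) := by
  obtain ⟨eh, heh⟩ := exists_traceForm_frame hc (hermSubmodule B.N)
  have hh : IsFrame c eh (hermSubmodule B.N) := ⟨heh.1, heh.2⟩
  have hηt : η Set.univ ≠ ⊤ := measure_ne_top _ _
  have hη't : η' Set.univ ≠ ⊤ := measure_ne_top _ _
  have hη0 : η Set.univ ≠ 0 := (isOpen_univ.measure_pos η ⟨1, trivial⟩).ne'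
  have hη'0 : η' Set.univ ≠ 0 := (isOpen_univ.measure_pos η' ⟨1, trivial⟩).ne'
  have h11 : (1 : Matrix ι ι ℂ) * (1 : Matrix ι ι ℂ)ᴴ = 1 := by
    rw [conjTranspose_one, Matrix.one_mul]
  have hKs : IsUnitaryGroupOf K (MatrixBimodule.self B.N).N := hK
  have h1X : (1 : Matrix ι ι ℂ) ∈ (MatrixBimodule.self B.N).X := B.N.one_mem
  have hqm : ∀ y, ea.coprod eb y ∈ skewSubmodule B.N := fun y =>
    (skewSubmodule B.N).add_mem (ha.mem y.1).1 (hb.mem y.2).1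
  have hqK : ∀ y, ∃ k ∈ K, ((k : GL ι ℂ) : Matrix ι ι ℂ) =
      NormedSpace.exp (ea.coprod eb y) := fun y => hK.exists_exp_eq (hqm y)
  have hek'K : ∀ x, ∃ k ∈ K', ((k : GL ι ℂ) : Matrix ι ι ℂ) =
      NormedSpace.exp (ek' x) := fun x => by
    obtain ⟨k, hk, hkx⟩ := hK.exists_exp_eq (hk'.mem x).1
    refine ⟨k, (hK' k).2 ⟨hk, ?_⟩, hkx⟩
    rw [hkx]
    exact mul_exp_of_mul_eq_zero (hk'.mem x).2
  have := isAddHaarMeasure_prod (volume : Measure (EuclideanSpace ℝ (Fin da)))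
    (volume : Measure (EuclideanSpace ℝ (Fin db)))
  have := isAddHaarMeasure_prod (volume : Measure (EuclideanSpace ℝ (Fin dk')))
    ((volume : Measure (EuclideanSpace ℝ (Fin da))).prod
      (volume : Measure (EuclideanSpace ℝ (Fin db))))
  have htA := tendsto_tube_mul_coset (MatrixBimodule.self B.N) hKs h1X h11 hh.mem
    (continuous_exp_comp ek) (fun y => hK.exists_exp_eq (hk.mem y))
    (hasStrictFDerivAt_exp_mul_mul eh 1 (HasStrictFDerivAt.exp_linear ek)
      (by rw [map_zero, NormedSpace.exp_zero]))
    (injective_orbitTangent_one hc hh hk.range_eq (hk.injective hc))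
    (range_orbitTangent_one hh hk.range_eq) volume volume η hηt
    (T := fun s : ℝ => Metric.ball 0 s) tendsto_ball_smallSets
    (by filter_upwards [self_mem_nhdsWithin] with s hs
        exact ⟨Metric.isOpen_ball, ⟨0, Metric.mem_ball_self hs⟩⟩)
  have hr := range_coprod_skew hP hPX hk' ha hb
  have htB := tendsto_tube_mul_coset (MatrixBimodule.self B.N) hKs h1X h11 hh.mem
    (σ := fun z : EuclideanSpace ℝ (Fin dk') × EuclideanSpace ℝ (Fin da) ×
      EuclideanSpace ℝ (Fin db) => NormedSpace.exp (ek' z.1) *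
        NormedSpace.exp (ea.coprod eb z.2))
    (((continuous_exp_comp ek').comp continuous_fst).matrix_mul
        ((continuous_exp_comp (ea.coprod eb)).comp continuous_snd))
    (fun z => by
      obtain ⟨k, hk, hkx⟩ := hek'K z.1
      obtain ⟨s, hs, hsy⟩ := hqK z.2
      exact ⟨k * s, K.mul_mem ((hK' k).1 hk).1 hs, by rw [Units.val_mul, hkx, hsy]⟩)
    (hasStrictFDerivAt_exp_mul_mul eh 1 (HasStrictFDerivAt.exp_mul_exp_linear ek' (ea.coprod eb))
      (by rw [Prod.fst_zero, Prod.snd_zero, map_zero, map_zero, NormedSpace.exp_zero,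
            Matrix.one_mul]))
    (injective_orbitTangent_one hc hh hr (injective_coprod_skew hc hP hk' ha hb))
    (range_orbitTangent_one hh hr) volume (volume.prod (volume.prod volume)) η hηt
    (T := fun s : ℝ × ℝ => Metric.ball 0 s.1 ×ˢ Metric.ball 0 s.2) tendsto_ball_prod_smallSets
    (by filter_upwards [prod_mem_prod (self_mem_nhdsWithin (a := (0 : ℝ)) (s := Set.Ioi 0))
          (self_mem_nhdsWithin (a := (0 : ℝ)) (s := Set.Ioi 0))] with s hs
        exact ⟨Metric.isOpen_ball.prod Metric.isOpen_ball,
          ⟨0, Metric.mem_ball_self hs.1, Metric.mem_ball_self hs.2⟩⟩)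
  have hD := hasStrictFDerivAt_exp_mul_mul ep P (HasStrictFDerivAt.exp_linear (ea.coprod eb))
      (by rw [map_zero, NormedSpace.exp_zero])
  have htD := tendsto_tube_mul_coset B hK hPX hP hp.mem
    (continuous_exp_comp (ea.coprod eb)) hqK hD
    (injective_orbitTangent hc hP hp ha hb)
    (range_orbitTangent hPX hP hp ha hb) volume (volume.prod volume) η hηt
    (T := fun s : ℝ => Metric.ball 0 s) tendsto_ball_smallSets
    (by filter_upwards [self_mem_nhdsWithin] with s hs
        exact ⟨Metric.isOpen_ball, ⟨0, Metric.mem_ball_self hs⟩⟩)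
  have hmap := map_orbitTangent_one_eq hc hP hPX hh hk hk' ha hb
  obtain ⟨δ, hδ, hinj⟩ := HasStrictFDerivAt.exists_ball_injOn_of_injective
    (injective_orbitTangent hc hP hp ha hb) hD
  -- The map `y ↦ P exp(q y)` is injective on small balls because it is the slice `x = 0` of the
  -- full chart of `X`, whose derivative is injective.
  have hfib : ∀ t s : ℝ, s < δ → _ := fun t s hs => measure_exp_mul_exp_mul hK' η η' hek'K hqK
    (S := Metric.ball 0 s) Metric.isOpen_ball (fun y hy y' hy' hyy => by
      have h0 : ∀ y ∈ Metric.ball (0 : EuclideanSpace ℝ (Fin da) × EuclideanSpace ℝ (Fin db)) s,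
          ((0 : EuclideanSpace ℝ (Fin dp)), y) ∈ Metric.ball (0 : EuclideanSpace ℝ (Fin dp) ×
            EuclideanSpace ℝ (Fin da) × EuclideanSpace ℝ (Fin db)) δ := fun y hy => by
        rw [← Prod.mk_zero_zero, ← ball_prod_same]
        exact ⟨Metric.mem_ball_self hδ, Metric.ball_subset_ball hs.le hy⟩
      have h1 := hinj (h0 y hy) (h0 y' hy') (by
        simp only [map_zero, NormedSpace.exp_zero, Matrix.one_mul]
        exact hyy)
      exact congrArg Prod.snd h1) t
  obtain ⟨a, ha0, hat, hfa, hga⟩ := ENNReal.exists_tendsto_of_tendsto_mul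
    (f := fun r => Measure.map (orbitTangent eh 1 ek) volume
      (tube eh 1 K r) / volume (Metric.ball 0 r))
    (g := fun s : ℝ => η {k : K | ∃ y ∈ Metric.ball 0 s,
      1 * ((k : GL ι ℂ) : Matrix ι ι ℂ) = 1 * NormedSpace.exp (ek y)} /
      volume (Metric.ball 0 s)) hη0 hηt htA
  obtain ⟨a', ha'0, ha't, hfa', hga'⟩ := ENNReal.exists_tendsto_of_tendsto_mul
    (f := fun r => Measure.map (orbitTangent eh 1 (ek'.coprod (ea.coprod eb))) volume
      (tube eh 1 K r) / volume (Metric.ball 0 r))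
    (g := fun z : ℝ × ℝ => η {k : K | ∃ y ∈ Metric.ball 0 z.1 ×ˢ Metric.ball 0 z.2,
      1 * ((k : GL ι ℂ) : Matrix ι ι ℂ) = 1 * (NormedSpace.exp (ek' y.1) *
        NormedSpace.exp (ea.coprod eb y.2))} /
      (volume.prod (volume.prod volume)) (Metric.ball 0 z.1 ×ˢ Metric.ball 0 z.2)) hη0 hηt htB
  -- Both charts push Lebesgue measure to the same measure on `N`, so the tube has the same limiting
  -- density, and hence so has the Haar measure.
  have haa : a' = a := by
    rw [hmap] at hfa'
    exact tendsto_nhds_unique hfa' hfa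
  rw [haa] at hga'
  set d := η Set.univ / a with hd
  have hd0 : d ≠ 0 := ENNReal.div_ne_zero.2 ⟨hη0, hat⟩
  have hdt : d ≠ ⊤ := ENNReal.div_ne_top hηt ha0
  have hsplit : Tendsto (fun z : ℝ × ℝ =>
      (η' {k : K' | ∃ x ∈ Metric.ball (0 : EuclideanSpace ℝ (Fin dk')) z.1,
        ((k : GL ι ℂ) : Matrix ι ι ℂ) = NormedSpace.exp (ek' x)} /
          volume (Metric.ball (0 : EuclideanSpace ℝ (Fin dk')) z.1)) *
      (η {k : K | ∃ y ∈ Metric.ball 0 z.2, P * ((k : GL ι ℂ) : Matrix ι ι ℂ) =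
        P * NormedSpace.exp (ea.coprod eb y)} / (volume.prod volume)
          (Metric.ball (0 : EuclideanSpace ℝ (Fin da) × EuclideanSpace ℝ (Fin db)) z.2)))
      (𝓝[>] 0 ×ˢ 𝓝[>] 0) (𝓝 (d * η' Set.univ)) := by
    refine (ENNReal.Tendsto.mul_const (b := η' Set.univ) hga' (Or.inr hη't)).congr' ?_
    filter_upwards [prod_mem_prod (Ioo_mem_nhdsGT hδ) (Ioo_mem_nhdsGT hδ)] with z hz
    have h0 : (volume : Measure (EuclideanSpace ℝ (Fin dk'))) (Metric.ball 0 z.1) ≠ 0 :=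
      (Metric.measure_ball_pos _ 0 hz.1.1).ne'
    have ht : (volume : Measure (EuclideanSpace ℝ (Fin dk'))) (Metric.ball 0 z.1) ≠ ⊤ :=
      measure_ball_lt_top.ne
    have h := hfib z.1 z.2 hz.2.2
    rw [Measure.prod_prod, ENNReal.div_eq_inv_mul, mul_assoc, h,
      ENNReal.mul_inv (Or.inl h0) (Or.inl ht), div_eq_mul_inv, div_eq_mul_inv]
    ring
  obtain ⟨d', hd'0, hd't, hfd', hgd'⟩ := ENNReal.exists_tendsto_of_tendsto_mul
    (f := fun t : ℝ => η' {k : K' | ∃ x ∈ Metric.ball (0 : EuclideanSpace ℝ (Fin dk')) t,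
        ((k : GL ι ℂ) : Matrix ι ι ℂ) = NormedSpace.exp (ek' x)} /
          volume (Metric.ball (0 : EuclideanSpace ℝ (Fin dk')) t))
    (g := fun s : ℝ => η {k : K | ∃ y ∈ Metric.ball 0 s, P * ((k : GL ι ℂ) : Matrix ι ι ℂ) =
        P * NormedSpace.exp (ea.coprod eb y)} / (volume.prod volume)
          (Metric.ball (0 : EuclideanSpace ℝ (Fin da) × EuclideanSpace ℝ (Fin db)) s))
    (mul_ne_zero hd0 hη'0) (ENNReal.mul_ne_top hdt hη't) hsplit
  obtain ⟨α, hα0, hαt, hfα, hgα⟩ := ENNReal.exists_tendsto_of_tendsto_mul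
    (f := fun r : ℝ => Measure.map (orbitTangent ep P (ea.coprod eb)) volume
        (tube ep P K r) / volume (Metric.ball (0 : EuclideanSpace ℝ (Fin dp)) r))
    (g := fun s : ℝ => η {k : K | ∃ y ∈ Metric.ball 0 s, P * ((k : GL ι ℂ) : Matrix ι ι ℂ) =
        P * NormedSpace.exp (ea.coprod eb y)} / (volume.prod volume)
          (Metric.ball (0 : EuclideanSpace ℝ (Fin da) × EuclideanSpace ℝ (Fin db)) s))
    hη0 hηt htD
  have hα : η Set.univ / α = d * η' Set.univ / d' := tendsto_nhds_unique hgα hgd'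
  have hval : α = η Set.univ * d' / (d * η' Set.univ) := by
    rw [ENNReal.eq_div_iff (mul_ne_zero hd0 hη'0) (ENNReal.mul_ne_top hdt hη't),
      ← (ENNReal.eq_div_iff hd'0 hd't).1 hα, mul_assoc, ENNReal.div_mul_cancel hα0 hαt, mul_comm]
  refine ⟨d, d', ⟨hd0, hdt⟩, ⟨hd'0, hd't⟩, ?_, hfd', hval ▸ hfα⟩
  simpa only [Matrix.one_mul] using hga

end TubeDensity

/-! ### Relatively invariant measures carried by an orbit -/

section OrbitFormula

variable {G Y : Type*} [Group G] [TopologicalSpace G] [IsTopologicalGroup G]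
  [LocallyCompactSpace G] [SecondCountableTopology G] [MeasurableSpace G] [BorelSpace G]
  [MeasurableSpace Y]

/-- The `w`-weighted measure of the set of all `g` with `act g y ∈ E`. -/
noncomputable def orbitWeight (γ : Measure G) (w : G → ℝ≥0∞) (act : G → Y → Y) (E : Set Y)
    (y : Y) : ℝ≥0∞ :=
  ∫⁻ g, E.indicator 1 (act g y) * w g ∂γ

theorem orbitWeight_eq_setLIntegral (γ : Measure G) (w : G → ℝ≥0∞) {act : G → Y → Y} {y : Y}
    (hact : Measurable fun g => act g y) {E : Set Y} (hE : MeasurableSet E) :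
    orbitWeight γ w act E y = ∫⁻ g in {g | act g y ∈ E}, w g ∂γ := by
  have hS : MeasurableSet {g | act g y ∈ E} := hact hE
  rw [orbitWeight, ← lintegral_indicator hS]
  refine lintegral_congr fun g => ?_
  by_cases hg : g ∈ {g | act g y ∈ E}
  · rw [Set.indicator_of_mem hg, Set.indicator_of_mem (s := E) hg]
    exact one_mul _
  · rw [Set.indicator_of_notMem hg, Set.indicator_of_notMem (s := E) hg, zero_mul]

/-- Moving the base point is a right translation of `g`, which costs the modular function and `w
h⁻¹`. The factor does not depend on `E`, so ratios of orbit weights are constant along an orbit;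
unimodularity of `G` is not needed. -/
theorem orbitWeight_act (γ : Measure G) [γ.IsHaarMeasure] {w : G → ℝ≥0∞} (hw : Measurable w)
    (hwm : ∀ g h, w (g * h) = w g * w h) {act : G → Y → Y}
    (hact : Measurable fun z : G × Y => act z.1 z.2)
    (hmul : ∀ g h y, act (g * h) y = act g (act h y)) (h : G) :
    ∃ a : ℝ≥0∞, ∀ (E : Set Y) (y : Y), MeasurableSet E →
      orbitWeight γ w act E (act h y) = a * orbitWeight γ w act E y := by
  refine ⟨Measure.modularCharacterFun h * w h⁻¹, fun E y hE => ?_⟩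
  have hy : Measurable fun g : G => E.indicator (1 : Y → ℝ≥0∞) (act g y) * w g :=
    ((measurable_one.indicator hE).comp (hact.comp (measurable_id.prodMk measurable_const))).mul hw
  have h1 : orbitWeight γ w act E (act h y) =
      ∫⁻ g, (fun g => E.indicator 1 (act g y) * w g * w h⁻¹) (g * h) ∂γ := by
    refine lintegral_congr fun g => ?_
    simp only [hmul]
    rw [mul_assoc, ← hwm, mul_inv_cancel_right]
  rw [h1, ← lintegral_map (hy.mul_const _) (measurable_mul_const h),
    Measure.map_right_mul_eq_modularCharacterFun_smul, lintegral_smul_measure,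
    lintegral_mul_const _ hy, orbitWeight, ENNReal.smul_def, smul_eq_mul, mul_assoc,
    mul_comm (w h⁻¹)]

/-- A measure which scales by `w` under `act` and is carried by an orbit (up to an equivalence
described by the sets in `Inv`) is a multiple of the `w`-weighted Haar measure on the orbit. -/
theorem exists_measure_eq_mul_orbitWeight (γ : Measure G) [γ.IsHaarMeasure] {w : G → ℝ≥0∞}
    (hw : Measurable w) (hwm : ∀ g h, w (g * h) = w g * w h) {act : G → Y → Y}
    (hact : Measurable fun z : G × Y => act z.1 z.2)
    (hmul : ∀ g h y, act (g * h) y = act g (act h y)) (hone : ∀ y, act 1 y = y)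
    (m : Measure Y) [SFinite m]
    (hscale : ∀ g (F : Y → ℝ≥0∞), Measurable F → ∫⁻ y, F y ∂m = w g * ∫⁻ y, F (act g y) ∂m)
    {Inv : Set Y → Prop} {y₀ : Y}
    (horb : ∀ᵐ y ∂m, ∃ h, ∀ E, Inv E → ∀ g, act g y ∈ E ↔ act g (act h y₀) ∈ E)
    {E₀ : Set Y} (hE₀ : MeasurableSet E₀) (hE₀i : Inv E₀)
    (hI0 : orbitWeight γ w act E₀ y₀ ≠ 0) (hIt : orbitWeight γ w act E₀ y₀ ≠ ⊤)
    (hc0 : γ {g | act g⁻¹ y₀ ∈ E₀} ≠ 0) (hct : γ {g | act g⁻¹ y₀ ∈ E₀} ≠ ⊤) :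
    ∃ C : ℝ≥0∞, ∀ E, MeasurableSet E → Inv E → m E = C * orbitWeight γ w act E y₀ := by
  set I₀ := orbitWeight γ w act E₀ y₀
  set c₀ := γ {g | act g⁻¹ y₀ ∈ E₀}
  -- The constant results from evaluating the double integral of `1_{E₀}(y) 1_E(g y) w(g)` in both
  -- orders; `E₀` is a fixed reference set of finite positive weight.
  refine ⟨(∫⁻ y, E₀.indicator 1 y * orbitWeight γ w act E₀ y ∂m) / I₀ / c₀,
    fun E hE hEi => ?_⟩
  have hm : ∀ (F : Set Y), MeasurableSet F → Measurable (F.indicator (1 : Y → ℝ≥0∞)) :=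
    fun F hF => measurable_one.indicator hF
  have hactg : ∀ g, Measurable (act g) := fun g =>
    hact.comp (measurable_const.prodMk measurable_id)
  have hinv : Measurable fun z : G × Y => act z.1⁻¹ z.2 :=
    hact.comp ((measurable_fst.inv).prodMk measurable_snd)
  have hjoint : Measurable fun z : Y × G => E.indicator (1 : Y → ℝ≥0∞) (act z.2 z.1) * w z.2 :=
    ((hm E hE).comp (hact.comp measurable_swap)).mul (hw.comp measurable_snd)
  have hOm : Measurable fun y => orbitWeight γ w act E₀ y :=
    Measurable.lintegral_prod_right' (f := fun z : Y × G =>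
      E₀.indicator (1 : Y → ℝ≥0∞) (act z.2 z.1) * w z.2)
      (((hm E₀ hE₀).comp (hact.comp measurable_swap)).mul (hw.comp measurable_snd))
  -- both sides of the double integral
  have key : ∫⁻ y, E₀.indicator 1 y * orbitWeight γ w act E y ∂m =
      ∫⁻ y, E.indicator 1 y * γ {g | act g⁻¹ y ∈ E₀} ∂m := by
    have e1 : ∀ y, E₀.indicator (1 : Y → ℝ≥0∞) y * orbitWeight γ w act E y =
        ∫⁻ g, E₀.indicator 1 y * (E.indicator 1 (act g y) * w g) ∂γ := fun y => by
      rw [orbitWeight, lintegral_const_mul]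
      exact hjoint.comp (measurable_const.prodMk measurable_id)
    have e2 : ∀ g, ∫⁻ y, E₀.indicator (1 : Y → ℝ≥0∞) y * (E.indicator 1 (act g y) * w g) ∂m =
        ∫⁻ y, E₀.indicator 1 (act g⁻¹ y) * E.indicator 1 y ∂m := fun g => by
      rw [hscale g (fun y => E₀.indicator 1 (act g⁻¹ y) * E.indicator 1 y)
        (((hm E₀ hE₀).comp (hactg g⁻¹)).mul (hm E hE)), ← lintegral_const_mul]
      · refine lintegral_congr fun y => ?_
        rw [← hmul, inv_mul_cancel, hone, mul_comm (w g), mul_assoc]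
      · simp only [← hmul, inv_mul_cancel, hone]
        exact (hm E₀ hE₀).mul ((hm E hE).comp (hactg g))
    have e3 : ∀ y, ∫⁻ g, E₀.indicator (1 : Y → ℝ≥0∞) (act g⁻¹ y) * E.indicator 1 y ∂γ =
        E.indicator 1 y * γ {g | act g⁻¹ y ∈ E₀} := fun y => by
      have hs : Measurable fun g : G => act g⁻¹ y :=
        hinv.comp (measurable_id.prodMk measurable_const)
      have hf : Measurable fun g => E₀.indicator (1 : Y → ℝ≥0∞) (act g⁻¹ y) :=
        (hm E₀ hE₀).comp hs
      rw [lintegral_mul_const _ hf, mul_comm]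
      congr 1
      exact lintegral_indicator_one (hs hE₀)
    simp only [e1]
    rw [lintegral_lintegral_swap]
    · simp only [e2]
      rw [lintegral_lintegral_swap]
      · simp only [e3]
      · exact (((hm E₀ hE₀).comp hinv).mul ((hm E hE).comp measurable_snd)).aemeasurable
    · exact (((hm E₀ hE₀).comp measurable_fst).mul hjoint).aemeasurable
  -- For almost every `y` the set of `g` is a left translate of the corresponding set for `y₀`, so
  -- its Haar measure is `c₀`.
  have hR : ∫⁻ y, E.indicator 1 y * γ {g | act g⁻¹ y ∈ E₀} ∂m = m E * c₀ := by
    rw [← lintegral_indicator_one hE, ← lintegral_mul_const _ (hm E hE)]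
    refine lintegral_congr_ae ?_
    filter_upwards [horb] with y hy
    obtain ⟨h, hh⟩ := hy
    congr 1
    have : {g : G | act g⁻¹ y ∈ E₀} = (fun g => h⁻¹ * g) ⁻¹' {g | act g⁻¹ y₀ ∈ E₀} := by
      ext g
      change act g⁻¹ y ∈ E₀ ↔ act (h⁻¹ * g)⁻¹ y₀ ∈ E₀
      rw [hh E₀ hE₀i, ← hmul, _root_.mul_inv_rev, inv_inv]
    rw [this, measure_preimage_mul]
  -- Pointwise almost everywhere, the weights of `E` and `E₀` seen from `y` are those seen from `y₀`
  -- times one common factor.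
  have hL : (∫⁻ y, E₀.indicator 1 y * orbitWeight γ w act E y ∂m) * I₀ =
      (∫⁻ y, E₀.indicator 1 y * orbitWeight γ w act E₀ y ∂m) * orbitWeight γ w act E y₀ := by
    have hf1 : Measurable fun y => E₀.indicator (1 : Y → ℝ≥0∞) y * orbitWeight γ w act E y :=
      (hm E₀ hE₀).mul (Measurable.lintegral_prod_right' hjoint)
    have hf2 : Measurable fun y => E₀.indicator (1 : Y → ℝ≥0∞) y * orbitWeight γ w act E₀ y :=
      (hm E₀ hE₀).mul hOm
    rw [← lintegral_mul_const _ hf1, ← lintegral_mul_const _ hf2]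
    refine lintegral_congr_ae ?_
    filter_upwards [horb] with y hy
    obtain ⟨h, hh⟩ := hy
    obtain ⟨a, ha⟩ := orbitWeight_act γ hw hwm hact hmul h
    have hE' : ∀ F, Inv F → orbitWeight γ w act F y = orbitWeight γ w act F (act h y₀) :=
      fun F hF => lintegral_congr fun g => by
        congr 1
        by_cases hg : act g y ∈ F
        · rw [Set.indicator_of_mem hg, Set.indicator_of_mem ((hh F hF g).1 hg)]
          rfl
        · rw [Set.indicator_of_notMem hg, Set.indicator_of_notMem fun h => hg ((hh F hF g).2 h)]
    rw [hE' E hEi, hE' E₀ hE₀i, ha E y₀ hE, ha E₀ y₀ hE₀]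
    ring
  rw [key, hR] at hL
  have hcI : (c₀ * I₀) * (c₀ * I₀)⁻¹ = 1 :=
    ENNReal.mul_inv_cancel (mul_ne_zero hc0 hI0) (ENNReal.mul_ne_top hct hIt)
  calc m E = m E * c₀ * I₀ * (c₀ * I₀)⁻¹ := by rw [mul_assoc (m E), mul_assoc, hcI, mul_one]
    _ = _ := by
      rw [hL, ENNReal.mul_inv (Or.inl hc0) (Or.inl hct), div_eq_mul_inv, div_eq_mul_inv]
      ring

end OrbitFormula

/-! ### Polar decomposition in a bimodule and the Jacobian of left multiplication -/

section PolarDecomposition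

attribute [local instance] Matrix.frobeniusNormedAddCommGroup Matrix.frobeniusNormedSpace
  Matrix.frobeniusNormedRing Matrix.frobeniusNormedAlgebra Matrix.borelSpace_frobenius

variable {ι κ : Type} [Fintype ι] [DecidableEq ι] [Fintype κ] [DecidableEq κ]

/-- Left multiplication by `a` is injective on the finite-dimensional space `A`, hence surjective,
so it reaches `1`. -/
theorem StarSubalgebra.exists_inverse_mem_matrix (A : StarSubalgebra ℝ (Matrix κ κ ℂ))
    {a : Matrix κ κ ℂ} (ha : a ∈ A) (hdet : a.det ≠ 0) : ∃ b ∈ A, a * b = 1 ∧ b * a = 1 := by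
  let p : Submodule ℝ (Matrix κ κ ℂ) := Subalgebra.toSubmodule A.toSubalgebra
  let φ : p →ₗ[ℝ] p :=
    { toFun := fun b => ⟨a * b.1, A.mul_mem ha b.2⟩
      map_add' := fun b c => Subtype.ext (Matrix.mul_add a b.1 c.1)
      map_smul' := fun t b => Subtype.ext (Matrix.mul_smul a t b.1) }
  have hu : IsUnit a := (Matrix.isUnit_iff_isUnit_det a).2 (isUnit_iff_ne_zero.2 hdet)
  have hinj : Function.Injective φ := fun b c h =>
    Subtype.ext (hu.mul_left_cancel (congrArg Subtype.val h))
  obtain ⟨b, hb⟩ := (LinearMap.injective_iff_surjective.1 hinj) ⟨1, A.one_mem⟩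
  have h1 : a * b.1 = 1 := congrArg Subtype.val hb
  exact ⟨b, b.2, h1, mul_eq_one_comm.1 h1⟩

/-- Decomposition `M = h * P * k` into an invertible element of `A`, the coisometry `P`, and a
unitary element of `N`. -/
theorem MatrixBimodule.exists_polar (B : MatrixBimodule κ ι) {P M : Matrix κ ι ℂ} (hPX : P ∈ B.X)
    (hP : P * Pᴴ = 1) (hM : M ∈ B.X) (hdet : (M * Pᴴ).det ≠ 0) :
    ∃ h ∈ B.A, h.det ≠ 0 ∧ ∃ k ∈ B.N, k * kᴴ = 1 ∧ M = h * P * k := by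
  have hM1 : M * Pᴴ ∈ B.A := B.mul_conjTranspose_mem hM hPX
  obtain ⟨m, hm, hm1, hm2⟩ := B.A.exists_inverse_mem_matrix hM1 hdet
  -- After multiplication by the inverse of `M Pᴴ` the matrix becomes `P + Y` with `Y` orthogonal to
  -- `P`; it remains to decompose `P + Y`.
  set Y := m * M - P with hY
  have hYX : Y ∈ B.X := B.X.sub_mem (B.mul_mem_left hm hM) hPX
  have hYP : Y * Pᴴ = 0 := by
    rw [hY, Matrix.sub_mul, hP, Matrix.mul_assoc, hm2, sub_self]
  have hPY : P * Yᴴ = 0 := by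
    have := congrArg conjTranspose hYP
    rwa [conjTranspose_mul, conjTranspose_conjTranspose, conjTranspose_zero] at this
  have hMY : M = M * Pᴴ * (P + Y) := by
    rw [hY, add_sub_cancel, ← Matrix.mul_assoc, hm1, Matrix.one_mul]
  clear_value Y
  have hPP : Pᴴ * P ∈ B.N := B.conjTranspose_mul_mem hPX hPX
  have hFs : (Pᴴ * P)ᴴ = Pᴴ * P := by rw [conjTranspose_mul, conjTranspose_conjTranspose]
  have hPF := mul_proj hP
  have hFP := proj_mul_conjTranspose hP
  -- The skew off-diagonal element with `P (1 + W) = P + Y`. The unitary factor is that of the polar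
  -- decomposition of `1 + W`, with positive part the square root `R` of `1 + W Wᴴ`.
  set W := Pᴴ * Y - Yᴴ * P with hW
  have hWN : W ∈ B.N := B.N.sub_mem (B.conjTranspose_mul_mem hPX hYX)
    (B.conjTranspose_mul_mem hYX hPX)
  have hWs : Wᴴ = -W := by
    rw [hW, conjTranspose_sub, conjTranspose_mul, conjTranspose_mul, conjTranspose_conjTranspose,
      conjTranspose_conjTranspose, neg_sub]
  have hPW : P * W = Y := by
    rw [hW, Matrix.mul_sub, ← Matrix.mul_assoc, hP, Matrix.one_mul, ← Matrix.mul_assoc, hPY,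
      Matrix.zero_mul, sub_zero]
  have hWW : W * W = -(Pᴴ * (Y * Yᴴ) * P) - Yᴴ * Y := by
    conv_lhs => rw [hW]
    rw [Matrix.mul_sub, Matrix.sub_mul, Matrix.sub_mul]
    have e1 : Pᴴ * Y * (Pᴴ * Y) = 0 := by
      rw [Matrix.mul_assoc, ← Matrix.mul_assoc Y, hYP, Matrix.zero_mul, Matrix.mul_zero]
    have e2 : Yᴴ * P * (Pᴴ * Y) = Yᴴ * Y := by
      rw [Matrix.mul_assoc, ← Matrix.mul_assoc P, hP, Matrix.one_mul]
    have e3 : Yᴴ * P * (Yᴴ * P) = 0 := by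
      rw [Matrix.mul_assoc, ← Matrix.mul_assoc P, hPY, Matrix.zero_mul, Matrix.mul_zero]
    have e4 : Pᴴ * Y * (Yᴴ * P) = Pᴴ * (Y * Yᴴ) * P := by simp only [Matrix.mul_assoc]
    rw [e1, e2, e3, e4]
    abel
  -- The square of an off-diagonal element is block diagonal, so `R` will commute with `Pᴴ P`. This
  -- allows `P R = (P R Pᴴ) P`, which moves `R` to the left of `P`.
  have hFWW : Pᴴ * P * (W * W) = W * W * (Pᴴ * P) := by
    have e1 : Pᴴ * P * (Pᴴ * (Y * Yᴴ) * P) = Pᴴ * (Y * Yᴴ) * P := by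
      rw [← Matrix.mul_assoc, ← Matrix.mul_assoc, hFP]
    have e2 : Pᴴ * P * (Yᴴ * Y) = 0 := by
      rw [Matrix.mul_assoc, ← Matrix.mul_assoc P, hPY, Matrix.zero_mul, Matrix.mul_zero]
    have e3 : Pᴴ * (Y * Yᴴ) * P * (Pᴴ * P) = Pᴴ * (Y * Yᴴ) * P := by
      rw [Matrix.mul_assoc, hPF]
    have e4 : Yᴴ * Y * (Pᴴ * P) = 0 := by
      rw [Matrix.mul_assoc, ← Matrix.mul_assoc Y, hYP, Matrix.zero_mul, Matrix.mul_zero]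
    rw [hWW, Matrix.mul_sub, Matrix.sub_mul, Matrix.mul_neg, Matrix.neg_mul, e1, e2, e3, e4]
  clear_value W
  have hD : (1 + W) * (1 + W)ᴴ = 1 + W * Wᴴ := by
    rw [conjTranspose_add, conjTranspose_one, hWs]
    noncomm_ring
  have hDpos : (1 + W * Wᴴ).PosDef :=
    PosDef.one.add_posSemidef (posSemidef_self_mul_conjTranspose W)
  have hDN : 1 + W * Wᴴ ∈ B.N := by
    rw [hWs]
    exact B.N.add_mem B.N.one_mem (B.N.mul_mem hWN (B.N.neg_mem hWN))
  have hDF : Commute (Pᴴ * P) (1 + W * Wᴴ) := by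
    rw [hWs, Matrix.mul_neg]
    exact (Commute.one_right _).add_right (Commute.neg_right hFWW)
  generalize 1 + W * Wᴴ = D at hD hDpos hDN hDF
  obtain ⟨q, hq⟩ := hDpos.exists_polynomial_mul_self
  have hRs := conjTranspose_aeval_of_isHermitian hDpos.1 q
  have hRN : Polynomial.aeval D q ∈ B.N := by
    have h : Polynomial.aeval D q ∈ B.N.toSubalgebra :=
      (Algebra.adjoin_le (S := B.N.toSubalgebra) (by simpa using hDN))
        (Polynomial.aeval_mem_adjoin_singleton ℝ D)
    exact h
  have hRF : Pᴴ * P * Polynomial.aeval D q = Polynomial.aeval D q * (Pᴴ * P) :=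
    have h : Polynomial.aeval D q ∈ Subalgebra.centralizer ℝ {Pᴴ * P} :=
      (Algebra.adjoin_le (S := Subalgebra.centralizer ℝ {Pᴴ * P}) (by
        rintro x rfl
        exact (Subalgebra.mem_centralizer_iff ℝ).2 fun g hg => hg ▸ hDF))
        (Polynomial.aeval_mem_adjoin_singleton ℝ D)
    (Subalgebra.mem_centralizer_iff ℝ).1 h _ rfl
  have hRdet : (Polynomial.aeval D q).det ≠ 0 := fun h0 => by
    have := congrArg det hq
    rw [det_mul, h0, zero_mul] at this
    exact hDpos.det_pos.ne this
  generalize Polynomial.aeval D q = R at hq hRs hRN hRF hRdet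
  obtain ⟨S, hS, hRS, hSR⟩ := B.N.exists_inverse_mem_matrix hRN hRdet
  have hSs : Sᴴ = S := by
    have h1 : R * Sᴴ = 1 := by
      have := congrArg conjTranspose hSR
      rwa [conjTranspose_mul, hRs, conjTranspose_one] at this
    calc Sᴴ = S * R * Sᴴ := by rw [hSR, Matrix.one_mul]
      _ = S := by rw [Matrix.mul_assoc, h1, Matrix.mul_one]
  refine ⟨M * Pᴴ * (P * R * Pᴴ), B.A.mul_mem hM1
    (B.mul_conjTranspose_mem (B.mul_mem_right hPX hRN) hPX), ?_, S * (1 + W),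
    B.N.mul_mem hS (B.N.add_mem B.N.one_mem hWN), ?_, ?_⟩
  · have h1 : P * R * Pᴴ * (P * S * Pᴴ) = 1 := by
      calc P * R * Pᴴ * (P * S * Pᴴ) = P * (R * (Pᴴ * P)) * S * Pᴴ := by
            simp only [Matrix.mul_assoc]
        _ = P * (Pᴴ * P) * (R * S) * Pᴴ := by rw [← hRF]; simp only [Matrix.mul_assoc]
        _ = 1 := by rw [hRS, Matrix.mul_one, hPF, hP]
    rw [det_mul]
    refine mul_ne_zero hdet fun h0 => ?_
    have := congrArg det h1
    rw [det_mul, h0, zero_mul, det_one] at this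
    exact zero_ne_one this
  · rw [conjTranspose_mul, hSs, Matrix.mul_assoc, ← Matrix.mul_assoc (1 + W), hD, ← hq,
      Matrix.mul_assoc R, hRS, Matrix.mul_one, hSR]
  · have h1 : P + Y = P * R * Pᴴ * P * (S * (1 + W)) := by
      calc P + Y = P * (1 + W) := by rw [Matrix.mul_add, Matrix.mul_one, hPW]
        _ = P * (R * S) * (1 + W) := by rw [hRS, Matrix.mul_one]
        _ = P * (Pᴴ * P * R) * (S * (1 + W)) := by
            rw [← Matrix.mul_assoc P (Pᴴ * P), hPF]; simp only [Matrix.mul_assoc]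
        _ = _ := by rw [hRF]; simp only [Matrix.mul_assoc]
    conv_lhs => rw [hMY, h1]
    simp only [Matrix.mul_assoc]

variable {D : Type*} [NormedAddCommGroup D] [NormedSpace ℝ D] [FiniteDimensional ℝ D]
  [MeasurableSpace D] [BorelSpace D]

theorem ae_det_mul_conjTranspose_ne_zero {P : Matrix κ ι ℂ} (hP : P * Pᴴ = 1) (μ : Measure D)
    [μ.IsAddHaarMeasure] {Λ : D →ₗ[ℝ] Matrix κ ι ℂ} (hPΛ : P ∈ LinearMap.range Λ) :
    ∀ᵐ z ∂μ, (Λ z * Pᴴ).det ≠ 0 := by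
  obtain ⟨z₀, hz₀⟩ := hPΛ
  have hc : Continuous fun z => (Λ z * Pᴴ).det :=
    ((LinearMap.continuous_of_finiteDimensional Λ).matrix_mul continuous_const).matrix_det
  have hopen : MeasurableSet {z | (Λ z * Pᴴ).det ≠ 0} :=
    (hc.measurable (measurableSet_singleton 0)).compl
  refine ae_mem_of_ae_add_linearMap_mem (LinearMap.toSpanSingleton ℝ D z₀) volume μ hopen
    fun y => ?_
  -- On a line in the direction `P` the determinant is `det (Λ y Pᴴ + t)`, a characteristic
  -- polynomial in `t`, so every such line meets the zero set in finitely many points.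
  have hfin : {t : ℂ | (-(Λ y * Pᴴ)).charpoly.IsRoot t}.Finite :=
    Polynomial.finite_setOfPred_isRoot (charpoly_monic _).ne_zero
  have hfin' := hfin.preimage (Complex.ofReal_injective.injOn)
  refine measure_mono_null (fun t ht => ?_) (hfin'.measure_zero volume)
  have h0 : (Λ (y + t • z₀) * Pᴴ).det = 0 := not_not.1 ht
  change (-(Λ y * Pᴴ)).charpoly.eval (t : ℂ) = 0
  rw [Matrix.eval_charpoly, ← h0, map_add, map_smul, hz₀, Matrix.add_mul, Matrix.smul_mul, hP]
  congr 1
  ext i j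
  simp [Matrix.one_apply, Matrix.scalar_apply, Matrix.diagonal_apply]
  exact add_comm _ _

theorem lintegral_map_eq_mul_lintegral (μ : Measure D) [μ.IsAddHaarMeasure]
    {W : Type*} [NormedAddCommGroup W] [NormedSpace ℝ W] [MeasurableSpace W] [BorelSpace W]
    {Λ : D →ₗ[ℝ] W} {L : W → W} (hL : Measurable L) {φ : D →ₗ[ℝ] D} (h : ∀ z, Λ (φ z) = L (Λ z))
    (hφ : LinearMap.det φ ≠ 0) {F : W → ℝ≥0∞} (hF : Measurable F) :
    ∫⁻ M, F M ∂(μ.map Λ) = ENNReal.ofReal |LinearMap.det φ| * ∫⁻ M, F (L M) ∂(μ.map Λ) := by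
  have hΛ : Measurable Λ := (LinearMap.continuous_of_finiteDimensional Λ).measurable
  have hφm : Measurable φ := (LinearMap.continuous_of_finiteDimensional φ).measurable
  have hFL : Measurable fun M => F (L M) := hF.comp hL
  have hFΛ : Measurable fun z => F (Λ z) := hF.comp hΛ
  rw [lintegral_map hF hΛ, lintegral_map hFL hΛ]
  simp only [← h]
  rw [← lintegral_map hFΛ hφm, Measure.map_linearMap_addHaar_eq_smul_addHaar _ hφ,
    lintegral_smul_measure, smul_eq_mul, ← mul_assoc, ← ENNReal.ofReal_mul (abs_nonneg _),
    ← abs_mul, mul_inv_cancel₀ hφ, abs_one, ENNReal.ofReal_one, one_mul]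

/-- Each column contributes one factor `det g`; the real determinant of a complex linear map is the
norm square of its complex determinant. -/
theorem det_mulLeft_matrix (g : Matrix κ κ ℂ) :
    |LinearMap.det ((mulLeftLinearMap ι ℂ g).restrictScalars ℝ)| =
      ‖g.det‖ ^ (2 * Fintype.card ι) := by
  have h1 : LinearMap.det (mulLeftLinearMap ι ℂ g) = g.det ^ Fintype.card ι := by
    have h := LinearMap.det_pi (ι := ι) fun _ => Matrix.toLin' g
    simp only [LinearMap.det_toLin', Finset.prod_const, Finset.card_univ] at h
    rw [← h, ← LinearMap.det_conj _ (Matrix.transposeLinearEquiv κ ι ℂ ℂ)]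
    congr 1
  rw [LinearMap.det_restrictScalars, h1, Algebra.norm_complex_eq]
  simp [Complex.normSq_eq_norm_sq, pow_mul']

end PolarDecomposition

/-! ### From invariant sets to integrals of invariant functions -/

section InvariantSets

variable {Y R : Type*} [mY : MeasurableSpace Y]

/-- The measurable sets which are stable under a family of transformations. -/
@[reducible]
def invariantSpace (r : R → Y → Y) : MeasurableSpace Y where
  MeasurableSet' E := MeasurableSet E ∧ ∀ k y, r k y ∈ E ↔ y ∈ E
  measurableSet_empty := ⟨MeasurableSet.empty, fun _ _ => Iff.rfl⟩
  measurableSet_compl := fun _ hE => ⟨hE.1.compl, fun k y => not_congr (hE.2 k y)⟩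
  measurableSet_iUnion := fun f hf => ⟨MeasurableSet.iUnion fun i => (hf i).1, fun k y => by
    simp only [Set.mem_iUnion, (hf _).2 k y]⟩

theorem invariantSpace_le (r : R → Y → Y) : invariantSpace r ≤ mY := fun _ hE => hE.1

theorem measurable_invariantSpace {r : R → Y → Y} {Z : Type*} [MeasurableSpace Z] {F : Y → Z}
    (hF : Measurable F) (hi : ∀ k y, F (r k y) = F y) : Measurable[invariantSpace r] F :=
  fun S hS => ⟨hF hS, fun k y => by simp only [Set.mem_preimage, hi]⟩

/-- Integrals of invariant functions over two measures which agree on invariant sets. -/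
theorem integral_eq_of_measure_eq_of_invariant {r : R → Y → Y} {m m' : Measure Y}
    (h : ∀ E, MeasurableSet E → (∀ k y, r k y ∈ E ↔ y ∈ E) → m E = m' E) {F : Y → ℂ}
    (hF : Measurable F) (hi : ∀ k y, F (r k y) = F y) (hint : Integrable F m) :
    Integrable F m' ∧ ∫ y, F y ∂m = ∫ y, F y ∂m' := by
  have hle := invariantSpace_le r
  -- Agreement on invariant sets is equality after restriction to the invariant σ-algebra, for which
  -- the function `F` is already measurable.
  have htrim : m.trim hle = m'.trim hle := by
    refine @Measure.ext _ (invariantSpace r) _ _ fun E hE => ?_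
    rw [trim_measurableSet_eq hle hE, trim_measurableSet_eq hle hE]
    exact h E hE.1 hE.2
  have hFs : StronglyMeasurable[invariantSpace r] F :=
    (measurable_invariantSpace hF hi).stronglyMeasurable
  have h1 := hint.trim hle hFs
  rw [htrim] at h1
  refine ⟨integrable_of_integrable_trim hle h1, ?_⟩
  rw [integral_trim hle hFs, integral_trim hle hFs, htrim]

variable {G : Type*} [Group G] [TopologicalSpace G] [IsTopologicalGroup G]
  [LocallyCompactSpace G] [SecondCountableTopology G] [MeasurableSpace G] [BorelSpace G]

theorem integral_eq_mul_integral_orbit {γ : Measure G} {w : G → ℝ≥0∞} (hw : Measurable w)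
    (hwt : ∀ g, w g ≠ ⊤) {act : G → Y → Y} {y₀ : Y} (hact : Measurable fun g => act g y₀)
    {r : R → Y → Y} {m : Measure Y} {C : ℝ≥0∞} (hC0 : C ≠ 0) (hCt : C ≠ ⊤)
    (h : ∀ E, MeasurableSet E → (∀ k y, r k y ∈ E ↔ y ∈ E) → m E = C * orbitWeight γ w act E y₀)
    {F : Y → ℂ} (hF : Measurable F) (hi : ∀ k y, F (r k y) = F y) (hint : Integrable F m) :
    Integrable (fun g => F (act g y₀) * ((w g).toReal : ℂ)) γ ∧
      ∫ y, F y ∂m = C.toReal * ∫ g, F (act g y₀) * ((w g).toReal : ℂ) ∂γ := by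
  have h' : ∀ E, MeasurableSet E → (∀ k y, r k y ∈ E ↔ y ∈ E) →
      m E = (C • (γ.withDensity w).map fun g => act g y₀) E := fun E hE hEi => by
    rw [h E hE hEi, Measure.smul_apply, Measure.map_apply hact hE, smul_eq_mul,
      orbitWeight_eq_setLIntegral γ w hact hE, withDensity_apply _ (hact hE)]
    rfl
  obtain ⟨h1, h2⟩ := integral_eq_of_measure_eq_of_invariant h' hF hi hint
  have hwf : ∀ᵐ g ∂γ, w g < ⊤ := Eventually.of_forall fun g => (hwt g).lt_top
  have h3 : Integrable F ((γ.withDensity w).map fun g => act g y₀) := by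
    have := h1.smul_measure (c := C⁻¹) (ENNReal.inv_ne_top.2 hC0)
    rwa [smul_smul, ENNReal.inv_mul_cancel hC0 hCt, one_smul] at this
  have h4 := (integrable_map_measure hF.aestronglyMeasurable hact.aemeasurable).1 h3
  have h5 := (integrable_withDensity_iff_integrable_smul' hw hwf).1 h4
  refine ⟨h5.congr (Eventually.of_forall fun g => ?_), ?_⟩
  · simp only [Function.comp_apply, Complex.real_smul, mul_comm]
  · rw [h2, integral_smul_measure, integral_map hact.aemeasurable hF.aestronglyMeasurable,
      integral_withDensity_eq_integral_toReal_smul hw hwf, Complex.real_smul]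
    congr 1
    refine integral_congr_ae (Eventually.of_forall fun g => ?_)
    simp only [Complex.real_smul, mul_comm]

end InvariantSets

/-! ### Lebesgue measure on `X` as a weighted Haar measure -/

section MatrixOrbit

open scoped Pointwise

attribute [local instance] Matrix.frobeniusNormedAddCommGroup Matrix.frobeniusNormedSpace
  Matrix.frobeniusNormedRing Matrix.frobeniusNormedAlgebra Matrix.borelSpace_frobenius

variable {ι κ : Type} [Fintype ι] [DecidableEq ι] [Fintype κ] [DecidableEq κ]

/-- The group of invertible elements of a matrix `*`-algebra. -/
def IsUnitGroupOf (G : Subgroup (GL κ ℂ)) (A : StarSubalgebra ℝ (Matrix κ κ ℂ)) : Prop :=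
  ∀ g : GL κ ℂ, g ∈ G ↔ (g : Matrix κ κ ℂ) ∈ A

/-- The weight `|det g| ^ N`. -/
noncomputable def detWeight (G : Subgroup (GL κ ℂ)) (N : ℕ) (g : G) : ℝ≥0∞ :=
  ‖((g : GL κ ℂ) : Matrix κ κ ℂ).det‖ₑ ^ N

variable {G : Subgroup (GL κ ℂ)} {N : ℕ}

theorem continuous_detWeight : Continuous (detWeight G N) :=
  (ENNReal.continuous_pow N).comp (continuous_enorm.comp (continuous_val_subgroup G).matrix_det)

theorem detWeight_mul (g h : G) : detWeight G N (g * h) = detWeight G N g * detWeight G N h := by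
  simp only [detWeight, Subgroup.coe_mul, Units.val_mul, det_mul, enorm_mul, mul_pow]

theorem detWeight_ne_top (g : G) : detWeight G N g ≠ ⊤ := ENNReal.pow_ne_top enorm_ne_top

theorem det_val_ne_zero (g : GL κ ℂ) : (g : Matrix κ κ ℂ).det ≠ 0 :=
  ((Matrix.isUnit_iff_isUnit_det _).1 g.isUnit).ne_zero

theorem detWeight_ne_zero (g : G) : detWeight G N g ≠ 0 :=
  pow_ne_zero _ (enorm_ne_zero.2 (det_val_ne_zero _))

theorem toReal_detWeight (g : G) :
    (detWeight G N g).toReal = ‖((g : GL κ ℂ) : Matrix κ κ ℂ).det‖ ^ N := by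
  rw [detWeight, ENNReal.toReal_pow, toReal_enorm]

theorem IsUnitGroupOf.isClosed {A : StarSubalgebra ℝ (Matrix κ κ ℂ)} (hG : IsUnitGroupOf G A) :
    IsClosed (G : Set (GL κ ℂ)) := by
  have h : (G : Set (GL κ ℂ)) = Units.val ⁻¹' (A : Set (Matrix κ κ ℂ)) := Set.ext fun g => hG g
  rw [h]
  exact A.isClosed_matrix.preimage Units.continuous_val

theorem isCompact_unitary_subgroup (hcl : IsClosed (G : Set (GL κ ℂ))) :
    IsCompact {g : G | ((g : GL κ ℂ) : Matrix κ κ ℂ) * ((g : GL κ ℂ) : Matrix κ κ ℂ)ᴴ = 1} := by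
  have hu : ∀ k ∈ G ⊓ unitaryGL κ, (k : Matrix κ κ ℂ) * (k : Matrix κ κ ℂ)ᴴ = 1 := fun k hk =>
    (Unitary.mem_iff.1 hk.2).2
  have := compactSpace_of_isClosed_of_unitary (hcl.inter isClosed_unitaryGL) hu
  have hc : Continuous (Subgroup.inclusion (inf_le_left : G ⊓ unitaryGL κ ≤ G)) :=
    continuous_subtype_val.subtype_mk _
  convert isCompact_range hc using 1
  ext g
  constructor
  · intro hg
    exact ⟨⟨g, g.2, Matrix.mem_unitaryGroup_iff.2 hg⟩, rfl⟩
  · rintro ⟨k, rfl⟩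
    exact hu k k.2

theorem mul_conjTranspose_eq_one_of_mul_eq {P : Matrix κ ι ℂ} (hP : P * Pᴴ = 1)
    {u : Matrix κ κ ℂ} {k : Matrix ι ι ℂ} (h : u * P = P * k) (hk : k * kᴴ = 1) : u * uᴴ = 1 := by
  calc u * uᴴ = u * P * (u * P)ᴴ := by
        rw [conjTranspose_mul, Matrix.mul_assoc, ← Matrix.mul_assoc P, hP, Matrix.one_mul]
    _ = 1 := by
        rw [h, conjTranspose_mul, Matrix.mul_assoc, ← Matrix.mul_assoc k, hk, Matrix.one_mul, hP]

variable {D : Type*} [NormedAddCommGroup D] [NormedSpace ℝ D] [FiniteDimensional ℝ D]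
  [MeasurableSpace D] [BorelSpace D]

/-- On sets which are stable under right multiplication by unitary elements of `N`, the image of
a Haar measure on `X` is a weighted Haar measure of `G`. -/
theorem exists_measure_eq_mul_detWeight (B : MatrixBimodule κ ι) (hG : IsUnitGroupOf G B.A)
    [LocallyCompactSpace G] {K : Subgroup (GL ι ℂ)} (hK : IsUnitaryGroupOf K B.N) [CompactSpace K]
    {P : Matrix κ ι ℂ} (hPX : P ∈ B.X) (hP : P * Pᴴ = 1) (μ : Measure D) [μ.IsAddHaarMeasure]
    {Λ : D →ₗ[ℝ] Matrix κ ι ℂ} (hΛi : Function.Injective Λ) (hΛr : LinearMap.range Λ = B.X)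
    (hdet : ∀ g ∈ B.A, ∀ φ : D →ₗ[ℝ] D, (∀ z, Λ (φ z) = g * Λ z) →
      |LinearMap.det φ| = ‖g.det‖ ^ N) (γ : Measure G) [γ.IsHaarMeasure] :
    ∃ C : ℝ≥0∞, ∀ E : Set (Matrix κ ι ℂ), MeasurableSet E →
      (∀ (k : K) (M : Matrix κ ι ℂ), M * ((k : GL ι ℂ) : Matrix ι ι ℂ) ∈ E ↔ M ∈ E) →
      μ.map Λ E = C * orbitWeight γ (detWeight G N)
        (fun g M => ((g : GL κ ℂ) : Matrix κ κ ℂ) * M) E P := by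
  have hact : Continuous fun z : G × Matrix κ ι ℂ => ((z.1 : GL κ ℂ) : Matrix κ κ ℂ) * z.2 :=
    ((continuous_val_subgroup G).comp continuous_fst).matrix_mul continuous_snd
  have hactP : Continuous fun g : G => ((g : GL κ ℂ) : Matrix κ κ ℂ) * P :=
    (continuous_val_subgroup G).matrix_mul continuous_const
  have hΛc : Continuous Λ := LinearMap.continuous_of_finiteDimensional Λ
  have hPΛ : P ∈ LinearMap.range Λ := hΛr ▸ hPX
  obtain ⟨Q, hQ, hQ1⟩ := exists_compact_mem_nhds (1 : G)
  -- The reference set is `Q P K` for a compact neighbourhood `Q` of `1` in `G`. The `g` with `g P ∈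
  -- E₀` form a set between `Q` and the compact set `Q U`, where `U` consists of the unitary
  -- elements, which gives the positivity and finiteness required below.
  set E₀ : Set (Matrix κ ι ℂ) := (fun z : G × K => ((z.1 : GL κ ℂ) : Matrix κ κ ℂ) * P *
    ((z.2 : GL ι ℂ) : Matrix ι ι ℂ)) '' (Q ×ˢ Set.univ) with hE₀
  have hE₀c : IsCompact E₀ := (hQ.prod isCompact_univ).image
    ((hactP.comp continuous_fst).matrix_mul ((continuous_val_subgroup K).comp continuous_snd))
  have hE₀m : MeasurableSet E₀ := hE₀c.isClosed.measurableSet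
  set U : Set G := {g : G | ((g : GL κ ℂ) : Matrix κ κ ℂ) * ((g : GL κ ℂ) : Matrix κ κ ℂ)ᴴ = 1}
  have hQU : IsCompact (Q * U) := hQ.mul (isCompact_unitary_subgroup hG.isClosed)
  set S : Set G := {g : G | ((g : GL κ ℂ) : Matrix κ κ ℂ) * P ∈ E₀} with hS
  have hQS : Q ⊆ S := fun g hg => ⟨(g, 1), ⟨hg, trivial⟩, by
    simp only [Subgroup.coe_one, Units.val_one, Matrix.mul_one]⟩
  have hSQ : S ⊆ Q * U := by
    rintro g ⟨⟨q, k⟩, ⟨hq, -⟩, hqk⟩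
    refine Set.mem_mul.2 ⟨q, hq, q⁻¹ * g, ?_, mul_inv_cancel_left q g⟩
    have hk := ((hK _).1 k.2).2
    have h1 : (((q⁻¹ * g : G) : GL κ ℂ) : Matrix κ κ ℂ) * P =
        P * ((k : GL ι ℂ) : Matrix ι ι ℂ) := by
      have h2 : ((q : GL κ ℂ) : Matrix κ κ ℂ) * P * ((k : GL ι ℂ) : Matrix ι ι ℂ) =
        ((g : GL κ ℂ) : Matrix κ κ ℂ) * P := hqk
      have h3 : (((q⁻¹ * g : G) : GL κ ℂ) : Matrix κ κ ℂ) =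
          (((q : GL κ ℂ)⁻¹ : GL κ ℂ) : Matrix κ κ ℂ) * ((g : GL κ ℂ) : Matrix κ κ ℂ) := rfl
      rw [h3, Matrix.mul_assoc, ← h2, Matrix.mul_assoc _ P, ← Matrix.mul_assoc, Units.inv_mul,
        Matrix.one_mul]
    change (((q⁻¹ * g : G) : GL κ ℂ) : Matrix κ κ ℂ) *
      (((q⁻¹ * g : G) : GL κ ℂ) : Matrix κ κ ℂ)ᴴ = 1
    exact mul_conjTranspose_eq_one_of_mul_eq hP h1 hk
  have hSm : MeasurableSet S := hactP.measurable hE₀m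
  have hwm : Measurable (detWeight G N) := continuous_detWeight.measurable
  have hIeq : orbitWeight γ (detWeight G N) (fun g M => ((g : GL κ ℂ) : Matrix κ κ ℂ) * M) E₀ P =
      ∫⁻ g in S, detWeight G N g ∂γ :=
    orbitWeight_eq_setLIntegral γ _ hactP.measurable hE₀m
  refine exists_measure_eq_mul_orbitWeight (Inv := fun E => ∀ (k : K) (M : Matrix κ ι ℂ),
    M * ((k : GL ι ℂ) : Matrix ι ι ℂ) ∈ E ↔ M ∈ E) γ hwm detWeight_mul hact.measurable
    (fun g h M => by rw [Subgroup.coe_mul, Units.val_mul, Matrix.mul_assoc])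
    (fun M => by rw [Subgroup.coe_one, Units.val_one, Matrix.one_mul]) (μ.map Λ) ?_ ?_
    hE₀m ?_ ?_ ?_ ?_ ?_
  · intro g F hF
    obtain ⟨Γ, hΓ⟩ := Λ.exists_leftInverse_of_injective (LinearMap.ker_eq_bot.2 hΛi)
    have hΛΓ : ∀ M ∈ B.X, Λ (Γ M) = M := fun M hM => by
      rw [← hΛr] at hM
      obtain ⟨z, rfl⟩ := hM
      exact congrArg Λ (LinearMap.congr_fun hΓ z)
    have hgA := (hG _).1 g.2
    -- Left multiplication by `g`, read in the chart `Λ`; its determinant gives the scaling factor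
    -- of the measure.
    have hφ : ∀ z, Λ ((Γ ∘ₗ (mulLeftLinearMap ι ℝ ((g : GL κ ℂ) : Matrix κ κ ℂ)) ∘ₗ Λ) z) =
        ((g : GL κ ℂ) : Matrix κ κ ℂ) * Λ z := fun z =>
      hΛΓ _ (B.mul_mem_left hgA (hΛr ▸ LinearMap.mem_range_self Λ z))
    have hd := hdet _ hgA _ hφ
    have hd0 : LinearMap.det (Γ ∘ₗ (mulLeftLinearMap ι ℝ ((g : GL κ ℂ) : Matrix κ κ ℂ)) ∘ₗ Λ) ≠ 0 := by
      intro h0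
      rw [h0, abs_zero] at hd
      exact (pow_ne_zero N (norm_ne_zero_iff.2 (det_val_ne_zero _))).symm hd
    have hL : Measurable fun M : Matrix κ ι ℂ => ((g : GL κ ℂ) : Matrix κ κ ℂ) * M :=
      (continuous_const.matrix_mul continuous_id).measurable
    rw [lintegral_map_eq_mul_lintegral μ hL hφ hd0 hF, hd, ENNReal.ofReal_pow (norm_nonneg _),
      ofReal_norm]
    rfl
  · have h1 : MeasurableSet {M : Matrix κ ι ℂ | (M * Pᴴ).det ≠ 0 ∧ M ∈ B.X} :=
      ((((continuous_id.matrix_mul continuous_const).matrix_det).measurable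
        (measurableSet_singleton 0)).compl).inter (B.X.closed_of_finiteDimensional.measurableSet)
    have h2 : ∀ᵐ M ∂(μ.map Λ), (M * Pᴴ).det ≠ 0 ∧ M ∈ B.X := by
      rw [ae_map_iff hΛc.measurable.aemeasurable h1]
      filter_upwards [ae_det_mul_conjTranspose_ne_zero hP μ hPΛ] with z hz
      exact ⟨hz, hΛr ▸ LinearMap.mem_range_self Λ z⟩
    filter_upwards [h2] with M hM
    obtain ⟨h, hh, hhd, k, hk, hkk, rfl⟩ := B.exists_polar hPX hP hM.2 hM.1
    have hu : IsUnit h := (Matrix.isUnit_iff_isUnit_det h).2 (isUnit_iff_ne_zero.2 hhd)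
    obtain ⟨h, rfl⟩ := hu
    obtain ⟨k, rfl⟩ : ∃ k' : GL ι ℂ, (k' : Matrix ι ι ℂ) = k :=
      ⟨⟨k, kᴴ, hkk, mul_eq_one_comm.1 hkk⟩, rfl⟩
    refine ⟨⟨h, (hG h).2 hh⟩, fun E hE g => ?_⟩
    have hkK : k ∈ K := (hK k).2 ⟨hk, hkk⟩
    rw [← hE ⟨k, hkK⟩ (((g : GL κ ℂ) : Matrix κ κ ℂ) * ((h : Matrix κ κ ℂ) * P)),
      ← Matrix.mul_assoc]
  · rintro k M
    constructor
    · rintro ⟨⟨q, k'⟩, ⟨hq, -⟩, hqk⟩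
      refine ⟨(q, k' * k⁻¹), ⟨hq, trivial⟩, ?_⟩
      have h2 : ((q : GL κ ℂ) : Matrix κ κ ℂ) * P * ((k' : GL ι ℂ) : Matrix ι ι ℂ) =
        M * ((k : GL ι ℂ) : Matrix ι ι ℂ) := hqk
      change ((q : GL κ ℂ) : Matrix κ κ ℂ) * P * (((k' : GL ι ℂ) : Matrix ι ι ℂ) *
        (((k : GL ι ℂ)⁻¹ : GL ι ℂ) : Matrix ι ι ℂ)) = M
      rw [← Matrix.mul_assoc, h2, Matrix.mul_assoc, Units.mul_inv, Matrix.mul_one]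
    · rintro ⟨⟨q, k'⟩, ⟨hq, -⟩, rfl⟩
      refine ⟨(q, k' * k), ⟨hq, trivial⟩, ?_⟩
      simp only [Subgroup.coe_mul, Units.val_mul, Matrix.mul_assoc]
  · rw [hIeq]
    intro h0
    rw [lintegral_eq_zero_iff hwm, Filter.EventuallyEq, ae_restrict_iff' hSm] at h0
    have h1 : γ S = 0 := measure_mono_null (fun g hg => by
      intro hc
      exact detWeight_ne_zero g (hc hg)) h0
    exact (Measure.measure_pos_of_mem_nhds γ (mem_of_superset hQ1 hQS)).ne' h1
  · rw [hIeq]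
    obtain ⟨g₁, -, hg₁⟩ := hQU.exists_isMaxOn ⟨1, Set.mem_mul.2 ⟨1, mem_of_mem_nhds hQ1, 1, by
      change ((1 : GL κ ℂ) : Matrix κ κ ℂ) * ((1 : GL κ ℂ) : Matrix κ κ ℂ)ᴴ = 1
      rw [Units.val_one, conjTranspose_one, Matrix.one_mul], one_mul 1⟩⟩
      (continuous_detWeight (G := G) (N := N)).continuousOn
    refine ne_top_of_le_ne_top (ENNReal.mul_ne_top (detWeight_ne_top g₁ (N := N))
      (hQU.measure_lt_top (μ := γ)).ne) ?_
    calc ∫⁻ g in S, detWeight G N g ∂γ ≤ ∫⁻ g in Q * U, detWeight G N g ∂γ :=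
          lintegral_mono_set hSQ
      _ ≤ ∫⁻ _ in Q * U, detWeight G N g₁ ∂γ :=
          setLIntegral_mono' hQU.measurableSet fun g hg => hg₁ hg
      _ = detWeight G N g₁ * γ (Q * U) := setLIntegral_const _ _
  · have h1 : S⁻¹ ∈ 𝓝 (1 : G) := inv_mem_nhds_one G (mem_of_superset hQ1 hQS)
    exact (Measure.measure_pos_of_mem_nhds γ h1).ne'
  · have h1 : {g : G | (((g⁻¹ : G) : GL κ ℂ) : Matrix κ κ ℂ) * P ∈ E₀} ⊆ (Q * U)⁻¹ :=
      fun g hg => hSQ hg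
    exact ((measure_mono h1).trans_lt (hQU.inv.measure_lt_top (μ := γ))).ne

end MatrixOrbit

/-! ### Euclidean volume of `Hom(ℂⁿ, ℂᵖ)` and the number of off-diagonal directions -/

section EuclideanVolume

attribute [local instance] Matrix.frobeniusNormedAddCommGroup Matrix.frobeniusNormedSpace
  Matrix.frobeniusNormedRing Matrix.frobeniusNormedAlgebra Matrix.borelSpace_frobenius

variable {ι κ κ' : Type} [Fintype ι] [DecidableEq ι] [Fintype κ] [DecidableEq κ]
  [Fintype κ'] [DecidableEq κ']

theorem Matrix.isAddHaarMeasure_frobenius : @Measure.IsAddHaarMeasure (Matrix κ' ι ℂ)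
    Matrix.frobeniusNormedAddCommGroup.toAddCommGroup.toAddGroup
    Matrix.frobeniusNormedAddCommGroup.toPseudoMetricSpace.toUniformSpace.toTopologicalSpace _
    volume :=
  Matrix.isAddHaarMeasure_volume

theorem lintegral_gaussian_matrix :
    ∫⁻ L : Matrix κ' ι ℂ, ENNReal.ofReal (Real.exp (-Real.pi * ‖L‖ ^ 2)) = 1 := by
  have h0 : ∫ z : ℂ, Real.exp (-Real.pi * ‖z‖ ^ 2) = 1 := by
    rw [GaussianFourier.integral_rexp_neg_mul_sq_norm Real.pi_pos, div_self Real.pi_ne_zero,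
      Real.one_rpow]
  have h1 : ∫ L : Matrix κ' ι ℂ, Real.exp (-Real.pi * ‖L‖ ^ 2) = 1 := by
    have h2 : ∀ L : Matrix κ' ι ℂ, Real.exp (-Real.pi * ‖L‖ ^ 2) =
        ∏ i, ∏ j, Real.exp (-Real.pi * ‖L i j‖ ^ 2) := fun L => by
      rw [frobenius_norm_sq, Finset.mul_sum, Real.exp_sum]
      refine Finset.prod_congr rfl fun i _ => ?_
      rw [Finset.mul_sum, Real.exp_sum]
    simp only [h2]
    have h3 : ∫ x : ι → ℂ, ∏ j, Real.exp (-Real.pi * ‖x j‖ ^ 2) = 1 := by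
      rw [volume_pi, integral_fintype_prod_eq_prod (f := fun _ (z : ℂ) => Real.exp (-Real.pi * ‖z‖ ^ 2)), h0,
        Finset.prod_const_one]
    have h4 := integral_fintype_prod_eq_prod (ι := κ') (μ := fun _ => (volume : Measure (ι → ℂ)))
      (f := fun _ (x : ι → ℂ) => ∏ j, Real.exp (-Real.pi * ‖x j‖ ^ 2))
    rw [h3, Finset.prod_const_one] at h4
    exact h4
  have h2 : Integrable fun L : Matrix κ' ι ℂ => Real.exp (-Real.pi * ‖L‖ ^ 2) := by
    by_contra h
    rw [integral_undef h] at h1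
    exact zero_ne_one h1
  rw [← ofReal_integral_eq_lintegral_ofReal h2 (Eventually.of_forall fun x => (Real.exp_pos _).le),
    h1, ENNReal.ofReal_one]

variable {B : MatrixBimodule κ ι} {P : Matrix κ ι ℂ}
variable {c : ℕ} {dp da db : ℕ} {ep : EuclideanSpace ℝ (Fin dp) →ₗ[ℝ] Matrix κ κ ℂ}
  {ea : EuclideanSpace ℝ (Fin da) →ₗ[ℝ] Matrix ι ι ℂ}
  {eb : EuclideanSpace ℝ (Fin db) →ₗ[ℝ] Matrix ι ι ℂ}

/-- Comparison of the Euclidean volume of `Hom(ℂⁿ, ℂᵖ)` with the measure of the parametrization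
`orbitTangent` of `X`. -/
theorem map_volume_eq_smul_map_orbitTangent (hc : c ≠ 0) (hPX : P ∈ B.X) (hP : P * Pᴴ = 1)
    (hp : IsFrame c ep (hermSubmodule B.A)) (ha : IsFrame c ea (cornerSubmodule B.N (Pᴴ * P)))
    (hb : IsFrame c eb (offDiagSubmodule B.N (Pᴴ * P)))
    {ψ : Matrix κ' ι ℂ →ₗ[ℝ] Matrix κ ι ℂ} (hψ : ∀ L, ‖ψ L‖ ^ 2 = c * ‖L‖ ^ 2)
    (hψr : LinearMap.range ψ = B.X) :
    (volume : Measure (Matrix κ' ι ℂ)).map ψ =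
      (ENNReal.ofReal (2 ^ ((db : ℝ) / 2)))⁻¹ •
        Measure.map (orbitTangent ep P (ea.coprod eb)) volume := by
  have hc' : (c : ℝ) ≠ 0 := Nat.cast_ne_zero.2 hc
  have hpos : (0 : ℝ) < 2 ^ ((db : ℝ) / 2) := by positivity
  have h1 := lintegral_exp_orbitTangent hc hP hp ha hb
  have hψi : Function.Injective ψ := injective_of_norm_sq fun L hL => by
    rw [hψ] at hL
    exact norm_eq_zero.1 (pow_eq_zero_iff two_ne_zero |>.1 ((mul_eq_zero.1 hL).resolve_left hc'))
  have h2 : ∫⁻ L, ENNReal.ofReal (Real.exp (-(Real.pi / c) * ‖ψ L‖ ^ 2)) = 1 := by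
    rw [← lintegral_gaussian_matrix (κ' := κ') (ι := ι)]
    refine lintegral_congr fun L => ?_
    rw [hψ]
    congr 2
    field_simp
  have := isAddHaarMeasure_prod (volume : Measure (EuclideanSpace ℝ (Fin da)))
    (volume : Measure (EuclideanSpace ℝ (Fin db)))
  have := isAddHaarMeasure_prod (volume : Measure (EuclideanSpace ℝ (Fin dp)))
    ((volume : Measure (EuclideanSpace ℝ (Fin da))).prod
      (volume : Measure (EuclideanSpace ℝ (Fin db))))
  have h0 : ENNReal.ofReal (2 ^ ((db : ℝ) / 2)) ≠ 0 := (ENNReal.ofReal_pos.2 hpos).ne'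
  have := Matrix.isAddHaarMeasure_frobenius (κ' := κ') (ι := ι)
  exact Measure.map_linear_eq_smul
    ((volume : Measure (EuclideanSpace ℝ (Fin dp))).prod
      ((volume : Measure (EuclideanSpace ℝ (Fin da))).prod
        (volume : Measure (EuclideanSpace ℝ (Fin db)))))
    (volume : Measure (Matrix κ' ι ℂ)) (injective_orbitTangent hc hP hp ha hb) hψi
    ((range_orbitTangent hPX hP hp ha hb).trans hψr.symm)
    (Q := fun M => ENNReal.ofReal (Real.exp (-(Real.pi / c) * ‖M‖ ^ 2)))
    (by fun_prop) (h1.trans_ne h0) (h1.trans_ne ENNReal.ofReal_ne_top)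
    (h2.trans (((congrArg _ h1).trans (ENNReal.inv_mul_cancel h0 ENNReal.ofReal_ne_top)).symm))

/-- The dimension of the off-diagonal part of the tangent space. -/
theorem finrank_add_finrank_offDiag (hc : c ≠ 0) (hPX : P ∈ B.X) (hP : P * Pᴴ = 1)
    (hp : IsFrame c ep (hermSubmodule B.A)) (ha : IsFrame c ea (cornerSubmodule B.N (Pᴴ * P)))
    (hb : IsFrame c eb (offDiagSubmodule B.N (Pᴴ * P))) :
    Module.finrank ℝ B.X = Module.finrank ℝ (Subalgebra.toSubmodule B.A.toSubalgebra) + db := by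
  have h1 := LinearMap.finrank_range_of_inj (injective_orbitTangent hc hP hp ha hb)
  rw [range_orbitTangent hPX hP hp ha hb, Module.finrank_prod, Module.finrank_prod,
    finrank_euclideanSpace_fin, finrank_euclideanSpace_fin, finrank_euclideanSpace_fin] at h1
  -- Conjugation by `P` identifies the corner of `N` with the skew part of `A`, so `dp + da` is the
  -- dimension of `A`, while `dp + da + db` is that of `X`.
  let Λ : EuclideanSpace ℝ (Fin dp) × EuclideanSpace ℝ (Fin da) →ₗ[ℝ] Matrix κ κ ℂ :=
    { toFun := fun z => ep z.1 + P * ea z.2 * Pᴴ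
      map_add' := fun z w => by
        simp only [Prod.fst_add, Prod.snd_add, map_add, Matrix.add_mul, Matrix.mul_add]
        abel
      map_smul' := fun c z => by
        simp only [Prod.smul_fst, Prod.smul_snd, map_smul, Matrix.smul_mul, Matrix.mul_smul,
          smul_add, RingHom.id_apply] }
  have hskew : ∀ y, (P * ea y * Pᴴ)ᴴ = -(P * ea y * Pᴴ) := fun y => by
    rw [conjTranspose_mul, conjTranspose_mul, conjTranspose_conjTranspose, (ha.mem y).1.2,
      Matrix.neg_mul, Matrix.mul_neg, Matrix.mul_assoc]
  have hnorm : ∀ x y, ‖Λ (x, y)‖ ^ 2 = c * ‖x‖ ^ 2 + c * ‖y‖ ^ 2 := fun x y => by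
    have h := frobenius_norm_sq_add (re_trace_herm_mul_skew (hp.mem x).2 (hskew y))
    rw [corner_norm hP (ha.mem y).2, hp.norm_sq, ha.norm_sq] at h
    exact h
  have hinj : Function.Injective Λ := injective_of_norm_sq fun z hz => by
    obtain ⟨x, y⟩ := z
    rw [hnorm, ← mul_add] at hz
    have h1 := (mul_eq_zero.1 hz).resolve_left (Nat.cast_ne_zero.2 hc)
    have hx : ‖x‖ ^ 2 = 0 := by nlinarith [sq_nonneg ‖x‖, sq_nonneg ‖y‖]
    have hy : ‖y‖ ^ 2 = 0 := by nlinarith [sq_nonneg ‖x‖, sq_nonneg ‖y‖]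
    rw [pow_eq_zero_iff two_ne_zero, norm_eq_zero] at hx hy
    rw [hx, hy]
    rfl
  have hrange : LinearMap.range Λ = Subalgebra.toSubmodule B.A.toSubalgebra := by
    ext M
    constructor
    · rintro ⟨⟨x, y⟩, rfl⟩
      exact B.A.add_mem (hp.mem x).1
        (B.mul_conjTranspose_mem (B.mul_mem_right hPX (ha.mem y).1.1) hPX)
    · intro hM
      obtain ⟨H, hH, S, hS, rfl⟩ := exists_herm_add_skew (A := B.A) hM
      obtain ⟨x, rfl⟩ := hp.exists_eq hH
      have hSa : Pᴴ * (S * P) ∈ cornerSubmodule B.N (Pᴴ * P) := by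
        refine ⟨⟨B.conjTranspose_mul_mem hPX (B.mul_mem_left hS.1 hPX), ?_⟩, ?_⟩
        · simp only [conjTranspose_mul, conjTranspose_conjTranspose, hS.2, Matrix.neg_mul,
            Matrix.mul_neg, Matrix.mul_assoc]
        · rw [← Matrix.mul_assoc (Pᴴ * P), proj_mul_conjTranspose hP, Matrix.mul_assoc,
            Matrix.mul_assoc, mul_proj hP]
      obtain ⟨y, hy⟩ := ha.exists_eq hSa
      refine ⟨(x, y), ?_⟩
      change ep x + P * ea y * Pᴴ = ep x + S
      rw [hy, ← Matrix.mul_assoc P, hP, Matrix.one_mul, Matrix.mul_assoc, hP, Matrix.mul_one]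
  have h2 := LinearMap.finrank_range_of_inj hinj
  rw [hrange, Module.finrank_prod, finrank_euclideanSpace_fin, finrank_euclideanSpace_fin] at h2
  omega

end EuclideanVolume

/-! ### Densities of the Haar measures at the identity and at the base point -/

section InvariantDensities

attribute [local instance] Matrix.frobeniusNormedAddCommGroup Matrix.frobeniusNormedSpace
  Matrix.frobeniusNormedRing Matrix.frobeniusNormedAlgebra Matrix.borelSpace_frobenius

variable {ι κ : Type} [Fintype ι] [DecidableEq ι] [Fintype κ] [DecidableEq κ] {c : ℕ}

theorem IsFrame.traceBall_eq (hc : c ≠ 0) {d : ℕ}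
    {e : EuclideanSpace ℝ (Fin d) →ₗ[ℝ] Matrix ι ι ℂ} {p : Submodule ℝ (Matrix ι ι ℂ)}
    (he : IsFrame c e p) {r : ℝ} (hr : 0 < r) :
    traceBall c (p : Set (Matrix ι ι ℂ)) r = e '' Metric.ball 0 r := by
  have hc' : (c : ℝ) ≠ 0 := Nat.cast_ne_zero.2 hc
  have key : ∀ x, traceForm c (e x) < r ^ 2 ↔ x ∈ Metric.ball (0 : EuclideanSpace ℝ (Fin d)) r :=
    fun x => by
      rw [traceForm_eq_norm_sq, he.norm_sq, inv_mul_cancel_left₀ hc', mem_ball_zero_iff,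
        sq_lt_sq₀ (norm_nonneg _) hr.le]
  ext A
  constructor
  · rintro ⟨hA, hA'⟩
    obtain ⟨x, rfl⟩ := he.exists_eq hA
    exact ⟨x, (key x).1 hA', rfl⟩
  · rintro ⟨x, hx, rfl⟩
    exact ⟨he.mem x, (key x).2 hx⟩

theorem haarDensityAtOne_eq (hc : c ≠ 0) {K : Subgroup (GL ι ℂ)} [LocallyCompactSpace K]
    {p : Submodule ℝ (Matrix ι ι ℂ)} (hp : lieSet K = p)
    {e : EuclideanSpace ℝ (Fin ((p : Set (Matrix ι ι ℂ)).finrank ℝ)) →ₗ[ℝ] Matrix ι ι ℂ}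
    (he : IsFrame c e p) {d : ℝ≥0∞}
    (h : Tendsto (fun r : ℝ => Measure.haar {k : K | ∃ x ∈ Metric.ball (0 : EuclideanSpace ℝ
        (Fin ((p : Set (Matrix ι ι ℂ)).finrank ℝ))) r,
        ((k : GL ι ℂ) : Matrix ι ι ℂ) = NormedSpace.exp (e x)} /
          volume (Metric.ball (0 : EuclideanSpace ℝ (Fin ((p : Set (Matrix ι ι ℂ)).finrank ℝ))) r))
      (𝓝[>] 0) (𝓝 d)) : haarDensityAtOne c K = d := by
  refine Tendsto.limUnder_eq (h.congr' ?_)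
  filter_upwards [self_mem_nhdsWithin] with r hr
  rw [hp, he.traceBall_eq hc hr]
  simp only [Set.exists_mem_image]
  rfl

variable {B : MatrixBimodule κ ι} {P : Matrix κ ι ℂ} {K : Subgroup (GL ι ℂ)}
  {G : Subgroup (GL κ ℂ)}

/-- A unitary of `U_p` extends to `ℂⁿ` by the identity on the kernel of `P`: take `k = Pᴴ u P + (1 -
Pᴴ P)`. -/
theorem exists_unitary_mul_eq (hK : IsUnitaryGroupOf K B.N) (hPX : P ∈ B.X) (hP : P * Pᴴ = 1)
    {u : Matrix κ κ ℂ} (hu : u ∈ B.A) (huu : u * uᴴ = 1) :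
    ∃ k ∈ K, u * P = P * ((k : GL ι ℂ) : Matrix ι ι ℂ) := by
  have hF := B.proj_mem hPX
  have hPF := mul_proj hP
  have hFs : (Pᴴ * P)ᴴ = Pᴴ * P := by rw [conjTranspose_mul, conjTranspose_conjTranspose]
  have hFF := proj_mul_proj hP
  have hG : 1 - Pᴴ * P ∈ B.N := B.N.sub_mem B.N.one_mem hF
  have hGs : (1 - Pᴴ * P)ᴴ = 1 - Pᴴ * P := by rw [conjTranspose_sub, conjTranspose_one, hFs]
  have hPG : P * (1 - Pᴴ * P) = 0 := by rw [Matrix.mul_sub, Matrix.mul_one, hPF, sub_self]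
  have hGP : (1 - Pᴴ * P) * Pᴴ = 0 := by
    rw [Matrix.sub_mul, Matrix.one_mul, proj_mul_conjTranspose hP, sub_self]
  have hGG : (1 - Pᴴ * P) * (1 - Pᴴ * P) = 1 - Pᴴ * P := by
    rw [Matrix.mul_sub, Matrix.mul_one, ← Matrix.mul_assoc, hGP, Matrix.zero_mul, sub_zero]
  have hsum : Pᴴ * P + (1 - Pᴴ * P) = 1 := add_sub_cancel _ _
  generalize 1 - Pᴴ * P = E at hG hGs hPG hGP hGG hsum
  have hkk : (Pᴴ * (u * P) + E) * (Pᴴ * (u * P) + E)ᴴ = 1 := by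
    have e1 : (Pᴴ * (u * P))ᴴ = Pᴴ * (uᴴ * P) := by
      simp only [conjTranspose_mul, conjTranspose_conjTranspose, Matrix.mul_assoc]
    have e2 : Pᴴ * (u * P) * (Pᴴ * (uᴴ * P)) = Pᴴ * P := by
      calc _ = Pᴴ * (u * (P * Pᴴ) * uᴴ) * P := by simp only [Matrix.mul_assoc]
        _ = _ := by rw [hP, Matrix.mul_one, huu, Matrix.mul_one]
    have e3 : Pᴴ * (u * P) * E = 0 := by
      rw [Matrix.mul_assoc, Matrix.mul_assoc, hPG, Matrix.mul_zero, Matrix.mul_zero]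
    have e4 : E * (Pᴴ * (uᴴ * P)) = 0 := by rw [← Matrix.mul_assoc, hGP, Matrix.zero_mul]
    rw [conjTranspose_add, e1, hGs, Matrix.add_mul, Matrix.mul_add, Matrix.mul_add, e2, e3, e4,
      hGG, add_zero, zero_add, hsum]
  refine ⟨⟨_, _, hkk, mul_eq_one_comm.1 hkk⟩, (hK _).2 ⟨B.N.add_mem
    (B.conjTranspose_mul_mem hPX (B.mul_mem_left hu hPX)) hG, hkk⟩, ?_⟩
  change u * P = P * (Pᴴ * (u * P) + E)
  rw [Matrix.mul_add, hPG, add_zero, ← Matrix.mul_assoc, hP, Matrix.one_mul]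

/-- Links the two descriptions of a small neighbourhood: the exponential ball in the symmetric space
and the tube in `X`. Unitary elements of `G` move across `P` to elements of `K`, and conversely `u P
= P k` forces `u` to be unitary. -/
theorem exists_exp_coset_iff_mem_tube (hG : IsUnitGroupOf G B.A) (hK : IsUnitaryGroupOf K B.N)
    (hPX : P ∈ B.X) (hP : P * Pᴴ = 1) {d : ℕ} {e : EuclideanSpace ℝ (Fin d) →ₗ[ℝ] Matrix κ κ ℂ}
    (he : ∀ x, e x ∈ B.A) {r : ℝ} (g₀ : G) :
    (∃ g : G, ((g : GL κ ℂ) : Matrix κ κ ℂ) ∈ NormedSpace.exp '' (e '' Metric.ball 0 r) ∧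
      (g₀ : G ⧸ unitaryPart G) = (g : G ⧸ unitaryPart G)) ↔
    ((g₀ : GL κ ℂ) : Matrix κ κ ℂ) * P ∈ tube e P K r := by
  constructor
  · rintro ⟨g, ⟨_, ⟨x, hx, rfl⟩, hxg⟩, hg⟩
    have hu : g⁻¹ * g₀ ∈ unitaryPart G := QuotientGroup.eq.1 hg.symm
    have huu : (((g⁻¹ * g₀ : G) : GL κ ℂ) : Matrix κ κ ℂ) *
        (((g⁻¹ * g₀ : G) : GL κ ℂ) : Matrix κ κ ℂ)ᴴ = 1 := Matrix.mem_unitaryGroup_iff.1 hu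
    obtain ⟨k, hk, hkP⟩ := exists_unitary_mul_eq hK hPX hP ((hG _).1 (g⁻¹ * g₀ : G).2) huu
    refine ⟨x, hx, k, hk, ?_⟩
    rw [hxg, Matrix.mul_assoc, ← hkP, ← Matrix.mul_assoc]
    congr 1
    have h : g₀ = g * (g⁻¹ * g₀) := (mul_inv_cancel_left g g₀).symm
    conv_lhs => rw [h]
    rfl
  · rintro ⟨x, hx, k, hk, hxk⟩
    have h2 : NormedSpace.exp (e x) * NormedSpace.exp (-e x) = 1 := by
      rw [← Matrix.exp_add_of_commute (e x) (-e x) ((Commute.refl (e x)).neg_right),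
        add_neg_cancel, NormedSpace.exp_zero]
    have h3 := mul_eq_one_comm.1 h2
    let g' : GL κ ℂ := ⟨_, _, h2, h3⟩
    have hg' : g' ∈ G := (hG _).2 (B.A.exp_mem_matrix (he x))
    refine ⟨⟨g', hg'⟩, ⟨_, ⟨x, hx, rfl⟩, rfl⟩, (QuotientGroup.eq.2 ?_).symm⟩
    have hu : (((⟨g', hg'⟩ : G)⁻¹ * g₀ : G) : GL κ ℂ).1 * P = P * ((k : GL ι ℂ) : Matrix ι ι ℂ) := by
      change NormedSpace.exp (-e x) * ((g₀ : GL κ ℂ) : Matrix κ κ ℂ) * P = _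
      rw [Matrix.mul_assoc, hxk, ← Matrix.mul_assoc, ← Matrix.mul_assoc, h3, Matrix.one_mul]
    exact Matrix.mem_unitaryGroup_iff.2
      (mul_conjTranspose_eq_one_of_mul_eq hP hu ((hK k).1 hk).2)

theorem tube_mul_mem_iff {d : ℕ} {e : EuclideanSpace ℝ (Fin d) →ₗ[ℝ] Matrix κ κ ℂ} {r : ℝ}
    (k : K) (M : Matrix κ ι ℂ) :
    M * ((k : GL ι ℂ) : Matrix ι ι ℂ) ∈ tube e P K r ↔ M ∈ tube e P K r := by
  constructor
  · rintro ⟨x, hx, k', hk', h⟩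
    refine ⟨x, hx, k' * (k : GL ι ℂ)⁻¹, K.mul_mem hk' (K.inv_mem k.2), ?_⟩
    rw [Units.val_mul, ← Matrix.mul_assoc, ← h, Matrix.mul_assoc, Units.mul_inv, Matrix.mul_one]
  · rintro ⟨x, hx, k', hk', rfl⟩
    exact ⟨x, hx, k' * k, K.mul_mem hk' k.2, by rw [Units.val_mul, Matrix.mul_assoc]⟩

/-- The hypothesis gives `g gᴴ = E Eᴴ`; take determinants. -/
theorem norm_det_eq_of_mem_tube (hK : IsUnitaryGroupOf K B.N) (hP : P * Pᴴ = 1)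
    {g E : Matrix κ κ ℂ} {k : GL ι ℂ} (hk : k ∈ K) (h : g * P = E * P * (k : Matrix ι ι ℂ)) :
    ‖g.det‖ = ‖E.det‖ := by
  have hkk := ((hK k).1 hk).2
  generalize (k : Matrix ι ι ℂ) = k' at h hkk
  have h1 : g * gᴴ = E * Eᴴ := by
    calc g * gᴴ = g * P * (g * P)ᴴ := by
          rw [conjTranspose_mul, Matrix.mul_assoc, ← Matrix.mul_assoc P, hP, Matrix.one_mul]
      _ = E * (P * (k' * k'ᴴ) * Pᴴ) * Eᴴ := by
          rw [h]; simp only [conjTranspose_mul, Matrix.mul_assoc]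
      _ = E * Eᴴ := by rw [hkk, Matrix.mul_one, hP, Matrix.mul_one]
  have h2 := congrArg (fun M => ‖det M‖) h1
  simp only [det_mul, det_conjTranspose, norm_mul, norm_star] at h2
  exact (mul_self_inj (norm_nonneg _) (norm_nonneg _)).1 h2

/-- On the `g` with `g P` in a thin tube, `|det g|` equals `|det exp(B)|` for some small `B`, hence
the weight is close to one. So `m` of the tube is asymptotically `C` times the Haar measure of the
preimage of the exponential ball. Finiteness and positivity of `τ` force the same of `C`. -/
theorem quotientDensityAtBase_eq (hc : c ≠ 0) [LocallyCompactSpace G] [LocallyCompactSpace K]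
    (hG : IsUnitGroupOf G B.A) (hK : IsUnitaryGroupOf K B.N) (hPX : P ∈ B.X) (hP : P * Pᴴ = 1)
    {e : EuclideanSpace ℝ (Fin ((hermSubmodule B.A : Set (Matrix κ κ ℂ)).finrank ℝ)) →ₗ[ℝ]
      Matrix κ κ ℂ} (he : IsFrame c e (hermSubmodule B.A)) {N : ℕ} {m : Measure (Matrix κ ι ℂ)}
    {C τ : ℝ≥0∞} (hm : ∀ E : Set (Matrix κ ι ℂ), MeasurableSet E →
      (∀ (k : K) (M : Matrix κ ι ℂ), M * ((k : GL ι ℂ) : Matrix ι ι ℂ) ∈ E ↔ M ∈ E) →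
      m E = C * orbitWeight (Measure.haar : Measure G) (detWeight G N)
        (fun g M => ((g : GL κ ℂ) : Matrix κ κ ℂ) * M) E P)
    (hτ0 : τ ≠ 0) (hτt : τ ≠ ⊤) (hτ : Tendsto (fun r : ℝ => m (tube e P K r) /
      volume (Metric.ball (0 : EuclideanSpace ℝ (Fin ((hermSubmodule B.A :
        Set (Matrix κ κ ℂ)).finrank ℝ))) r)) (𝓝[>] 0) (𝓝 τ)) :
    (C ≠ 0 ∧ C ≠ ⊤) ∧ quotientDensityAtBase c G = τ / C := by
  have hactP : Continuous fun g : G => ((g : GL κ ℂ) : Matrix κ κ ℂ) * P :=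
    (continuous_val_subgroup G).matrix_mul continuous_const
  have hherm : hermSet G = (hermSubmodule B.A : Set (Matrix κ κ ℂ)) := by
    rw [hermSet, lieSet_eq_of_units hG]
    rfl
  set S : ℝ → Set G := fun r => {g : G | ((g : GL κ ℂ) : Matrix κ κ ℂ) * P ∈ tube e P K r} with hS
  have hSm : ∀ r, MeasurableSet (S r) := fun r => hactP.measurable (measurableSet_tube e P K r)
  set I : ℝ → ℝ≥0∞ := fun r => ∫⁻ g in S r, detWeight G N g ∂Measure.haar with hI
  have hmI : ∀ r, m (tube e P K r) = C * I r := fun r => by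
    rw [hm _ (measurableSet_tube e P K r) tube_mul_mem_iff,
      orbitWeight_eq_setLIntegral _ _ hactP.measurable (measurableSet_tube e P K r)]
  set v : ℝ → ℝ≥0∞ := fun r => volume (Metric.ball (0 : EuclideanSpace ℝ
    (Fin ((hermSubmodule B.A : Set (Matrix κ κ ℂ)).finrank ℝ))) r) with hv
  have hv0 : ∀ᶠ r in 𝓝[>] (0 : ℝ), v r ≠ 0 ∧ v r ≠ ⊤ := by
    filter_upwards [self_mem_nhdsWithin] with r hr
    exact ⟨(Metric.measure_ball_pos _ 0 hr).ne', measure_ball_lt_top.ne⟩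
  have hm0 : ∀ᶠ r in 𝓝[>] (0 : ℝ), C * I r ≠ 0 ∧ C * I r ≠ ⊤ := by
    filter_upwards [hv0, hτ.eventually (isOpen_ne.mem_nhds hτ0),
      hτ.eventually (isOpen_ne.mem_nhds hτt)] with r hr h1 h2
    rw [← hmI]
    exact ⟨fun h => h1 (by rw [h, ENNReal.zero_div]),
      fun h => h2 (by rw [h, ENNReal.top_div_of_ne_top hr.2])⟩
  obtain ⟨r₀, hr₀⟩ := hm0.exists
  have hC0 : C ≠ 0 := fun h => hr₀.1 (by rw [h, zero_mul])
  have hCt : C ≠ ⊤ := fun h => hr₀.2 (by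
    rw [h, ENNReal.top_mul]
    exact fun h0 => hr₀.1 (by rw [h0, mul_zero]))
  refine ⟨⟨hC0, hCt⟩, ?_⟩
  have hI0 : ∀ᶠ r in 𝓝[>] (0 : ℝ), I r ≠ 0 ∧ I r ≠ ⊤ := by
    filter_upwards [hm0] with r hr
    exact ⟨fun h => hr.1 (by rw [h, mul_zero]), fun h => hr.2 (by
      rw [h, ENNReal.mul_top hC0])⟩
  have hratio : Tendsto (fun r => (Measure.haar (S r) : ℝ≥0∞) / I r) (𝓝[>] 0) (𝓝 1) := by
    refine ENNReal.tendsto_div_one_of_forall hI0 fun b hb => ?_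
    have hb' : (1 : ℝ≥0∞) < b := by exact_mod_cast hb
    have hcont : Continuous fun x => ‖(NormedSpace.exp (e x)).det‖ₑ ^ N :=
      (ENNReal.continuous_pow N).comp (continuous_enorm.comp (continuous_exp_comp e).matrix_det)
    have hone : ‖(NormedSpace.exp (e 0)).det‖ₑ ^ N = 1 := by
      rw [map_zero, NormedSpace.exp_zero, det_one, enorm_one, one_pow]
    have hnhds : ∀ᶠ x in 𝓝 (0 : EuclideanSpace ℝ (Fin ((hermSubmodule B.A :
        Set (Matrix κ κ ℂ)).finrank ℝ))), ‖(NormedSpace.exp (e x)).det‖ₑ ^ N < b ∧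
          (b : ℝ≥0∞)⁻¹ < ‖(NormedSpace.exp (e x)).det‖ₑ ^ N :=
      (hcont.tendsto' 0 1 hone).eventually
        (Filter.inter_mem (Iio_mem_nhds hb') (Ioi_mem_nhds (ENNReal.inv_lt_one.2 hb')))
    obtain ⟨δ, hδ, hball⟩ := Metric.mem_nhds_iff.1 hnhds
    filter_upwards [Ioo_mem_nhdsGT hδ] with r hr
    have hw : ∀ g ∈ S r, detWeight G N g ≤ b ∧ 1 ≤ b * detWeight G N g := by
      rintro g ⟨x, hx, k, hk, hxk⟩
      have h1 := norm_det_eq_of_mem_tube hK hP hk hxk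
      have h2 : detWeight G N g = ‖(NormedSpace.exp (e x)).det‖ₑ ^ N := by
        rw [detWeight, ← ofReal_norm, h1, ofReal_norm]
      have h3 := hball (Metric.ball_subset_ball hr.2.le hx)
      rw [h2]
      refine ⟨h3.1.le, ?_⟩
      rw [← ENNReal.mul_inv_cancel (a := (b : ℝ≥0∞)) (zero_lt_one.trans hb').ne'
        ENNReal.coe_ne_top]
      exact mul_le_mul_right h3.2.le _
    constructor
    · calc Measure.haar (S r) = ∫⁻ _ in S r, 1 ∂Measure.haar := by rw [setLIntegral_one]
        _ ≤ ∫⁻ g in S r, b * detWeight G N g ∂Measure.haar :=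
          setLIntegral_mono' (hSm r) fun g hg => (hw g hg).2
        _ = b * I r := lintegral_const_mul _ continuous_detWeight.measurable
    · calc I r ≤ ∫⁻ _ in S r, b ∂Measure.haar :=
          setLIntegral_mono' (hSm r) fun g hg => (hw g hg).1
        _ = b * Measure.haar (S r) := setLIntegral_const _ _
  have hlim : Tendsto (fun r => (Measure.haar (S r) : ℝ≥0∞) / v r) (𝓝[>] 0) (𝓝 (τ / C)) := by
    have h1 := ENNReal.Tendsto.mul hratio (Or.inl one_ne_zero)
      (ENNReal.Tendsto.div_const hτ (Or.inl hτ0) (b := C)) (Or.inr ENNReal.one_ne_top)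
    rw [one_mul] at h1
    refine h1.congr' ?_
    filter_upwards [hI0] with r hr
    have hCI : C * I r / v r / C = I r / v r := by
      rw [div_eq_mul_inv, div_eq_mul_inv, div_eq_mul_inv]
      calc C * I r * (v r)⁻¹ * C⁻¹ = (C * C⁻¹) * (I r * (v r)⁻¹) := by ring
        _ = _ := by rw [ENNReal.mul_inv_cancel hC0 hCt, one_mul]
    rw [hmI]
    change (Measure.haar (S r) : ℝ≥0∞) / I r * (C * I r / v r / C) = _
    rw [hCI, ← mul_div_assoc, ENNReal.div_mul_cancel hr.1 hr.2]
  refine Tendsto.limUnder_eq (hlim.congr' ?_)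
  filter_upwards [self_mem_nhdsWithin] with r hr
  have hset : (QuotientGroup.mk : G → G ⧸ unitaryPart G) ⁻¹' {x | ∃ g : G,
      ((g : GL κ ℂ) : Matrix κ κ ℂ) ∈ NormedSpace.exp '' traceBall c (hermSet G) r ∧
        x = (g : G ⧸ unitaryPart G)} = S r := by
    ext g₀
    rw [hherm, he.traceBall_eq hc hr]
    exact exists_exp_coset_iff_mem_tube hG hK hPX hP (fun x => (he.mem x).1) g₀
  have hmeas : MeasurableSet {x : G ⧸ unitaryPart G | ∃ g : G,
      ((g : GL κ ℂ) : Matrix κ κ ℂ) ∈ NormedSpace.exp '' traceBall c (hermSet G) r ∧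
        x = (g : G ⧸ unitaryPart G)} := by
    -- A set in the quotient is measurable exactly when its preimage in `G` is.
    have h := hSm r
    rw [← hset] at h
    exact h
  rw [quotientHaar, Measure.map_apply QuotientGroup.measurable_coe hmeas, hset, ballVolume, hherm]

end InvariantDensities

/-! ### Integration in polar coordinates -/

section PolarIntegration

attribute [local instance] Matrix.frobeniusNormedAddCommGroup Matrix.frobeniusNormedSpace
  Matrix.frobeniusNormedRing Matrix.frobeniusNormedAlgebra Matrix.borelSpace_frobenius

variable {ι κ κ' : Type} [Fintype ι] [DecidableEq ι] [Fintype κ] [DecidableEq κ]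
  [Fintype κ'] [DecidableEq κ']

/-- The determinant of left multiplication on `X` is the same in every linear chart. -/
theorem MatrixBimodule.abs_det_eq_of_chart {B : MatrixBimodule κ ι} {N : ℕ}
    (hdet : ∀ g ∈ B.A, ∀ φ : B.X →ₗ[ℝ] B.X, (∀ z, (φ z : Matrix κ ι ℂ) = g * (z : Matrix κ ι ℂ)) →
      |LinearMap.det φ| = ‖g.det‖ ^ N) {D : Type*} [AddCommGroup D] [Module ℝ D]
    {Λ : D →ₗ[ℝ] Matrix κ ι ℂ} (hΛi : Function.Injective Λ) (hΛr : LinearMap.range Λ = B.X)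
    {g : Matrix κ κ ℂ} (hg : g ∈ B.A) {φ : D →ₗ[ℝ] D} (hφ : ∀ z, Λ (φ z) = g * Λ z) :
    |LinearMap.det φ| = ‖g.det‖ ^ N := by
  let e : D ≃ₗ[ℝ] B.X := (LinearEquiv.ofInjective Λ hΛi).trans (LinearEquiv.ofEq _ _ hΛr)
  have he : ∀ z, (e z : Matrix κ ι ℂ) = Λ z := fun z => rfl
  rw [← LinearMap.det_conj φ e]
  refine hdet g hg _ fun z => ?_
  change (e (φ (e.symm z)) : Matrix κ ι ℂ) = _
  rw [he, hφ, ← he, e.apply_symm_apply]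

variable {B : MatrixBimodule κ ι} {P : Matrix κ ι ℂ} {c N db : ℕ} {K K' : Subgroup (GL ι ℂ)}
  {G : Subgroup (GL κ ℂ)}

/-- A function on `X` which is invariant under the unitary elements of `N` is constant on the
cosets of the unitary part of `G`, along the orbit of `P`. -/
theorem apply_mul_eq_of_coset_eq (hG : IsUnitGroupOf G B.A) (hK : IsUnitaryGroupOf K B.N)
    (hPX : P ∈ B.X) (hP : P * Pᴴ = 1) {F : Matrix κ ι ℂ → ℂ}
    (hi : ∀ (k : K) (M : Matrix κ ι ℂ), F (M * ((k : GL ι ℂ) : Matrix ι ι ℂ)) = F M) {g g' : G}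
    (h : (g : G ⧸ unitaryPart G) = (g' : G ⧸ unitaryPart G)) :
    F (((g : GL κ ℂ) : Matrix κ κ ℂ) * P) = F (((g' : GL κ ℂ) : Matrix κ κ ℂ) * P) ∧
      ‖((g : GL κ ℂ) : Matrix κ κ ℂ).det‖ = ‖((g' : GL κ ℂ) : Matrix κ κ ℂ).det‖ := by
  have hu : g⁻¹ * g' ∈ unitaryPart G := QuotientGroup.eq.1 h
  have huu : (((g⁻¹ * g' : G) : GL κ ℂ) : Matrix κ κ ℂ) *
      (((g⁻¹ * g' : G) : GL κ ℂ) : Matrix κ κ ℂ)ᴴ = 1 := Matrix.mem_unitaryGroup_iff.1 hu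
  obtain ⟨k, hk, hkP⟩ := exists_unitary_mul_eq hK hPX hP ((hG _).1 (g⁻¹ * g' : G).2) huu
  have hg' : ((g' : GL κ ℂ) : Matrix κ κ ℂ) * P =
      ((g : GL κ ℂ) : Matrix κ κ ℂ) * P * (k : Matrix ι ι ℂ) := by
    rw [Matrix.mul_assoc, ← hkP, ← Matrix.mul_assoc]
    congr 1
    have h : g' = g * (g⁻¹ * g') := (mul_inv_cancel_left g g').symm
    conv_lhs => rw [h]
    rfl
  exact ⟨by rw [hg']; exact (hi ⟨k, hk⟩ _).symm, (norm_det_eq_of_mem_tube hK hP hk hg').symm⟩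

/-- Integration in polar coordinates: the integral over `Hom(ℂⁿ, ℂᵖ) ≃ X` of an invariant function
as an integral over the symmetric space of `G`. -/
theorem exists_integral_eq_mul_integral_symmetricMeasure (hc : c ≠ 0) [LocallyCompactSpace G]
    [LocallyCompactSpace K] [LocallyCompactSpace K'] (hG : IsUnitGroupOf G B.A)
    (hK : IsUnitaryGroupOf K B.N) (hKcl : IsClosed (K : Set (GL ι ℂ)))
    (hK'cl : IsClosed (K' : Set (GL ι ℂ)))
    (hK' : ∀ k, k ∈ K' ↔ k ∈ K ∧ P * (k : Matrix ι ι ℂ) = P) (hPX : P ∈ B.X) (hP : P * Pᴴ = 1)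
    (hdet : ∀ g ∈ B.A, ∀ φ : B.X →ₗ[ℝ] B.X, (∀ z, (φ z : Matrix κ ι ℂ) = g * (z : Matrix κ ι ℂ)) →
      |LinearMap.det φ| = ‖g.det‖ ^ N)
    (hdb : Module.finrank ℝ B.X = Module.finrank ℝ (Subalgebra.toSubmodule B.A.toSubalgebra) + db)
    {ψ : Matrix κ' ι ℂ →ₗ[ℝ] Matrix κ ι ℂ} (hψ : ∀ L, ‖ψ L‖ ^ 2 = c * ‖L‖ ^ 2)
    (hψr : LinearMap.range ψ = B.X) {F : Matrix κ ι ℂ → ℂ} (hF : Measurable F)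
    (hi : ∀ (k : K) (M : Matrix κ ι ℂ), F (M * ((k : GL ι ℂ) : Matrix ι ι ℂ)) = F M)
    (hint : Integrable (fun L => F (ψ L)) (volume : Measure (Matrix κ' ι ℂ))) :
    ∃ Φ : G ⧸ unitaryPart G → ℂ,
      (∀ g : G, Φ (g : G ⧸ unitaryPart G) = F (((g : GL κ ℂ) : Matrix κ κ ℂ) * P) *
        (((2 ^ ((db : ℝ) / 2))⁻¹ * ‖((g : GL κ ℂ) : Matrix κ κ ℂ).det‖ ^ N : ℝ) : ℂ)) ∧
      Integrable Φ (symmetricMeasure c G) ∧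
      ∫ L : Matrix κ' ι ℂ, F (ψ L) = ((groupVolume c K / groupVolume c K' : ℝ) : ℂ) *
        ∫ x, Φ x ∂(symmetricMeasure c G) := by
  have hKu : ∀ k ∈ K, (k : Matrix ι ι ℂ) * (k : Matrix ι ι ℂ)ᴴ = 1 := fun k hk => ((hK k).1 hk).2
  have hcK : CompactSpace K := compactSpace_of_isClosed_of_unitary hKcl hKu
  have hcK' : CompactSpace K' := compactSpace_of_isClosed_of_unitary hK'cl
    fun k hk => hKu k ((hK' k).1 hk).1
  obtain ⟨ep, hep⟩ := exists_traceForm_frame hc (hermSubmodule B.A)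
  obtain ⟨ek, hek⟩ := exists_traceForm_frame hc (skewSubmodule B.N)
  obtain ⟨ek', hek'⟩ := exists_traceForm_frame hc (stabSubmodule B.N P)
  obtain ⟨ea, hea⟩ := exists_traceForm_frame hc (cornerSubmodule B.N (Pᴴ * P))
  obtain ⟨eb, heb⟩ := exists_traceForm_frame hc (offDiagSubmodule B.N (Pᴴ * P))
  have fp : IsFrame c ep (hermSubmodule B.A) := ⟨hep.1, hep.2⟩
  have fk : IsFrame c ek (skewSubmodule B.N) := ⟨hek.1, hek.2⟩
  have fk' : IsFrame c ek' (stabSubmodule B.N P) := ⟨hek'.1, hek'.2⟩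
  have fa : IsFrame c ea (cornerSubmodule B.N (Pᴴ * P)) := ⟨hea.1, hea.2⟩
  have fb : IsFrame c eb (offDiagSubmodule B.N (Pᴴ * P)) := ⟨heb.1, heb.2⟩
  have hdb' := finrank_add_finrank_offDiag hc hPX hP fp fa fb
  rw [hdb, Nat.add_left_cancel_iff] at hdb'
  have hmap := map_volume_eq_smul_map_orbitTangent hc hPX hP fp fa fb hψ hψr
  have hpow : (2 : ℝ) ^ (((offDiagSubmodule B.N (Pᴴ * P) : Set (Matrix ι ι ℂ)).finrank ℝ : ℝ) / 2) =
      2 ^ ((db : ℝ) / 2) := by rw [hdb']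
  rw [hpow] at hmap
  obtain ⟨dK, dK', hdK, hdK', hlimK, hlimK', hlim⟩ := exists_tube_density hc hK hK' hPX hP
    fp fk fk' fa fb (Measure.haar : Measure K) (Measure.haar : Measure K')
  have hvK : haarDensityAtOne c K = dK := haarDensityAtOne_eq hc (lieSet_eq_of_unitary hK) fk hlimK
  have hvK' : haarDensityAtOne c K' = dK' := haarDensityAtOne_eq hc
    (lieSet_eq_of_stabilizer (N := B.N) (P := P) fun k => by rw [hK', hK k]) fk' hlimK'
  have hηt : (Measure.haar : Measure K) Set.univ ≠ ⊤ := measure_ne_top _ _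
  have hη't : (Measure.haar : Measure K') Set.univ ≠ ⊤ := measure_ne_top _ _
  have hη0 : (Measure.haar : Measure K) Set.univ ≠ 0 := (isOpen_univ.measure_pos _ ⟨1, trivial⟩).ne'
  have hη'0 : (Measure.haar : Measure K') Set.univ ≠ 0 :=
    (isOpen_univ.measure_pos _ ⟨1, trivial⟩).ne'
  -- The limiting tube density is precisely the quotient of the two normalized volumes; the
  -- arbitrary scalings of the Haar measures drop out.
  have hvol : groupVolume c K / groupVolume c K' = ((Measure.haar : Measure K) Set.univ * dK' /
      (dK * (Measure.haar : Measure K') Set.univ)).toReal := by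
    rw [groupVolume, groupVolume, hvK, hvK']
    simp only [ENNReal.toReal_mul, ENNReal.toReal_div, ENNReal.toReal_inv]
    rw [inv_mul_eq_div, inv_mul_eq_div, div_div_div_eq]
  have hτ0 : (Measure.haar : Measure K) Set.univ * dK' /
      (dK * (Measure.haar : Measure K') Set.univ) ≠ 0 :=
    ENNReal.div_ne_zero.2 ⟨mul_ne_zero hη0 hdK'.1, ENNReal.mul_ne_top hdK.2 hη't⟩
  have hτt : (Measure.haar : Measure K) Set.univ * dK' /
      (dK * (Measure.haar : Measure K') Set.univ) ≠ ⊤ :=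
    ENNReal.div_ne_top (ENNReal.mul_ne_top hηt hdK'.2) (mul_ne_zero hdK.1 hη'0)
  generalize (Measure.haar : Measure K) Set.univ * dK' /
      (dK * (Measure.haar : Measure K') Set.univ) = τ at hlim hvol hτ0 hτt
  have hinj := injective_orbitTangent hc hP fp fa fb
  have hran := range_orbitTangent hPX hP fp fa fb
  have := isAddHaarMeasure_prod
    (volume : Measure (EuclideanSpace ℝ (Fin ((cornerSubmodule B.N (Pᴴ * P) :
      Set (Matrix ι ι ℂ)).finrank ℝ))))
    (volume : Measure (EuclideanSpace ℝ (Fin ((offDiagSubmodule B.N (Pᴴ * P) :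
      Set (Matrix ι ι ℂ)).finrank ℝ))))
  have := isAddHaarMeasure_prod
    (volume : Measure (EuclideanSpace ℝ (Fin ((hermSubmodule B.A :
      Set (Matrix κ κ ℂ)).finrank ℝ))))
    ((volume : Measure (EuclideanSpace ℝ (Fin ((cornerSubmodule B.N (Pᴴ * P) :
      Set (Matrix ι ι ℂ)).finrank ℝ)))).prod
    (volume : Measure (EuclideanSpace ℝ (Fin ((offDiagSubmodule B.N (Pᴴ * P) :
      Set (Matrix ι ι ℂ)).finrank ℝ)))))
  obtain ⟨C, hC⟩ := exists_measure_eq_mul_detWeight B hG hK hPX hP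
    ((volume : Measure (EuclideanSpace ℝ (Fin ((hermSubmodule B.A :
      Set (Matrix κ κ ℂ)).finrank ℝ)))).prod
    ((volume : Measure (EuclideanSpace ℝ (Fin ((cornerSubmodule B.N (Pᴴ * P) :
      Set (Matrix ι ι ℂ)).finrank ℝ)))).prod
    (volume : Measure (EuclideanSpace ℝ (Fin ((offDiagSubmodule B.N (Pᴴ * P) :
      Set (Matrix ι ι ℂ)).finrank ℝ)))))) hinj hran
    (fun g hg φ hφ => B.abs_det_eq_of_chart hdet hinj hran hg hφ) (Measure.haar : Measure G)
  change ∀ E, MeasurableSet E → _ → Measure.map (orbitTangent ep P (ea.coprod eb)) volume E = _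
    at hC
  obtain ⟨⟨hC0, hCt⟩, hdQ⟩ := quotientDensityAtBase_eq hc hG hK hPX hP fp hC hτ0 hτt hlim
  have hpos : (0 : ℝ) < 2 ^ ((db : ℝ) / 2) := by positivity
  have hs0 : (ENNReal.ofReal (2 ^ ((db : ℝ) / 2)))⁻¹ ≠ 0 := ENNReal.inv_ne_zero.2 ENNReal.ofReal_ne_top
  have hst : (ENNReal.ofReal (2 ^ ((db : ℝ) / 2)))⁻¹ ≠ ⊤ :=
    ENNReal.inv_ne_top.2 (ENNReal.ofReal_pos.2 hpos).ne'
  have hsr : (ENNReal.ofReal (2 ^ ((db : ℝ) / 2)))⁻¹.toReal = (2 ^ ((db : ℝ) / 2))⁻¹ := by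
    rw [ENNReal.toReal_inv, ENNReal.toReal_ofReal hpos.le]
  have hψm : Measurable ψ := (LinearMap.continuous_of_finiteDimensional ψ).measurable
  have hintm : Integrable F (Measure.map (orbitTangent ep P (ea.coprod eb)) volume) := by
    have h := (integrable_map_measure hF.aestronglyMeasurable hψm.aemeasurable).2 hint
    rw [hmap] at h
    exact (integrable_smul_measure hs0 hst).1 h
  have hactP : Measurable fun g : G => ((g : GL κ ℂ) : Matrix κ κ ℂ) * P :=
    ((continuous_val_subgroup G).matrix_mul continuous_const).measurable
  obtain ⟨hI1, hI2⟩ := integral_eq_mul_integral_orbit continuous_detWeight.measurable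
    detWeight_ne_top hactP hC0 hCt hC hF hi hintm
  simp only [toReal_detWeight] at hI1 hI2
  generalize hs : (2 ^ ((db : ℝ) / 2) : ℝ)⁻¹ = s at hsr ⊢
  set Φ₀ : G → ℂ := fun g => F (((g : GL κ ℂ) : Matrix κ κ ℂ) * P) *
    ((s * ‖((g : GL κ ℂ) : Matrix κ κ ℂ).det‖ ^ N : ℝ) : ℂ) with hΦ₀
  have hΦs : Φ₀ = fun g : G => (s : ℂ) * (F (((g : GL κ ℂ) : Matrix κ κ ℂ) * P) *
      ((‖((g : GL κ ℂ) : Matrix κ κ ℂ).det‖ ^ N : ℝ) : ℂ)) := by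
    funext g
    simp only [hΦ₀, Complex.ofReal_mul]
    ring
  have hΦ₀m : Measurable Φ₀ := (hF.comp hactP).mul (Complex.measurable_ofReal.comp
    ((continuous_const.mul (((continuous_val_subgroup G).matrix_det).norm.pow N)).measurable))
  let Φ : G ⧸ unitaryPart G → ℂ := Quotient.lift Φ₀ fun a b hab => by
    obtain ⟨h1, h2⟩ := apply_mul_eq_of_coset_eq hG hK hPX hP hi
      (show (a : G ⧸ unitaryPart G) = (b : G ⧸ unitaryPart G) from Quotient.sound hab)
    simp only [hΦ₀, h1, h2]
  have hΦm : Measurable Φ := fun S hS => hΦ₀m hS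
  have hΦi : Integrable Φ (quotientHaar G) := by
    refine (integrable_map_measure hΦm.aestronglyMeasurable
      QuotientGroup.measurable_coe.aemeasurable).2 ?_
    change Integrable Φ₀ Measure.haar
    rw [hΦs]
    exact hI1.const_mul _
  have hd0 : τ / C ≠ 0 := ENNReal.div_ne_zero.2 ⟨hτ0, hCt⟩
  refine ⟨Φ, fun g => rfl, ?_, ?_⟩
  · rw [symmetricMeasure, hdQ]
    exact hΦi.smul_measure (ENNReal.inv_ne_top.2 hd0)
  · have h1 : ∫ x, Φ x ∂(quotientHaar G) = ∫ g, Φ₀ g ∂Measure.haar :=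
      integral_map QuotientGroup.measurable_coe.aemeasurable hΦm.aestronglyMeasurable
    have h2 : ∫ L : Matrix κ' ι ℂ, F (ψ L) = ∫ M, F M ∂(volume : Measure (Matrix κ' ι ℂ)).map ψ :=
      (integral_map hψm.aemeasurable hF.aestronglyMeasurable).symm
    -- The left side carries `s C` and the normalized measure carries `C / τ`. The unknown `C`
    -- cancels, `s` is part of `Φ`, and `τ` is the volume quotient.
    rw [h2, hmap, integral_smul_measure, hI2, symmetricMeasure, integral_smul_measure, h1, hdQ,
      hvol, hΦs, integral_const_mul, hsr]
    have hτr : (τ.toReal : ℂ) ≠ 0 := Complex.ofReal_ne_zero.2 (ENNReal.toReal_ne_zero.2 ⟨hτ0, hτt⟩)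
    have hCr : (C.toReal : ℂ) ≠ 0 := Complex.ofReal_ne_zero.2 (ENNReal.toReal_ne_zero.2 ⟨hC0, hCt⟩)
    simp only [Complex.real_smul, ENNReal.toReal_inv, ENNReal.toReal_div, Complex.ofReal_inv,
      Complex.ofReal_div]
    field_simp

end PolarIntegration

/-! ### Real forms of matrix spaces and anti-linear maps -/

section RealForms

attribute [local instance] Matrix.frobeniusNormedAddCommGroup Matrix.frobeniusNormedSpace
  Matrix.frobeniusNormedRing Matrix.frobeniusNormedAlgebra Matrix.borelSpace_frobenius

variable {ι κ ν : Type} [Fintype ι] [DecidableEq ι] [Fintype κ] [DecidableEq κ]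
  [Fintype ν] [DecidableEq ν]

/-- Every complex matrix is uniquely `x + i y` with `x, y ∈ X`. -/
def IsRealForm (X : Submodule ℝ (Matrix κ ι ℂ)) : Prop :=
  Function.Bijective fun z : X × X => (z.1 : Matrix κ ι ℂ) + Complex.I • (z.2 : Matrix κ ι ℂ)

/-- The linear isomorphism of `X × X` with the space of complex matrices. -/
noncomputable def IsRealForm.equiv {X : Submodule ℝ (Matrix κ ι ℂ)} (hX : IsRealForm X) :
    (X × X) ≃ₗ[ℝ] Matrix κ ι ℂ :=
  LinearEquiv.ofBijective (show X × X →ₗ[ℝ] Matrix κ ι ℂ from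
    { toFun := fun z => (z.1 : Matrix κ ι ℂ) + Complex.I • (z.2 : Matrix κ ι ℂ)
      map_add' := fun z w => by
        simp only [Prod.fst_add, Prod.snd_add, Submodule.coe_add, smul_add]
        abel
      map_smul' := fun c z => by
        simp only [Prod.smul_fst, Prod.smul_snd, Submodule.coe_smul, RingHom.id_apply, smul_add]
        rw [smul_comm] }) hX

theorem IsRealForm.finrank_eq {X : Submodule ℝ (Matrix κ ι ℂ)} (hX : IsRealForm X) :
    Module.finrank ℝ X = Fintype.card κ * Fintype.card ι := by
  have h := hX.equiv.finrank_eq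
  rw [Module.finrank_prod, Module.finrank_matrix, Complex.finrank_real_complex] at h
  omega

/-- On `X ⊕ iX`, left multiplication by `g` acts as two copies of `φ`, so the square of `det φ` is
the real determinant on all complex matrices. -/
theorem IsRealForm.abs_det_eq {X : Submodule ℝ (Matrix κ ι ℂ)} (hX : IsRealForm X)
    {g : Matrix κ κ ℂ} {φ : X →ₗ[ℝ] X}
    (hφ : ∀ z, (φ z : Matrix κ ι ℂ) = g * (z : Matrix κ ι ℂ)) :
    |LinearMap.det φ| = ‖g.det‖ ^ Fintype.card ι := by
  have h1 : (mulLeftLinearMap ι ℂ g).restrictScalars ℝ =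
      hX.equiv.toLinearMap ∘ₗ (φ.prodMap φ) ∘ₗ hX.equiv.symm.toLinearMap := by
    refine LinearMap.ext fun M => ?_
    obtain ⟨z, rfl⟩ := hX.equiv.surjective M
    change g * ((z.1 : Matrix κ ι ℂ) + Complex.I • (z.2 : Matrix κ ι ℂ)) =
      hX.equiv ((φ.prodMap φ) (hX.equiv.symm (hX.equiv z)))
    rw [hX.equiv.symm_apply_apply]
    change _ = (φ z.1 : Matrix κ ι ℂ) + Complex.I • (φ z.2 : Matrix κ ι ℂ)
    rw [hφ, hφ, Matrix.mul_add, Matrix.mul_smul]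
  have h2 := det_mulLeft_matrix (ι := ι) g
  rw [h1, LinearMap.det_conj, LinearMap.det_prodMap, abs_mul, pow_mul', ← sq] at h2
  exact (pow_left_inj₀ (abs_nonneg _) (pow_nonneg (norm_nonneg _) _) two_ne_zero).1 h2

/-- Real and imaginary parts with respect to the conjugation `θ`, whose fixed points form `X`. -/
theorem isRealForm_of_involution {X : Submodule ℝ (Matrix κ ι ℂ)}
    {θ : Matrix κ ι ℂ → Matrix κ ι ℂ} (hadd : ∀ M M', θ (M + M') = θ M + θ M')
    (hsmul : ∀ (c : ℂ) M, θ (c • M) = star c • θ M) (hθ : ∀ M, θ (θ M) = M)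
    (hX : ∀ M, M ∈ X ↔ θ M = M) : IsRealForm X := by
  have hI : ∀ M, θ (Complex.I • M) = -(Complex.I • θ M) := fun M => by
    rw [hsmul, Complex.star_def, Complex.conj_I, neg_smul]
  constructor
  · rintro ⟨⟨x, hx⟩, ⟨y, hy⟩⟩ ⟨⟨x', hx'⟩, ⟨y', hy'⟩⟩ h
    rw [hX] at hx hy hx' hy'
    have h1 : x + Complex.I • y = x' + Complex.I • y' := h
    have h2 := congrArg θ h1
    rw [hadd, hadd, hI, hI, hx, hy, hx', hy'] at h2
    have h3 : (2 : ℂ) • x = (2 : ℂ) • x' := by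
      rw [two_smul, two_smul]
      calc x + x = x + Complex.I • y + (x + -(Complex.I • y)) := by abel
        _ = x' + Complex.I • y' + (x' + -(Complex.I • y')) := by rw [h1, h2]
        _ = x' + x' := by abel
    have h4 : x = x' := smul_right_injective _ (two_ne_zero (α := ℂ)) h3
    rw [h4] at h1
    have h5 : y = y' := smul_right_injective _ Complex.I_ne_zero (add_left_cancel h1)
    subst h4 h5
    rfl
  · intro M
    refine ⟨⟨⟨(2⁻¹ : ℂ) • (M + θ M), (hX _).2 ?_⟩, ⟨(-Complex.I * 2⁻¹ : ℂ) • (M - θ M), (hX _).2 ?_⟩⟩, ?_⟩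
    · rw [hsmul, hadd, hθ, add_comm (θ M)]
      simp
    · have h1 : θ (M - θ M) = θ M - M := by
        have h := hadd (M - θ M) (θ M)
        rw [sub_add_cancel, hθ] at h
        exact eq_sub_of_add_eq h.symm
      rw [hsmul, h1]
      simp only [Complex.star_def, map_mul, map_neg, Complex.conj_I, neg_neg, map_inv₀, map_ofNat]
      rw [← neg_sub M, smul_neg, neg_mul, neg_smul]
    · change (2⁻¹ : ℂ) • (M + θ M) + Complex.I • (-Complex.I * 2⁻¹ : ℂ) • (M - θ M) = M
      rw [smul_smul, ← mul_assoc, mul_neg, Complex.I_mul_I, neg_neg, one_mul, ← smul_add,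
        add_add_sub_cancel, ← two_smul ℂ M, smul_smul, inv_mul_cancel₀ two_ne_zero, one_smul]

theorem map_star_mul (A : Matrix κ ι ℂ) (B : Matrix ι ν ℂ) :
    (A * B).map star = A.map star * B.map star :=
  Matrix.map_mul (f := starRingEnd ℂ)

theorem map_star_map_star (A : Matrix κ ι ℂ) : (A.map star).map star = A := by
  ext i j
  simp

theorem conjTranspose_map_star (A : Matrix κ ι ℂ) : (A.map star)ᴴ = Aᴴ.map star := rfl

theorem isRealForm_antilinearIntertwiners {σ : ℂ} (hσ : star σ = σ) (hσσ : σ * σ = 1)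
    {J : Matrix κ κ ℂ} {T : Matrix ι ι ℂ} (hJ : J * J.map star = σ • 1)
    (hT : T * T.map star = σ • 1) : IsRealForm (antilinearIntertwiners J T) := by
  have hT' : T.map star * T = σ • 1 := by
    have h := congrArg (fun M => M.map star) hT
    simp only [map_star_mul, map_star_map_star] at h
    rw [h]
    ext i j
    by_cases hij : i = j
    · rw [hij, map_apply, Matrix.smul_apply, one_apply_eq, smul_eq_mul, mul_one, hσ]
    · simp [hij]
  have hmap : ∀ (c : ℂ) (M : Matrix κ ι ℂ), (c • M).map star = star c • M.map star := fun c M => by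
    ext i j
    simp
  -- This solves `J M̄ = M T` for `M`, since `T T̄ = σ` and `σ² = 1`; the signs of `J J̄` and `T T̄`
  -- agree, so `θ` is an involution.
  refine isRealForm_of_involution (θ := fun M => σ • (J * M.map star * T.map star)) ?_ ?_ ?_ ?_
  · intro M M'
    rw [Matrix.map_add _ star_add, Matrix.mul_add, Matrix.add_mul, smul_add]
  · intro c M
    rw [hmap, Matrix.mul_smul, Matrix.smul_mul, smul_comm]
  · intro M
    simp only [hmap, map_star_mul, map_star_map_star, hσ, Matrix.mul_smul, Matrix.smul_mul,
      smul_smul, hσσ, one_smul]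
    calc J * (J.map star * M * T) * T.map star = (J * J.map star) * M * (T * T.map star) := by
          simp only [Matrix.mul_assoc]
      _ = M := by
          rw [hJ, hT, Matrix.smul_mul, Matrix.one_mul, Matrix.smul_mul, Matrix.mul_smul,
            Matrix.mul_one, smul_smul, hσσ, one_smul]
  · intro M
    change J * M.map star = M * T ↔ σ • (J * M.map star * T.map star) = M
    constructor
    · intro h
      rw [h, Matrix.mul_assoc, hT, Matrix.mul_smul, Matrix.mul_one, smul_smul, hσσ, one_smul]
    · intro h
      conv_rhs => rw [← h]
      rw [Matrix.smul_mul, Matrix.mul_assoc, hT', Matrix.mul_smul, Matrix.mul_one, smul_smul, hσσ,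
        one_smul]

theorem mul_mem_antilinearIntertwiners {J : Matrix κ κ ℂ} {T : Matrix ι ι ℂ} {S : Matrix ν ν ℂ}
    {M : Matrix κ ι ℂ} {M' : Matrix ι ν ℂ} (hM : M ∈ antilinearIntertwiners J T)
    (hM' : M' ∈ antilinearIntertwiners T S) : M * M' ∈ antilinearIntertwiners J S := by
  have h1 : J * M.map star = M * T := hM
  have h2 : T * M'.map star = M' * S := hM'
  change J * (M * M').map star = M * M' * S
  rw [map_star_mul, ← Matrix.mul_assoc, h1, Matrix.mul_assoc, h2, ← Matrix.mul_assoc]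

theorem conjTranspose_mem_antilinearIntertwiners {J : Matrix κ κ ℂ} {T : Matrix ι ι ℂ}
    (hJ : J * Jᴴ = 1) (hT : T * Tᴴ = 1) {M : Matrix κ ι ℂ} (hM : M ∈ antilinearIntertwiners J T) :
    Mᴴ ∈ antilinearIntertwiners T J := by
  have h1 : J * M.map star = M * T := hM
  have h2 := congrArg conjTranspose h1
  rw [conjTranspose_mul, conjTranspose_mul, conjTranspose_map_star] at h2
  change T * Mᴴ.map star = Mᴴ * J
  calc T * Mᴴ.map star = T * (Mᴴ.map star * Jᴴ) * J := by
        rw [Matrix.mul_assoc, Matrix.mul_assoc, mul_eq_one_comm.1 hJ, Matrix.mul_one]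
    _ = Mᴴ * J := by rw [h2, ← Matrix.mul_assoc, hT, Matrix.one_mul]

/-- The real `*`-algebra of matrices commuting with a unitary anti-linear map. -/
noncomputable def antilinearAlgebra (J : Matrix ι ι ℂ) (hJ : J * Jᴴ = 1) :
    StarSubalgebra ℝ (Matrix ι ι ℂ) where
  carrier := antilinearIntertwiners J J
  mul_mem' := mul_mem_antilinearIntertwiners
  one_mem' := by
    change J * (1 : Matrix ι ι ℂ).map star = 1 * J
    simp
  add_mem' := (antilinearIntertwiners J J).add_mem
  zero_mem' := (antilinearIntertwiners J J).zero_mem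
  algebraMap_mem' := fun r => by
    rw [Algebra.algebraMap_eq_smul_one]
    refine (antilinearIntertwiners J J).smul_mem r ?_
    change J * (1 : Matrix ι ι ℂ).map star = 1 * J
    simp
  star_mem' := conjTranspose_mem_antilinearIntertwiners hJ hJ

/-- Matrices intertwining two unitary anti-linear maps. -/
noncomputable def antilinearBimodule (J : Matrix κ κ ℂ) (T : Matrix ι ι ℂ) (hJ : J * Jᴴ = 1)
    (hT : T * Tᴴ = 1) : MatrixBimodule κ ι where
  A := antilinearAlgebra J hJ
  X := antilinearIntertwiners J T
  N := antilinearAlgebra T hT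
  mul_mem_left := fun ha hx => mul_mem_antilinearIntertwiners ha hx
  mul_mem_right := fun hx hb => mul_mem_antilinearIntertwiners hx hb
  mul_conjTranspose_mem := fun hx hy =>
    mul_mem_antilinearIntertwiners hx (conjTranspose_mem_antilinearIntertwiners hJ hT hy)
  conjTranspose_mul_mem := fun hx hy =>
    mul_mem_antilinearIntertwiners (conjTranspose_mem_antilinearIntertwiners hJ hT hx) hy

/-- All matrices. -/
noncomputable def fullBimodule (κ ι : Type) [Fintype κ] [DecidableEq κ] [Fintype ι]
    [DecidableEq ι] : MatrixBimodule κ ι where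
  A := ⊤
  X := ⊤
  N := ⊤
  mul_mem_left := fun _ _ => trivial
  mul_mem_right := fun _ _ => trivial
  mul_conjTranspose_mem := fun _ _ => trivial
  conjTranspose_mul_mem := fun _ _ => trivial

theorem abs_det_eq_of_top {g : Matrix κ κ ℂ}
    {φ : (⊤ : Submodule ℝ (Matrix κ ι ℂ)) →ₗ[ℝ] (⊤ : Submodule ℝ (Matrix κ ι ℂ))}
    (hφ : ∀ z, (φ z : Matrix κ ι ℂ) = g * (z : Matrix κ ι ℂ)) :
    |LinearMap.det φ| = ‖g.det‖ ^ (2 * Fintype.card ι) := by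
  rw [← det_mulLeft_matrix (ι := ι) g, ← LinearMap.det_conj φ Submodule.topEquiv]
  congr 2
  refine LinearMap.ext fun M => ?_
  exact hφ (Submodule.topEquiv.symm M)

/-- For unitary `k` the transpose is the inverse of `k̄`, so `kᵀ β k = β` reads `β k = k̄ β`, whose
conjugate says that `k` commutes with `v ↦ β̄ v̄`. -/
theorem isUnitaryGroupOf_formSubgroup {β : Matrix ι ι ℂ}
    (hT : β.map star * (β.map star)ᴴ = 1) :
    IsUnitaryGroupOf (formSubgroup β ⊓ unitaryGL ι) (antilinearAlgebra (β.map star) hT) := by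
  intro k
  have h1 : k ∈ formSubgroup β ⊓ unitaryGL ι ↔ (k : Matrix ι ι ℂ)ᵀ * β * (k : Matrix ι ι ℂ) = β ∧
      (k : Matrix ι ι ℂ) * (k : Matrix ι ι ℂ)ᴴ = 1 :=
    and_congr Iff.rfl Matrix.mem_unitaryGroup_iff
  have h2 : (k : Matrix ι ι ℂ) ∈ antilinearAlgebra (β.map star) hT ↔
      β.map star * (k : Matrix ι ι ℂ).map star = (k : Matrix ι ι ℂ) * β.map star := Iff.rfl
  rw [h1, h2]
  refine and_congr_left fun hk => ?_
  generalize (k : Matrix ι ι ℂ) = k at hk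
  have hk2 : kᵀ * k.map star = 1 := by
    have h := congrArg transpose (mul_eq_one_comm.1 hk)
    rwa [transpose_mul, transpose_one] at h
  have hk3 : k.map star * kᵀ = 1 := mul_eq_one_comm.1 hk2
  have h3 : β.map star * k.map star = k * β.map star ↔ β * k = k.map star * β := by
    constructor
    · intro h
      have h := congrArg (fun M => M.map star) h
      simpa only [map_star_mul, map_star_map_star] using h
    · intro h
      rw [← map_star_mul, h, map_star_mul, map_star_map_star]
  rw [h3]
  constructor
  · intro h
    conv_rhs => rw [← h]
    rw [← Matrix.mul_assoc, ← Matrix.mul_assoc, hk3, Matrix.one_mul]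
  · intro h
    rw [Matrix.mul_assoc, h, ← Matrix.mul_assoc, hk2, Matrix.one_mul]

end RealForms

/-! ### The three symmetry classes -/

section SymmetryClasses

attribute [local instance] Matrix.frobeniusNormedAddCommGroup Matrix.frobeniusNormedSpace
  Matrix.frobeniusNormedRing Matrix.frobeniusNormedAlgebra Matrix.borelSpace_frobenius

variable {ι κ : Type} [Fintype ι] [DecidableEq ι] [Fintype κ] [DecidableEq κ]

theorem IsSchwartz.measurable {u : Matrix κ ι ℂ → ℂ} (hu : IsSchwartz u) : Measurable u := by
  obtain ⟨φ, hφ⟩ := hu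
  have h : u = φ := funext fun L => (hφ L).symm
  rw [h]
  exact φ.continuous.measurable

theorem IsSchwartz.integrable {u : Matrix κ ι ℂ → ℂ} (hu : IsSchwartz u) : Integrable u volume := by
  obtain ⟨φ, hφ⟩ := hu
  have h : u = φ := funext fun L => (hφ L).symm
  rw [h]
  have := Matrix.isAddHaarMeasure_frobenius (κ' := κ) (ι := ι)
  exact φ.integrable (μ := volume)

theorem inv_two_rpow_half_eq_zpow {d : ℕ} {k : ℤ} (h : (d : ℤ) = -2 * k) :
    ((2 : ℝ) ^ ((d : ℝ) / 2))⁻¹ = 2 ^ k := by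
  have h' : (d : ℝ) = -2 * k := by exact_mod_cast h
  rw [← Real.rpow_neg two_pos.le, ← Real.rpow_intCast, h']
  congr 1
  ring

theorem realRestriction_mul_of_unitary {n p : ℕ} {G : Subgroup (GL (Fin n) ℂ)}
    {f : Matrix (Fin p) (Fin n) ℂ × Matrix (Fin n) (Fin p) ℂ → ℂ}
    (hinv : ∀ h ∈ G, ∀ (L : Matrix (Fin p) (Fin n) ℂ) (L' : Matrix (Fin n) (Fin p) ℂ),
      f (L * (h : Matrix (Fin n) (Fin n) ℂ), ((h⁻¹ : GL (Fin n) ℂ) : Matrix (Fin n) (Fin n) ℂ) * L')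
        = f (L, L')) {k : GL (Fin n) ℂ} (hk : k ∈ G ⊓ unitaryGL (Fin n))
    (L : Matrix (Fin p) (Fin n) ℂ) :
    SymmetryClass.realRestriction f (L * (k : Matrix (Fin n) (Fin n) ℂ)) =
      SymmetryClass.realRestriction f L := by
  have h1 : (k : Matrix (Fin n) (Fin n) ℂ)ᴴ * (k : Matrix (Fin n) (Fin n) ℂ) = 1 :=
    Matrix.mem_unitaryGroup_iff'.1 hk.2
  have h2 : ((k⁻¹ : GL (Fin n) ℂ) : Matrix (Fin n) (Fin n) ℂ) =
      (k : Matrix (Fin n) (Fin n) ℂ)ᴴ := Units.inv_eq_of_mul_eq_one_left h1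
  rw [SymmetryClass.realRestriction, SymmetryClass.realRestriction, conjTranspose_mul, ← h2]
  exact hinv k hk.1 L Lᴴ

theorem CMatrix_mul_map_star {σ : ℂ} (hσ : star σ = σ) (p : ℕ) :
    SymmetryClass.CMatrix σ p * (SymmetryClass.CMatrix σ p).map star = σ • 1 := by
  have h : (SymmetryClass.CMatrix σ p).map star = SymmetryClass.CMatrix σ p := by
    have h1 : (σ • (1 : Matrix (Fin p) (Fin p) ℂ)).map star = σ • 1 := by
      ext i j
      by_cases hij : i = j
      · rw [hij, map_apply, Matrix.smul_apply, one_apply_eq, smul_eq_mul, mul_one, hσ]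
      · simp [hij]
    rw [SymmetryClass.CMatrix, fromBlocks_map, h1]
    simp
  rw [h, SymmetryClass.CMatrix, fromBlocks_multiply, ← fromBlocks_one, fromBlocks_smul]
  simp

theorem CMatrix_mul_conjTranspose {σ : ℂ} (hσ : star σ = σ) (hσσ : σ * σ = 1) (p : ℕ) :
    SymmetryClass.CMatrix σ p * (SymmetryClass.CMatrix σ p)ᴴ = 1 := by
  rw [SymmetryClass.CMatrix, fromBlocks_conjTranspose, fromBlocks_multiply, ← fromBlocks_one]
  simp only [conjTranspose_zero, conjTranspose_one, conjTranspose_smul, hσ, Matrix.zero_mul,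
    Matrix.mul_zero, Matrix.one_mul, Matrix.mul_one, add_zero, zero_add, smul_smul, hσσ, one_smul, Matrix.smul_mul]

/-- Both blocks of `ψ(L)` have the norm of `L`; this doubling is compensated by the factor `1 + |m|
= 2` in the trace form. -/
theorem norm_sq_fromRows {n p : ℕ} {β : Matrix (Fin n) (Fin n) ℂ} (hu : β * βᴴ = 1)
    (L : Matrix (Fin p) (Fin n) ℂ) : ‖fromRows L (L.map star * β)‖ ^ 2 = (2 : ℕ) * ‖L‖ ^ 2 := by
  have h1 : ‖fromRows L (L.map star * β)‖ ^ 2 = ‖L‖ ^ 2 + ‖L.map star * β‖ ^ 2 := by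
    rw [frobenius_norm_sq, frobenius_norm_sq, frobenius_norm_sq, Fintype.sum_sum_type]
    rfl
  have h2 : ‖L.map star‖ ^ 2 = ‖L‖ ^ 2 := by
    rw [frobenius_norm_sq, frobenius_norm_sq]
    simp only [map_apply, norm_star]
  rw [h1, norm_mul_of_unitary _ hu, h2]
  push_cast
  ring

/-- Polar integration for the orthogonal and symplectic groups. -/
theorem exists_integral_eq_of_form {n p : ℕ} {σ : ℂ} (hσ : star σ = σ) (hσσ : σ * σ = 1)
    (hp : 2 * p ≤ n) {β : Matrix (Fin n) (Fin n) ℂ} (hβ : β * β.map star = σ • 1)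
    (hu : β ∈ Matrix.unitaryGroup (Fin n) ℂ) {P : Matrix (Fin p ⊕ Fin p) (Fin n) ℂ}
    (hPX : P ∈ antilinearIntertwiners (SymmetryClass.CMatrix σ p) (β.map star)) (hP : P * Pᴴ = 1)
    {K K' : Subgroup (GL (Fin n) ℂ)} [LocallyCompactSpace K] [LocallyCompactSpace K']
    [LocallyCompactSpace (antilinearCommutant (SymmetryClass.CMatrix σ p))]
    (hKcl : IsClosed (K : Set (GL (Fin n) ℂ))) (hK'cl : IsClosed (K' : Set (GL (Fin n) ℂ)))
    (hK : K = formSubgroup β ⊓ unitaryGL (Fin n))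
    (hK' : ∀ k, k ∈ K' ↔ k ∈ K ∧ P * (k : Matrix (Fin n) (Fin n) ℂ) = P)
    {u : Matrix (Fin p) (Fin n) ℂ → ℂ} (hum : Measurable u) (hint : Integrable u volume)
    (hi : ∀ k ∈ K, ∀ L, u (L * ((k : GL (Fin n) ℂ) : Matrix (Fin n) (Fin n) ℂ)) = u L) :
    ∃ Φ : antilinearCommutant (SymmetryClass.CMatrix σ p) ⧸
        unitaryPart (antilinearCommutant (SymmetryClass.CMatrix σ p)) → ℂ,
      (∀ g : antilinearCommutant (SymmetryClass.CMatrix σ p), Φ g =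
        u (toRows₁ (((g : GL (Fin p ⊕ Fin p) ℂ) : Matrix (Fin p ⊕ Fin p) (Fin p ⊕ Fin p) ℂ) * P)) *
        (((2 : ℝ) ^ (2 * (p : ℤ) ^ 2 - p * n) * ‖((g : GL (Fin p ⊕ Fin p) ℂ) :
          Matrix (Fin p ⊕ Fin p) (Fin p ⊕ Fin p) ℂ).det‖ ^ n : ℝ) : ℂ)) ∧
      Integrable Φ (symmetricMeasure 2 (antilinearCommutant (SymmetryClass.CMatrix σ p))) ∧
      ∫ L, u L = ((groupVolume 2 K / groupVolume 2 K' : ℝ) : ℂ) *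
        ∫ x, Φ x ∂(symmetricMeasure 2 (antilinearCommutant (SymmetryClass.CMatrix σ p))) := by
  have hu1 : β * βᴴ = 1 := Matrix.mem_unitaryGroup_iff.1 hu
  have hT : β.map star * (β.map star)ᴴ = 1 := by
    rw [conjTranspose_map_star, ← map_star_mul, hu1]
    simp
  have hTT : β.map star * (β.map star).map star = σ • 1 := by
    rw [map_star_map_star]
    refine smul_right_injective _ (left_ne_zero_of_mul_eq_one hσσ) ?_
    change σ • (β.map star * β) = σ • σ • (1 : Matrix (Fin n) (Fin n) ℂ)
    have h1 : β * (σ • β.map star) = 1 := by rw [Matrix.mul_smul, hβ, smul_smul, hσσ, one_smul]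
    rw [smul_smul, hσσ, one_smul, ← Matrix.smul_mul]
    exact mul_eq_one_comm.1 h1
  have hJ := CMatrix_mul_conjTranspose hσ hσσ p
  have hJJ := CMatrix_mul_map_star hσ p
  have hX := isRealForm_antilinearIntertwiners hσ hσσ hJJ hTT
  have hXr := hX.finrank_eq
  have hAr := (isRealForm_antilinearIntertwiners hσ hσσ hJJ hJJ).finrank_eq
  simp only [Fintype.card_sum, Fintype.card_fin] at hXr hAr
  have hle : (p + p) * (p + p) ≤ (p + p) * n := Nat.mul_le_mul_left _ (by omega)
  set ψ : Matrix (Fin p) (Fin n) ℂ →ₗ[ℝ] Matrix (Fin p ⊕ Fin p) (Fin n) ℂ :=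
    (antilinearIntertwiners (SymmetryClass.CMatrix σ p) (β.map star)).subtype ∘ₗ
      (SymmetryClass.psiForm p hβ).toLinearMap with hψ
  have hψr : LinearMap.range ψ =
      antilinearIntertwiners (SymmetryClass.CMatrix σ p) (β.map star) := by
    rw [hψ, LinearMap.range_comp, LinearEquiv.range, Submodule.map_top, Submodule.range_subtype]
  subst hK
  -- A real form has as real dimension the number of matrix entries, so `dim X - dim A = 2pn - 4p²`.
  -- The natural subtraction is exact because `2p ≤ n`.
  have hdb : ((((p + p) * n - (p + p) * (p + p) : ℕ) : ℤ)) = -2 * (2 * (p : ℤ) ^ 2 - p * n) := by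
    rw [Nat.cast_sub hle]
    push_cast
    ring
  have hrows : Measurable fun M : Matrix (Fin p ⊕ Fin p) (Fin n) ℂ => toRows₁ M :=
    measurable_pi_lambda _ fun i => measurable_pi_apply (Sum.inl i)
  obtain ⟨Φ, h1, h2, h3⟩ := exists_integral_eq_mul_integral_symmetricMeasure
    (B := antilinearBimodule (SymmetryClass.CMatrix σ p) (β.map star) hJ hT)
    (P := P) (c := 2) (N := n) (db := (p + p) * n - (p + p) * (p + p))
    (K := formSubgroup β ⊓ unitaryGL (Fin n)) (K' := K')
    (G := antilinearCommutant (SymmetryClass.CMatrix σ p)) two_ne_zero (fun _ => Iff.rfl)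
    (isUnitaryGroupOf_formSubgroup hT) hKcl hK'cl hK' hPX hP
    (fun g _ φ hφ => by
      have h := hX.abs_det_eq hφ
      rwa [Fintype.card_fin] at h)
    (hXr.trans (by
      change _ = Module.finrank ℝ (antilinearIntertwiners (SymmetryClass.CMatrix σ p)
        (SymmetryClass.CMatrix σ p)) + _
      rw [hAr, Nat.add_sub_cancel' hle]))
    (ψ := ψ) (norm_sq_fromRows hu1) hψr (F := fun M => u (toRows₁ M)) (hum.comp hrows)
    (fun k M => hi k k.2 (toRows₁ M)) hint
  rw [inv_two_rpow_half_eq_zpow hdb] at h1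
  exact ⟨Φ, h1, h2, h3⟩

/-- Polar integration for the unitary group. -/
theorem exists_integral_eq_of_top {n p : ℕ} (hp : p ≤ n) {P : Matrix (Fin p) (Fin n) ℂ}
    (hP : P * Pᴴ = 1) {K K' : Subgroup (GL (Fin n) ℂ)} [LocallyCompactSpace K]
    [LocallyCompactSpace K'] [LocallyCompactSpace (⊤ : Subgroup (GL (Fin p) ℂ))]
    (hKcl : IsClosed (K : Set (GL (Fin n) ℂ))) (hK'cl : IsClosed (K' : Set (GL (Fin n) ℂ)))
    (hK : K = ⊤ ⊓ unitaryGL (Fin n))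
    (hK' : ∀ k, k ∈ K' ↔ k ∈ K ∧ P * (k : Matrix (Fin n) (Fin n) ℂ) = P)
    {u : Matrix (Fin p) (Fin n) ℂ → ℂ} (hum : Measurable u) (hint : Integrable u volume)
    (hi : ∀ k ∈ K, ∀ L, u (L * ((k : GL (Fin n) ℂ) : Matrix (Fin n) (Fin n) ℂ)) = u L) :
    ∃ Φ : (⊤ : Subgroup (GL (Fin p) ℂ)) ⧸ unitaryPart (⊤ : Subgroup (GL (Fin p) ℂ)) → ℂ,
      (∀ g : (⊤ : Subgroup (GL (Fin p) ℂ)), Φ g =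
        u (((g : GL (Fin p) ℂ) : Matrix (Fin p) (Fin p) ℂ) * P) *
        (((2 : ℝ) ^ ((p : ℤ) ^ 2 - p * n) * ‖((g : GL (Fin p) ℂ) :
          Matrix (Fin p) (Fin p) ℂ).det‖ ^ (2 * n) : ℝ) : ℂ)) ∧
      Integrable Φ (symmetricMeasure 1 (⊤ : Subgroup (GL (Fin p) ℂ))) ∧
      ∫ L, u L = ((groupVolume 1 K / groupVolume 1 K' : ℝ) : ℂ) *
        ∫ x, Φ x ∂(symmetricMeasure 1 (⊤ : Subgroup (GL (Fin p) ℂ))) := by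
  subst hK
  have hle : p * p * 2 ≤ p * n * 2 := Nat.mul_le_mul_right _ (Nat.mul_le_mul_left _ hp)
  -- Here `X` and `A` are full complex matrix spaces, of real dimensions `2pn` and `2p²`; the
  -- natural subtraction is exact because `p ≤ n`.
  have hdb : (((p * n * 2 - p * p * 2 : ℕ) : ℤ)) = -2 * ((p : ℤ) ^ 2 - p * n) := by
    rw [Nat.cast_sub hle]
    push_cast
    ring
  have hfin : ∀ q : ℕ, Module.finrank ℝ (⊤ : Submodule ℝ (Matrix (Fin p) (Fin q) ℂ)) =
      p * q * 2 := fun q => by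
    rw [finrank_top, Module.finrank_matrix, Fintype.card_fin, Fintype.card_fin,
      Complex.finrank_real_complex]
  obtain ⟨Φ, h1, h2, h3⟩ := exists_integral_eq_mul_integral_symmetricMeasure
    (B := fullBimodule (Fin p) (Fin n)) (P := P) (c := 1) (N := 2 * n)
    (db := p * n * 2 - p * p * 2) (K := ⊤ ⊓ unitaryGL (Fin n)) (K' := K')
    (G := (⊤ : Subgroup (GL (Fin p) ℂ))) one_ne_zero (fun _ => Iff.rfl)
    (fun k => and_congr Iff.rfl Matrix.mem_unitaryGroup_iff) hKcl hK'cl hK' trivial hP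
    (fun g _ φ hφ => by
      have h := abs_det_eq_of_top hφ
      rwa [Fintype.card_fin] at h)
    ((hfin n).trans (by
      change _ = Module.finrank ℝ (⊤ : Submodule ℝ (Matrix (Fin p) (Fin p) ℂ)) + _
      rw [hfin, Nat.add_sub_cancel' hle]))
    (ψ := LinearMap.id) (fun L => by rw [LinearMap.id_apply, Nat.cast_one, one_mul])
    LinearMap.range_id (F := u) hum (fun k M => hi k k.2 M) hint
  rw [inv_two_rpow_half_eq_zpow hdb] at h1
  exact ⟨Φ, h1, h2, h3⟩

end SymmetryClasses

theorem mainTheorem3 (n p : ℕ) (S : SymmetryClass n)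
    -- rank K_p ≤ rank K_n, i.e. p ≤ n for GL and 2 p ≤ n for O and Sp
    (hrank : S.factor * p ≤ n)
    -- P is the orthogonal projector ℂⁿ = U_p ⊕ U_{n,p} → U_p
    (P : S.X p) (hP : P.1 * P.1ᴴ = 1)
    (f : Matrix (Fin p) (Fin n) ℂ × Matrix (Fin n) (Fin p) ℂ → ℂ)
    (hf : Differentiable ℂ f)
    (hinv : ∀ h ∈ S.G, ∀ (L : Matrix (Fin p) (Fin n) ℂ) (L' : Matrix (Fin n) (Fin p) ℂ),
      f (L * (h : Matrix (Fin n) (Fin n) ℂ), ((h⁻¹ : GL (Fin n) ℂ) : Matrix (Fin n) (Fin n) ℂ) * L')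
        = f (L, L'))
    (hS : IsSchwartz (SymmetryClass.realRestriction f)) :
    Integrable (SymmetryClass.realRestriction f) volume ∧
    -- the integrand on G_p / K_p is well defined and integrable
    ∃ Φ : S.Gp p ⧸ unitaryPart (S.Gp p) → ℂ,
      (∀ g : S.Gp p, Φ (g : S.Gp p ⧸ unitaryPart (S.Gp p)) =
        SymmetryClass.realRestriction f ((S.psi p).symm (S.translate g P)) * (S.J p g : ℂ)) ∧
      Integrable Φ (symmetricMeasure S.factor (S.Gp p)) ∧
      ∫ L : Matrix (Fin p) (Fin n) ℂ, SymmetryClass.realRestriction f L =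
        ((groupVolume S.factor S.K / groupVolume S.factor (S.Knp P) : ℝ) : ℂ) *
          ∫ x, Φ x ∂(symmetricMeasure S.factor (S.Gp p)) := by
  refine ⟨hS.integrable, ?_⟩
  have hcl := S.isClosed_K
  have hcl' := S.isClosed_Knp P
  have hi : ∀ k ∈ S.K, ∀ L, _ := fun k hk L => realRestriction_mul_of_unitary hinv hk L
  have hlc := (S.isClosed_Gp p).locallyCompactSpace
  cases S with
  | gl =>
    have : LocallyCompactSpace (⊤ : Subgroup (GL (Fin p) ℂ)) := hlc
    exact exists_integral_eq_of_top (by simpa [SymmetryClass.factor] using hrank) hP hcl hcl' rfl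
      (fun _ => Iff.rfl) hS.measurable hS.integrable hi
  | orth δ symm unit =>
    have : LocallyCompactSpace (antilinearCommutant (SymmetryClass.CMatrix 1 p)) := hlc
    exact exists_integral_eq_of_form (by simp) (by simp) hrank
      (SymmetryClass.mul_map_star_of_unitary (σ := 1) (by simp) (by simpa using symm) unit) unit
      P.2 hP hcl hcl' rfl (fun _ => Iff.rfl) hS.measurable hS.integrable hi
  | symp ε alt unit =>
    have : LocallyCompactSpace (antilinearCommutant (SymmetryClass.CMatrix (-1) p)) := hlc
    exact exists_integral_eq_of_form (by simp) (by simp) hrank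
      (SymmetryClass.mul_map_star_of_unitary (σ := -1) (by simp) (by simpa using alt) unit) unit
      P.2 hP hcl hcl' rfl (fun _ => Iff.rfl) hS.measurable hS.integrable hi
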